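/- Let $d\ge 1$ and $\mathbb T^d=[-\pi,\pi]^d/\!\sim$ be the torus. Let $\mathcal D(\mathbb T^d)$ be the space of real-valued $C^\infty$ functions on $\mathbb T^d$ and $\mathcal D'(\mathbb T^d)$ the space of complex-valued distributions. For a smooth $\varphi$ with compact support in $(-\pi,\pi)^d$, $\lambda\in(0,1]$ and $x\in\mathbb T^d$, let $\varphi_x^\lambda(y)=\lambda^{-d}\varphi((y-x)/\lambda)$, extended $2\pi$-periodically. *Hölder–Zygmund norms.* For $r\in\mathbb N_0$ let $\mathscr B^r$ be the set of real-valued $\varphi\in C_c^\infty((-\pi,\pi)^d)$ with $\|\partial^k\varphi\|_\infty\le1$ for all $|k|\le r$, and for $\alpha\ge0$ let $\mathscr B^r_\alpha$ be the set of those $\varphi\in\mathscr B^r$ with $\int\varphi(z)z^k\,dz=0$ for all $|k|\le\alpha$. For a real-valued distribution $f$ put $$|f|_\alpha=\sup_{\psi\in\mathcal D(\mathbb T^d),\,\|\psi\|_\infty\le1}|f(\psi)|+\sup_{x\in\mathbb T^d,\ \lambda\in\{2^{-n}:\,n\ge0\},\ \varphi\in\mathscr B^0_\alpha}\frac{|f(\varphi^\lambda_x)|}{\lambda^\alpha}\quad(\alpha\ge0),$$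 $$|f|_\alpha=\sup_{x\in\mathbb T^d,\ \lambda\in\{2^{-n}:\,n\ge0\},\ \varphi\in\mathscr B^r}\frac{|f(\varphi^\lambda_x)|}{\lambda^\alpha}\quad(\alpha<0),\qquad r=\lfloor-\alpha+1\rfloor,$$ and for complex-valued $f$ put $|f|_\alpha=(|\mathrm{Re} f|_\alpha^2+|\mathrm{Im} f|_\alpha^2)^{1/2}$. The little Hölder–Zygmund space $\mathcal Z_s^\alpha$ is the closure of $C^\infty(\mathbb T^d)$ in $\{f\in\mathcal D'(\mathbb T^d):|f|_\alpha<\infty\}$. Let $\widetilde{\mathscr B}^1$ be the set of real-valued $\varphi\in C_c^\infty(B_1(0))$, $B_1(0)\subset\mathbb R^d$ the open Euclidean unit ball, with $\|\partial^k\varphi\|_\infty\le1$ for all $|k|\le1$. **Proposition.** Let $\kappa\in(0,\tfrac12)$. There is a constant $C$, depending only on $d$ and $\kappa$, such that for every $\nu\in(2\kappa,1)$ the following holds. There is a unique continuous bilinear map (the Young product) $\mathcal Z_s^{\nu}\times\mathcal Z_s^{-\kappa}\to\mathcal Z_s^{-\kappa}$ that extends the usual product of smooth functions. Every $u\in\mathcal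 Z_s^\nu$ is given by a continuous function on $\mathbb T^d$, again denoted by $u$, and $u-u(x)\in\mathcal Z_s^\nu$ for every $x\in\mathbb T^d$. For all $u\in\mathcal Z_s^\nu$ and $\eta\in\mathcal Z_s^{-\kappa}$, $$\sup_{\substack{x\in\mathbb T^d,\ \lambda\in(0,1],\\ \varphi,\psi\in\widetilde{\mathscr B}^1}}\frac{\big|[(u-u(x))\eta]\big((\varphi\psi)^\lambda_x\big)\big|}{\lambda^{\nu-3\kappa}}\le C\,[u]_\nu\,|\eta|_{-\kappa}\qquad\text{and}\qquad [u]_\nu\,|\eta|_{-\kappa}\le C\,|u|_\nu\,|\eta|_{-\kappa},$$ where $(u-u(x))\eta$ is the Young product and $[u]_\nu=\sup_{x\in\mathbb T^d,\ 0<|y|\le1}|u(x+y)-u(x)|/|y|^\nu$. -/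

import Mathlib

open Set Filter Topology MeasureTheory TopologicalSpace
open scoped ENNReal NNReal ContDiff Distributions

noncomputable section

namespace HZ

/-- `ℝ^d` with its Euclidean norm. Functions on the torus `𝕋^d = [-π, π]^d / ∼` are regarded as
functions on `ℝ^d` which are `2π`-periodic in every coordinate. -/
abbrev Rd (d : ℕ) : Type := EuclideanSpace ℝ (Fin d)

/-- The point `2π n` of the period lattice. -/
def period {d : ℕ} (n : Fin d → ℤ) : Rd d :=
  WithLp.toLp 2 (fun i => 2 * Real.pi * (n i : ℝ))

/-- `f` is `2π`-periodic in every coordinate. -/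
def IsPeriodic {d : ℕ} {F : Type*} (f : Rd d → F) : Prop :=
  ∀ (n : Fin d → ℤ) (y : Rd d), f (y + period n) = f y

/-- The space `𝓓(𝕋^d)` of real-valued smooth functions on the torus. -/
def TestFn (d : ℕ) : Submodule ℝ (Rd d → ℝ) where
  carrier := {f | ContDiff ℝ ∞ f ∧ IsPeriodic f}
  add_mem' := by
    rintro f g ⟨hf, hf'⟩ ⟨hg, hg'⟩
    exact ⟨hf.add hg, fun n y => by simp [hf' n y, hg' n y]⟩
  zero_mem' := ⟨contDiff_const, fun _ _ => rfl⟩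
  smul_mem' := by
    rintro c f ⟨hf, hf'⟩
    exact ⟨contDiff_const.mul hf, fun n y => by simp [hf' n y]⟩

/-- The space `𝓓'(𝕋^d)` of (complex-valued) distributions on the torus: the linear functionals
that are continuous for the Fréchet topology of `𝓓(𝕋^d)`, i.e. bounded by a multiple of some
`C^N` norm. -/
def Dist (d : ℕ) : Submodule ℂ (TestFn d →ₗ[ℝ] ℂ) where
  carrier := {F | ∃ (C : ℝ) (N : ℕ), 0 ≤ C ∧ ∀ (φ : TestFn d) (B : ℝ),
    (∀ k ≤ N, ∀ y, ‖iteratedFDeriv ℝ k (φ : Rd d → ℝ) y‖ ≤ B) → ‖F φ‖ ≤ C * B}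
  add_mem' := by
    rintro F G ⟨C, N, hC, hF⟩ ⟨C', N', hC', hG⟩
    refine ⟨C + C', max N N', add_nonneg hC hC', fun φ B hB => ?_⟩
    have h1 := hF φ B fun k hk => hB k (hk.trans (le_max_left _ _))
    have h2 := hG φ B fun k hk => hB k (hk.trans (le_max_right _ _))
    calc ‖(F + G) φ‖ ≤ ‖F φ‖ + ‖G φ‖ := norm_add_le _ _
      _ ≤ (C + C') * B := by linarith
  zero_mem' := ⟨0, 0, le_rfl, fun φ B _ => by simp⟩
  smul_mem' := by
    rintro c F ⟨C, N, hC, hF⟩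
    refine ⟨‖c‖ * C, N, mul_nonneg (norm_nonneg _) hC, fun φ B hB => ?_⟩
    have h1 := hF φ B hB
    calc ‖(c • F) φ‖ = ‖c‖ * ‖F φ‖ := by simp
      _ ≤ ‖c‖ * (C * B) := by gcongr
      _ = ‖c‖ * C * B := by ring

/-- The fundamental domain `(-π, π]^d` of the torus. -/
def cell (d : ℕ) : Set (Rd d) := {y | ∀ i, y i ∈ Ioc (-Real.pi) Real.pi}

theorem cell_subset (d : ℕ) : cell d ⊆ Metric.closedBall 0 (Real.sqrt (d * Real.pi ^ 2)) := by
  intro y hy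
  rw [mem_closedBall_zero_iff, EuclideanSpace.norm_eq]
  apply Real.sqrt_le_sqrt
  calc ∑ i, ‖y i‖ ^ 2 ≤ ∑ _i : Fin d, Real.pi ^ 2 := by
        apply Finset.sum_le_sum
        intro i _
        have h := hy i
        rw [Real.norm_eq_abs, sq_abs]
        exact sq_le_sq' h.1.le h.2
    _ = d * Real.pi ^ 2 := by simp

theorem integrableOn_cell {d : ℕ} {u : Rd d → ℂ} (hu : Continuous u) :
    IntegrableOn u (cell d) :=
  (hu.continuousOn.integrableOn_compact (isCompact_closedBall _ _)).mono_set (cell_subset d)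

/-- The distribution `φ ↦ ∫_{𝕋^d} u φ` of a continuous function `u`. -/
def ofFun (d : ℕ) : C(Rd d, ℂ) →ₗ[ℂ] Dist d where
  toFun u := ⟨{ toFun := fun φ => ∫ y in cell d, ((φ : Rd d → ℝ) y : ℂ) * u y
                map_add' := by
                  intro φ ψ
                  rw [← integral_add]
                  · congr 1
                    ext y
                    simp [add_mul]
                  · exact integrableOn_cell
                      ((Complex.continuous_ofReal.comp φ.2.1.continuous).mul u.continuous)
                  · exact integrableOn_cell
                      ((Complex.continuous_ofReal.comp ψ.2.1.continuous).mul u.continuous)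
                map_smul' := by
                  intro c φ
                  simp [mul_assoc, integral_const_mul] }, by
      refine ⟨∫ y in cell d, ‖u y‖, 0, integral_nonneg fun _ => norm_nonneg _, fun φ B hB => ?_⟩
      have hφ : ∀ y, ‖(φ : Rd d → ℝ) y‖ ≤ B := fun y => by
        simpa using hB 0 le_rfl y
      calc ‖∫ y in cell d, ((φ : Rd d → ℝ) y : ℂ) * u y‖
          ≤ ∫ y in cell d, B * ‖u y‖ := by
            apply norm_integral_le_of_norm_le
            · exact (integrableOn_cell u.continuous).norm.const_mul B
            · refine Eventually.of_forall fun y => ?_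
              rw [norm_mul, Complex.norm_real]
              exact mul_le_mul_of_nonneg_right (hφ y) (norm_nonneg _)
        _ = (∫ y in cell d, ‖u y‖) * B := by rw [integral_const_mul, mul_comm]⟩
  map_add' := by
    intro u v
    apply Subtype.ext
    apply LinearMap.ext
    intro φ
    change (∫ y in cell d, ((φ : Rd d → ℝ) y : ℂ) * (u + v) y) =
      (∫ y in cell d, ((φ : Rd d → ℝ) y : ℂ) * u y) + ∫ y in cell d, ((φ : Rd d → ℝ) y : ℂ) * v y
    rw [← integral_add]
    · congr 1
      ext y
      simp [mul_add]
    · exact integrableOn_cell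
        ((Complex.continuous_ofReal.comp φ.2.1.continuous).mul u.continuous)
    · exact integrableOn_cell
        ((Complex.continuous_ofReal.comp φ.2.1.continuous).mul v.continuous)
  map_smul' := by
    intro c u
    apply Subtype.ext
    apply LinearMap.ext
    intro φ
    change (∫ y in cell d, ((φ : Rd d → ℝ) y : ℂ) * (c • u) y) =
      c * ∫ y in cell d, ((φ : Rd d → ℝ) y : ℂ) * u y
    rw [← integral_const_mul]
    congr 1
    ext y
    simp
    ring

/-! ### Localized test functions and their rescalings -/

/-- The open cube `(-π, π)^d`. -/
def cube (d : ℕ) : Opens (Rd d) :=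
  ⟨{y | ∀ i, y i ∈ Ioo (-Real.pi) Real.pi}, by
    simp only [Set.ofPred_forall]
    exact isOpen_iInter_of_finite fun i =>
      isOpen_Ioo.preimage (f := fun y : Rd d => y i) (by fun_prop)⟩

/-- The open unit ball `B_1(0)`. -/
def unitBall (d : ℕ) : Opens (Rd d) := ⟨Metric.ball 0 1, Metric.isOpen_ball⟩

/-- The pointwise product of two test functions. -/
def prodTest {d : ℕ} {Ω : Opens (Rd d)} (φ ψ : 𝓓(Ω, ℝ)) : 𝓓(Ω, ℝ) where
  toFun := fun y => φ y * ψ y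
  contDiff' := φ.contDiff.mul ψ.contDiff
  hasCompactSupport' := φ.hasCompactSupport.mul_right
  tsupport_subset' := (tsupport_mul_subset_left).trans φ.tsupport_subset

/-- The `2π`-periodic extension of `y ↦ l^{-d} φ((y - x) / l)`. When `φ` is supported in
`(-π, π)^d` and `0 < l ≤ 1`, at most one term of the sum is nonzero. -/
def rescaleFun {d : ℕ} (φ : Rd d → ℝ) (l : ℝ) (x : Rd d) : Rd d → ℝ :=
  fun y => ∑ᶠ n : Fin d → ℤ, (l ^ d)⁻¹ * φ (l⁻¹ • (y - x + period n))

theorem period_add {d : ℕ} (m n : Fin d → ℤ) :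
    (period (m + n) : Rd d) = period m + period n := by
  ext i
  simp [period, mul_add]

theorem rescaleFun_periodic {d : ℕ} (φ : Rd d → ℝ) (l : ℝ) (x : Rd d) :
    IsPeriodic (rescaleFun φ l x) := by
  intro m y
  unfold rescaleFun
  rw [← finsum_comp_equiv (Equiv.addLeft m)
    (f := fun n => (l ^ d)⁻¹ * φ (l⁻¹ • (y - x + period n)))]
  refine finsum_congr fun n => ?_
  simp only [Equiv.coe_addLeft, period_add]
  congr 3
  abel

theorem rescaleFun_contDiff {d : ℕ} {φ : Rd d → ℝ} (hφ : ContDiff ℝ ∞ φ)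
    (hc : HasCompactSupport φ) (l : ℝ) (x : Rd d) : ContDiff ℝ ∞ (rescaleFun φ l x) := by
  rcases eq_or_ne l 0 with rfl | hl
  · have : rescaleFun φ 0 x = fun _ => rescaleFun φ 0 x 0 := by
      funext y
      simp [rescaleFun]
    rw [this]
    exact contDiff_const
  obtain ⟨R, hR⟩ := hc.isCompact.isBounded.subset_closedBall (0 : Rd d)
  have hterm : ∀ n : Fin d → ℤ,
      ContDiff ℝ ∞ fun y : Rd d => (l ^ d)⁻¹ * φ (l⁻¹ • (y - x + period n)) := by
    intro n
    exact contDiff_const.mul (hφ.comp (by fun_prop))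
  rw [contDiff_iff_contDiffAt]
  intro y₀
  obtain ⟨N, hN⟩ := exists_nat_ge (|l| * R + ‖y₀‖ + 1 + ‖x‖)
  set S : Set (Fin d → ℤ) := Icc (fun _ => -(N : ℤ)) (fun _ => (N : ℤ)) with hS
  have hSf : S.Finite := finite_Icc _ _
  have key : ∀ y ∈ Metric.ball y₀ 1, rescaleFun φ l x y =
      ∑ n ∈ hSf.toFinset, (l ^ d)⁻¹ * φ (l⁻¹ • (y - x + period n)) := by
    intro y hy
    apply finsum_eq_sum_of_support_subset
    intro n hn
    rw [Set.Finite.coe_toFinset]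
    have h1 : φ (l⁻¹ • (y - x + period n)) ≠ 0 := right_ne_zero_of_mul hn
    have h2 : ‖l⁻¹ • (y - x + period n)‖ ≤ R :=
      mem_closedBall_zero_iff.1 (hR (subset_tsupport φ h1))
    have h3 : ‖y - x + period n‖ ≤ |l| * R := by
      have : y - x + period n = l • (l⁻¹ • (y - x + period n)) := by
        rw [smul_inv_smul₀ hl]
      rw [this, norm_smul, Real.norm_eq_abs]
      gcongr
    have h4 : ‖y‖ ≤ ‖y₀‖ + 1 := by
      have h := norm_le_norm_add_norm_sub' y y₀
      have h' : ‖y - y₀‖ < 1 := by simpa [dist_eq_norm] using hy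
      linarith
    have h5 : ‖(period n : Rd d)‖ ≤ N := by
      have : (period n : Rd d) = (y - x + period n) - y + x := by abel
      rw [this]
      have h6 := norm_add_le ((y - x + period n) - y) x
      have h7 := norm_sub_le (y - x + period n) y
      linarith
    have h8 : ∀ i, |(n i : ℝ)| ≤ N := by
      intro i
      have h9 : ‖(period n : Rd d) i‖ ≤ N := (PiLp.norm_apply_le _ i).trans h5
      simp only [period, Real.norm_eq_abs, abs_mul, abs_of_pos Real.pi_pos, abs_two] at h9
      have := Real.two_le_pi
      nlinarith [abs_nonneg (n i : ℝ)]
    constructor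
    · intro i
      exact_mod_cast (abs_le.1 (h8 i)).1
    · intro i
      exact_mod_cast (abs_le.1 (h8 i)).2
  have h : ContDiffAt ℝ ∞
      (fun y => ∑ n ∈ hSf.toFinset, (l ^ d)⁻¹ * φ (l⁻¹ • (y - x + period n))) y₀ :=
    (ContDiff.sum fun n _ => hterm n).contDiffAt
  refine h.congr_of_eventuallyEq ?_
  filter_upwards [Metric.ball_mem_nhds y₀ one_pos] with y hy using key y hy

/-- The rescaled centered test function `φ_x^l ∈ 𝓓(𝕋^d)`, `φ_x^l(y) = l^{-d} φ((y - x) / l)`. -/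
def rescale {d : ℕ} {Ω : Opens (Rd d)} (φ : 𝓓(Ω, ℝ)) (l : ℝ) (x : Rd d) : TestFn d :=
  ⟨rescaleFun φ l x, rescaleFun_contDiff φ.contDiff φ.hasCompactSupport l x,
    rescaleFun_periodic φ l x⟩

/-- The class of the test functions `φ` supported in `Ω` all of whose partial derivatives of
order at most `r` (including `φ` itself) are bounded by `1`. -/
def classB {d : ℕ} (Ω : Opens (Rd d)) (r : ℕ) : Set 𝓓(Ω, ℝ) :=
  {φ | ∀ m ≤ r, ∀ (i : Fin m → Fin d) (y : Rd d),
    |iteratedFDeriv ℝ m φ y (fun j => EuclideanSpace.single (i j) (1 : ℝ))| ≤ 1}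

/-- The class of the test functions `φ` supported in `Ω` that annihilate all monomials of degree
at most `α`. -/
def classVanish {d : ℕ} (Ω : Opens (Rd d)) (α : ℝ) : Set 𝓓(Ω, ℝ) :=
  {φ | ∀ k : Fin d → ℕ, ((∑ i, k i : ℕ) : ℝ) ≤ α → ∫ z, φ z * ∏ i, z i ^ k i = 0}

/-! ### Hölder–Zygmund norms and spaces -/

/-- `sup |F(φ_x^l)| / l^α` over `x ∈ 𝕋^d`, dyadic `l = 2^{-n}` and `φ` in the class `T`. -/
def scaledSup {d : ℕ} (T : Set 𝓓(cube d, ℝ)) (α : ℝ) (F : TestFn d → ℝ) : ℝ≥0∞ :=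
  ⨆ (x : Rd d) (n : ℕ) (φ ∈ T),
    ‖F (rescale φ ((2 : ℝ)⁻¹ ^ n) x)‖ₑ / ENNReal.ofReal (((2 : ℝ)⁻¹ ^ n) ^ α)

/-- The Hölder–Zygmund norm of order `α` of a real-valued distribution. -/
def hzSup {d : ℕ} (α : ℝ) (F : TestFn d → ℝ) : ℝ≥0∞ :=
  if 0 ≤ α then
    (⨆ (ψ : TestFn d) (_ : ∀ y, |(ψ : Rd d → ℝ) y| ≤ 1), ‖F ψ‖ₑ) +
      scaledSup (classB (cube d) 0 ∩ classVanish (cube d) α) α F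
  else scaledSup (classB (cube d) ⌊-α + 1⌋₊) α F

/-- The Hölder–Zygmund norm `|f|_α = (|Re f|_α² + |Im f|_α²)^{1/2}` of a complex-valued
distribution, with values in `[0, ∞]`. -/
def hzNorm {d : ℕ} (α : ℝ) (f : Dist d) : ℝ≥0∞ :=
  (hzSup α (fun φ => (f.1 φ).re) ^ 2 + hzSup α (fun φ => (f.1 φ).im) ^ 2) ^ (1 / 2 : ℝ)

theorem scaledSup_le {d : ℕ} (T : Set 𝓓(cube d, ℝ)) (α : ℝ) {F G H : TestFn d → ℝ} {a b : ℝ≥0∞}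
    (h : ∀ φ, ‖H φ‖ₑ ≤ a * ‖F φ‖ₑ + b * ‖G φ‖ₑ) :
    scaledSup T α H ≤ a * scaledSup T α F + b * scaledSup T α G := by
  refine iSup_le fun x => iSup_le fun n => iSup₂_le fun φ hφ => ?_
  have hle : ∀ F : TestFn d → ℝ, ‖F (rescale φ ((2 : ℝ)⁻¹ ^ n) x)‖ₑ /
      ENNReal.ofReal (((2 : ℝ)⁻¹ ^ n) ^ α) ≤ scaledSup T α F := fun F =>
    le_iSup_of_le x (le_iSup_of_le n (le_iSup₂_of_le φ hφ le_rfl))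
  calc _ ≤ (a * ‖F (rescale φ ((2 : ℝ)⁻¹ ^ n) x)‖ₑ + b * ‖G (rescale φ ((2 : ℝ)⁻¹ ^ n) x)‖ₑ) /
        ENNReal.ofReal (((2 : ℝ)⁻¹ ^ n) ^ α) := ENNReal.div_le_div_right (h _) _
    _ = a * (‖F (rescale φ ((2 : ℝ)⁻¹ ^ n) x)‖ₑ / ENNReal.ofReal (((2 : ℝ)⁻¹ ^ n) ^ α)) +
        b * (‖G (rescale φ ((2 : ℝ)⁻¹ ^ n) x)‖ₑ / ENNReal.ofReal (((2 : ℝ)⁻¹ ^ n) ^ α)) := by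
        rw [ENNReal.add_div, mul_div_assoc, mul_div_assoc]
    _ ≤ _ := by
        gcongr
        · exact hle F
        · exact hle G

theorem hzSup_le {d : ℕ} (α : ℝ) {F G H : TestFn d → ℝ} {a b : ℝ≥0∞}
    (h : ∀ φ, ‖H φ‖ₑ ≤ a * ‖F φ‖ₑ + b * ‖G φ‖ₑ) :
    hzSup α H ≤ a * hzSup α F + b * hzSup α G := by
  unfold hzSup
  split_ifs with hα
  · have h1 : (⨆ (ψ : TestFn d) (_ : ∀ y, |(ψ : Rd d → ℝ) y| ≤ 1), ‖H ψ‖ₑ) ≤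
        a * (⨆ (ψ : TestFn d) (_ : ∀ y, |(ψ : Rd d → ℝ) y| ≤ 1), ‖F ψ‖ₑ) +
        b * (⨆ (ψ : TestFn d) (_ : ∀ y, |(ψ : Rd d → ℝ) y| ≤ 1), ‖G ψ‖ₑ) := by
      refine iSup₂_le fun ψ hψ => (h ψ).trans ?_
      gcongr
      · exact le_iSup₂ (f := fun (ψ : TestFn d)
          (_ : ∀ y, |(ψ : Rd d → ℝ) y| ≤ 1) => ‖F ψ‖ₑ) ψ hψ
      · exact le_iSup₂ (f := fun (ψ : TestFn d)
          (_ : ∀ y, |(ψ : Rd d → ℝ) y| ≤ 1) => ‖G ψ‖ₑ) ψ hψ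
    refine (add_le_add h1 (scaledSup_le _ α h)).trans (le_of_eq ?_)
    ring
  · exact scaledSup_le _ α h

theorem sqrt_sq_add_le (s t : ℝ≥0∞) : (s ^ 2 + t ^ 2) ^ (1 / 2 : ℝ) ≤ s + t := by
  calc (s ^ 2 + t ^ 2) ^ (1 / 2 : ℝ) ≤ ((s + t) ^ 2) ^ (1 / 2 : ℝ) := by
        gcongr
        rw [add_sq]
        calc s ^ 2 + t ^ 2 ≤ (s ^ 2 + t ^ 2) + 2 * s * t := le_self_add
          _ = _ := by ring
    _ = s + t := by
        rw [← ENNReal.rpow_natCast, ← ENNReal.rpow_mul]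
        norm_num

theorem le_sqrt_sq_add (s t : ℝ≥0∞) : s ≤ (s ^ 2 + t ^ 2) ^ (1 / 2 : ℝ) := by
  calc s = (s ^ 2) ^ (1 / 2 : ℝ) := by
        rw [← ENNReal.rpow_natCast, ← ENNReal.rpow_mul]
        norm_num
    _ ≤ _ := by
        gcongr
        exact le_self_add

theorem hzSup_part_le {d : ℕ} (α : ℝ) {f g h : Dist d} {a b : ℝ≥0∞}
    (hh : ∀ φ, ‖h.1 φ‖ₑ ≤ a * ‖f.1 φ‖ₑ + b * ‖g.1 φ‖ₑ) (p : ℂ → ℝ) (hp : ∀ z, |p z| ≤ ‖z‖) :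
    hzSup α (fun φ => p (h.1 φ)) ≤ 2 * (a * hzNorm α f + b * hzNorm α g) := by
  have hz : ∀ z : ℂ, ‖z‖ₑ ≤ ‖z.re‖ₑ + ‖z.im‖ₑ := by
    intro z
    rw [← ofReal_norm, ← ofReal_norm, ← ofReal_norm, ← ENNReal.ofReal_add (norm_nonneg _)
      (norm_nonneg _)]
    exact ENNReal.ofReal_le_ofReal (Complex.norm_le_abs_re_add_abs_im z)
  have habs : ∀ (f : Dist d), hzSup α (fun φ => ‖f.1 φ‖) ≤ 2 * hzNorm α f := by
    intro f
    have h1 : hzSup α (fun φ => ‖f.1 φ‖) ≤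
        1 * hzSup α (fun φ => (f.1 φ).re) + 1 * hzSup α (fun φ => (f.1 φ).im) :=
      hzSup_le α fun φ => by simpa using hz (f.1 φ)
    refine h1.trans ?_
    rw [one_mul, one_mul, two_mul]
    refine add_le_add (le_sqrt_sq_add _ _) ?_
    unfold hzNorm
    rw [add_comm]
    exact le_sqrt_sq_add _ _
  have h2 : hzSup α (fun φ => p (h.1 φ)) ≤
      a * hzSup α (fun φ => ‖f.1 φ‖) + b * hzSup α (fun φ => ‖g.1 φ‖) := by
    refine hzSup_le α fun φ => ?_
    rw [enorm_norm, enorm_norm]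
    refine le_trans ?_ (hh φ)
    rw [← ofReal_norm, ← ofReal_norm]
    exact ENNReal.ofReal_le_ofReal (hp _)
  refine h2.trans ?_
  calc _ ≤ a * (2 * hzNorm α f) + b * (2 * hzNorm α g) := by
        gcongr
        · exact habs f
        · exact habs g
    _ = _ := by ring

theorem hzNorm_le {d : ℕ} (α : ℝ) {f g h : Dist d} {a b : ℝ≥0∞}
    (hh : ∀ φ, ‖h.1 φ‖ₑ ≤ a * ‖f.1 φ‖ₑ + b * ‖g.1 φ‖ₑ) :
    hzNorm α h ≤ 4 * (a * hzNorm α f + b * hzNorm α g) := by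
  refine (sqrt_sq_add_le _ _).trans ?_
  refine (add_le_add (hzSup_part_le α hh Complex.re Complex.abs_re_le_norm)
    (hzSup_part_le α hh Complex.im Complex.abs_im_le_norm)).trans (le_of_eq ?_)
  ring

theorem hzNorm_zero {d : ℕ} (α : ℝ) : hzNorm α (0 : Dist d) = 0 := by
  have h := hzNorm_le α (f := (0 : Dist d)) (g := 0) (h := 0) (a := 0) (b := 0)
    (fun φ => by simp)
  simpa using h

theorem hzNorm_add_le {d : ℕ} (α : ℝ) (f g : Dist d) :
    hzNorm α (f + g) ≤ 4 * (hzNorm α f + hzNorm α g) := by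
  have h := hzNorm_le α (f := f) (g := g) (h := f + g) (a := 1) (b := 1)
    (fun φ => by simpa using enorm_add_le (f.1 φ) (g.1 φ))
  simpa using h

theorem hzNorm_smul_le {d : ℕ} (α : ℝ) (c : ℂ) (f : Dist d) :
    hzNorm α (c • f) ≤ 4 * (‖c‖ₑ * hzNorm α f) := by
  have h := hzNorm_le α (f := f) (g := 0) (h := c • f) (a := ‖c‖ₑ) (b := 0)
    (fun φ => by simp [enorm_mul])
  simpa using h

/-- The little Hölder–Zygmund space of order `α`: the closure of `C^∞(𝕋^d)` in the
Hölder–Zygmund space `{f ∈ 𝓓'(𝕋^d) : |f|_α < ∞}`. -/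
def LittleHZ (d : ℕ) (α : ℝ) : Submodule ℂ (Dist d) where
  carrier := {f | hzNorm α f < ⊤ ∧ ∀ ε : ℝ≥0∞, 0 < ε → ∃ g : C(Rd d, ℂ),
    IsPeriodic g ∧ ContDiff ℝ ∞ g ∧ hzNorm α (f - ofFun d g) < ε}
  add_mem' := by
    rintro f₁ f₂ ⟨h₁, h₁'⟩ ⟨h₂, h₂'⟩
    refine ⟨(hzNorm_add_le α f₁ f₂).trans_lt (ENNReal.mul_lt_top (by simp)
      (ENNReal.add_lt_top.2 ⟨h₁, h₂⟩)), fun ε hε => ?_⟩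
    have hε' : 0 < ε / 4 / 2 :=
      ENNReal.div_pos (ENNReal.div_pos hε.ne' (by simp)).ne' (by simp)
    obtain ⟨g₁, hp₁, hs₁, hg₁⟩ := h₁' _ hε'
    obtain ⟨g₂, hp₂, hs₂, hg₂⟩ := h₂' _ hε'
    refine ⟨g₁ + g₂, fun n y => by simp [hp₁ n y, hp₂ n y], hs₁.add hs₂, ?_⟩
    have e : f₁ + f₂ - ofFun d (g₁ + g₂) = (f₁ - ofFun d g₁) + (f₂ - ofFun d g₂) := by
      rw [map_add]
      abel
    rw [e]
    refine (hzNorm_add_le α _ _).trans_lt ?_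
    calc _ < 4 * (ε / 4) := by
          refine (ENNReal.mul_lt_mul_iff_right (by simp) (by simp)).2 ?_
          exact (ENNReal.add_lt_add hg₁ hg₂).trans_eq (ENNReal.add_halves _)
      _ = ε := ENNReal.mul_div_cancel (by simp) (by simp)
  zero_mem' := by
    refine ⟨by simp [hzNorm_zero], fun ε hε => ⟨0, fun _ _ => rfl, contDiff_const, ?_⟩⟩
    simpa [hzNorm_zero] using hε
  smul_mem' := by
    rintro c f ⟨h, h'⟩
    refine ⟨(hzNorm_smul_le α c f).trans_lt (ENNReal.mul_lt_top (by simp)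
      (ENNReal.mul_lt_top (by simp) h)), fun ε hε => ?_⟩
    rcases eq_or_ne c 0 with rfl | hc
    · refine ⟨0, fun _ _ => rfl, contDiff_const, ?_⟩
      simpa [hzNorm_zero] using hε
    have hc' : ‖c‖ₑ ≠ 0 := by simpa using hc
    have hε' : 0 < ε / 4 / ‖c‖ₑ :=
      ENNReal.div_pos (ENNReal.div_pos hε.ne' (by simp)).ne' (by simp)
    obtain ⟨g, hp, hs, hg⟩ := h' _ hε'
    refine ⟨c • g, fun n y => by simp [hp n y], contDiff_const.mul hs, ?_⟩
    rw [map_smul, ← smul_sub]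
    refine (hzNorm_smul_le α _ _).trans_lt ?_
    calc _ < 4 * (‖c‖ₑ * (ε / 4 / ‖c‖ₑ)) := by
          refine (ENNReal.mul_lt_mul_iff_right (by simp) (by simp)).2 ?_
          exact (ENNReal.mul_lt_mul_iff_right hc' (by simp)).2 hg
      _ = ε := by
          rw [ENNReal.mul_div_cancel hc' (by simp), ENNReal.mul_div_cancel (by simp) (by simp)]

/-- The Hölder seminorm `[u]_ν = sup_{x, |y| ≤ 1} |u(x + y) - u(x)| / |y|^ν`. -/
def holderSeminorm {d : ℕ} (ν : ℝ) (u : Rd d → ℂ) : ℝ≥0∞ :=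
  ⨆ (x : Rd d) (y : Rd d) (_ : ‖y‖ ≤ 1), ‖u (x + y) - u x‖ₑ / ENNReal.ofReal (‖y‖ ^ ν)

/-- `M` is a Young product on the little spaces of orders `α` and `β`: a continuous bilinear map
(continuity of a bilinear map being boundedness) that extends the usual product of smooth
functions. -/
def IsYoungProduct {d : ℕ} {α β : ℝ}
    (M : LittleHZ d α →ₗ[ℂ] LittleHZ d β →ₗ[ℂ] LittleHZ d β) : Prop :=
  (∃ K : ℝ≥0, ∀ (f : LittleHZ d α) (g : LittleHZ d β),
    hzNorm β (M f g).1 ≤ K * (hzNorm α f.1 * hzNorm β g.1)) ∧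
  ∀ (f g : C(Rd d, ℂ)), IsPeriodic f → ContDiff ℝ ∞ f → IsPeriodic g → ContDiff ℝ ∞ g →
    ∀ (hf : ofFun d f ∈ LittleHZ d α) (hg : ofFun d g ∈ LittleHZ d β),
      (M ⟨ofFun d f, hf⟩ ⟨ofFun d g, hg⟩).1 = ofFun d (f * g)

end HZ

end

/-!
The product of a `ν`-Hölder function `u` and a distribution `η` of order `-κ` with `2κ < ν` is
obtained by continuity from the products `u g`, with `g` smooth and close to `η`. Everything rests
on estimates for continuous periodic functions with constants depending only on `d` and `κ`.

*Multiscale estimate* (`norm_integral_mul_le`). Let `Sₙ` be the average at scale `2^{-n}` against a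
fixed smooth probability density. If `‖Sₙ g‖_∞ ≤ A 2^{nκ}` for all `n` and `h` is compactly
supported, bounded by `H` and `ν`-Hölder with constant `H`, then `|∫ g h| ≤ C A H`. The integrals
`Tₙ = ∫ (Sₙ Sₙ₊₁ g) h` converge to `∫ g h`. Since the averages commute, `Tₙ₊₁ - Tₙ` is the integral
of `Sₙ₊₁ g`, of size `2^{nκ}`, against `(Sₙ₊₂* - Sₙ*) h`, of size `2^{-nν}`; as `ν - κ > κ`, the
increments are dominated by a geometric series of ratio `2^{-κ}`, uniformly in `ν`.

*Local estimate* (`exists_norm_integral_increment_le`). After a change of variables to unit scale,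
the function `(u - u(x)) φ_x^l` satisfies the hypotheses on `h` with `H` of order `[u]_ν l^ν`, and
the averages of `g` are of order `l^{-κ} 2^{nκ}` times `|g|_{-κ}`. Hence `(u - u(x)) g` tested
against `φ_x^l` is of order `l^{ν-κ} ≤ l^{ν-3κ}`. Writing `u = (u - u(x)) + u(x)` yields
`|u g|_{-κ} ≤ C |u|_ν |g|_{-κ}` (`exists_hzNorm_mul_le`).

*Hölder regularity* (`exists_holder_bound`). Averages of `u` at consecutive scales, or at the same
scale around nearby points, differ by a test function of mean zero, so the norm `|u|_ν` controls the
telescoping sum from `Sₙ u (x)` to `u(x)`, and thereby `‖u‖_∞` and `[u]_ν`.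

*Completeness and uniqueness* (`exists_norm_apply_le`). A finite partition of unity bounds a
distribution of order `-κ` by its norm times the `C^1` norm of the test function. So the norm
separates distributions, and Cauchy sequences converge. The product is therefore well defined as a
limit (`exists_product`), and it is bilinear and bounded. Smooth functions being dense, it is the
only continuous extension of their usual product, and the local estimate passes to the limit.
-/

namespace HZ

/-! ### The period lattice and unfolding of integrals over the torus -/

theorem period_neg {d : ℕ} (n : Fin d → ℤ) : (period (-n) : Rd d) = -period n := by
  ext i
  simp [period]

theorem exists_add_period_mem_cell {d : ℕ} (y : Rd d) :
    ∃ n : Fin d → ℤ, y + period n ∈ cell d := by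
  have h : ∀ i, ∃ m : ℤ, y i + m • (2 * Real.pi) ∈ Ioc (-Real.pi) (-Real.pi + 2 * Real.pi) :=
    fun i => (existsUnique_add_zsmul_mem_Ioc Real.two_pi_pos (y i) (-Real.pi)).exists
  choose n hn using h
  refine ⟨n, fun i => ?_⟩
  have := hn i
  simp only [zsmul_eq_mul] at this
  simp only [period, PiLp.add_apply]
  constructor
  · have := this.1; linarith
  · have := this.2; linarith

theorem eq_of_add_period_mem_cell {d : ℕ} {y : Rd d} {m n : Fin d → ℤ}
    (hm : y + period m ∈ cell d) (hn : y + period n ∈ cell d) : m = n := by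
  funext i
  have hu := (existsUnique_add_zsmul_mem_Ioc Real.two_pi_pos (y i) (-Real.pi)).unique
    (y₁ := m i) (y₂ := n i)
  refine hu ?_ ?_
  · have := hm i
    simp only [period, PiLp.add_apply] at this
    simp only [zsmul_eq_mul]
    constructor
    · have := this.1; linarith
    · have := this.2; linarith
  · have := hn i
    simp only [period, PiLp.add_apply] at this
    simp only [zsmul_eq_mul]
    constructor
    · have := this.1; linarith
    · have := this.2; linarith

theorem measurableSet_cell (d : ℕ) : MeasurableSet (cell d) := by
  have : cell d = ⋂ i, (fun y : Rd d => y i) ⁻¹' Ioc (-Real.pi) Real.pi := by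
    ext y
    simp [cell]
  rw [this]
  refine MeasurableSet.iInter fun i => ?_
  have hc : Continuous fun y : Rd d => y i := by fun_prop
  exact hc.measurable measurableSet_Ioc

/-- A continuous periodic function is bounded. -/
theorem IsPeriodic.exists_bound {d : ℕ} {F : Type*} [SeminormedAddCommGroup F] {u : Rd d → F}
    (hu : IsPeriodic u) (hc : Continuous u) : ∃ B, ∀ y, ‖u y‖ ≤ B := by
  obtain ⟨B, hB⟩ := (isCompact_closedBall (0 : Rd d)
    (Real.sqrt (d * Real.pi ^ 2))).exists_bound_of_continuousOn hc.continuousOn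
  refine ⟨B, fun y => ?_⟩
  obtain ⟨n, hn⟩ := exists_add_period_mem_cell y
  rw [← hu n y]
  exact hB _ (cell_subset d hn)

/-- The translates of the cell by the period lattice tile the space. -/
theorem hasSum_setIntegral_cell {d : ℕ} (f : Rd d → ℂ) (hf : Integrable f) :
    HasSum (fun n : Fin d → ℤ => ∫ y in cell d, f (y + period n)) (∫ y, f y) := by
  have hmeas : ∀ n : Fin d → ℤ, MeasurableSet ((fun y : Rd d => y + period (-n)) ⁻¹' cell d) :=
    fun n => (measurable_add_const _) (measurableSet_cell d)
  have hcov : ⋃ n : Fin d → ℤ, (fun y : Rd d => y + period (-n)) ⁻¹' cell d = univ := by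
    refine eq_univ_of_forall fun y => mem_iUnion.2 ?_
    obtain ⟨n, hn⟩ := exists_add_period_mem_cell y
    exact ⟨-n, by simpa using hn⟩
  have hdisj : Pairwise (Function.onFun Disjoint
      fun n : Fin d → ℤ => (fun y : Rd d => y + period (-n)) ⁻¹' cell d) := by
    intro m n hmn
    refine Set.disjoint_left.2 fun y hy hy' => hmn ?_
    exact neg_injective (eq_of_add_period_mem_cell hy hy')
  have h := hasSum_integral_iUnion (μ := volume) hmeas hdisj (f := f) hf.integrableOn
  rw [hcov, Measure.restrict_univ] at h
  refine (congrArg (HasSum · (∫ y, f y)) (funext fun n => ?_)).mp h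
  have hmp : MeasurePreserving (fun y : Rd d => y + period (-n)) volume volume :=
    measurePreserving_add_right _ _
  have := hmp.setIntegral_preimage_emb (measurableEmbedding_addRight _)
    (fun y => f (y + period n)) (cell d)
  refine Eq.trans ?_ this
  refine integral_congr_ae (Eventually.of_forall fun y => ?_)
  simp [period_neg]

/-- Locally in `y`, only finitely many terms of the periodization are nonzero. -/
theorem exists_finset_period {d : ℕ} {φ : Rd d → ℝ} (hc : HasCompactSupport φ) {l : ℝ}
    (hl : l ≠ 0) (x : Rd d) (ρ : ℝ) :
    ∃ S : Finset (Fin d → ℤ), ∀ y, ‖y‖ ≤ ρ → ∀ n ∉ S, φ (l⁻¹ • (y - x + period n)) = 0 := by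
  obtain ⟨R, hR⟩ := hc.isCompact.isBounded.subset_closedBall (0 : Rd d)
  obtain ⟨N, hN⟩ := exists_nat_ge (|l| * R + ρ + ‖x‖)
  refine ⟨Finset.Icc (fun _ => -(N : ℤ)) (fun _ => (N : ℤ)), fun y hy n hn => ?_⟩
  by_contra h1
  refine hn ?_
  have h2 : ‖l⁻¹ • (y - x + period n)‖ ≤ R :=
    mem_closedBall_zero_iff.1 (hR (subset_tsupport φ h1))
  have h3 : ‖y - x + period n‖ ≤ |l| * R := by
    have : y - x + period n = l • (l⁻¹ • (y - x + period n)) := by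
      rw [smul_inv_smul₀ hl]
    rw [this, norm_smul, Real.norm_eq_abs]
    gcongr
  have h5 : ‖(period n : Rd d)‖ ≤ N := by
    have : (period n : Rd d) = (y - x + period n) - y + x := by abel
    rw [this]
    have h6 := norm_add_le ((y - x + period n) - y) x
    have h7 := norm_sub_le (y - x + period n) y
    linarith
  have h8 : ∀ i, |(n i : ℝ)| ≤ N := by
    intro i
    have h9 : ‖(period n : Rd d) i‖ ≤ N := (PiLp.norm_apply_le _ i).trans h5
    simp only [period, Real.norm_eq_abs, abs_mul, abs_of_pos Real.pi_pos, abs_two] at h9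
    have := Real.two_le_pi
    nlinarith [abs_nonneg (n i : ℝ)]
  rw [Finset.mem_Icc]
  exact ⟨fun i => by exact_mod_cast (abs_le.1 (h8 i)).1,
    fun i => by exact_mod_cast (abs_le.1 (h8 i)).2⟩

/-- Unfolding: pairing a periodic function with a periodized test function is an integral over
the whole space. -/
theorem ofFun_rescale {d : ℕ} {Ω : Opens (Rd d)} {u : C(Rd d, ℂ)} (hu : IsPeriodic u)
    (φ : 𝓓(Ω, ℝ)) {l : ℝ} (hl : 0 < l) (x : Rd d) :
    (ofFun d u).1 (rescale φ l x) = ∫ w, (φ w : ℂ) * u (x + l • w) := by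
  have hφc : Continuous φ := φ.contDiff.continuous
  set f : Rd d → ℂ := fun y => (((l ^ d)⁻¹ * φ (l⁻¹ • (y - x)) : ℝ) : ℂ) * u y with hf
  have hfc : Continuous f := by
    have : Continuous fun y : Rd d => l⁻¹ • (y - x) := by fun_prop
    exact (Complex.continuous_ofReal.comp (continuous_const.mul (hφc.comp this))).mul u.continuous
  have hsupp : HasCompactSupport f := by
    have h1 : HasCompactSupport fun y : Rd d => φ (l⁻¹ • (y - x)) := by
      have := φ.hasCompactSupport.comp_homeomorph
        ((Homeomorph.subRight x).trans (Homeomorph.smulOfNeZero l⁻¹ (inv_ne_zero hl.ne')))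
      exact this
    refine h1.mono ?_
    intro y hy
    contrapose! hy
    simp only [Function.mem_support, not_not] at hy ⊢
    simp [hf, hy]
  have hsum := hasSum_setIntegral_cell f (hfc.integrable_of_hasCompactSupport hsupp)
  obtain ⟨S, hS⟩ := exists_finset_period φ.hasCompactSupport hl.ne' x
    (Real.sqrt (d * Real.pi ^ 2))
  have hcell : ∀ y ∈ cell d, ‖y‖ ≤ Real.sqrt (d * Real.pi ^ 2) := fun y hy =>
    mem_closedBall_zero_iff.1 (cell_subset d hy)
  have hf' : ∀ (n : Fin d → ℤ) (y : Rd d), f (y + period n) =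
      (((l ^ d)⁻¹ * φ (l⁻¹ • (y - x + period n)) : ℝ) : ℂ) * u y := by
    intro n y
    simp only [hf]
    rw [hu n y, show y + period n - x = y - x + period n by abel]
  have h0 : ∀ n ∉ S, ∫ y in cell d, f (y + period n) = 0 := by
    intro n hn
    rw [setIntegral_congr_fun (measurableSet_cell d) (g := fun _ => 0)]
    · simp
    · intro y hy
      change f (y + period n) = 0
      rw [hf', hS y (hcell y hy) n hn, mul_zero, Complex.ofReal_zero, zero_mul]
  have h1 : ∑ n ∈ S, ∫ y in cell d, f (y + period n) = ∫ y, f y :=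
    (hasSum_sum_of_ne_finset_zero h0).unique hsum
  have h2 : (ofFun d u).1 (rescale φ l x) = ∫ y, f y := by
    rw [← h1, ← integral_finsetSum]
    · refine setIntegral_congr_fun (measurableSet_cell d) fun y hy => ?_
      have h3 : rescaleFun φ l x y = ∑ n ∈ S, (l ^ d)⁻¹ * φ (l⁻¹ • (y - x + period n)) := by
        refine finsum_eq_sum_of_support_subset _ fun n hn => ?_
        by_contra h
        refine hn ?_
        change (l ^ d)⁻¹ * φ (l⁻¹ • (y - x + period n)) = 0
        rw [hS y (hcell y hy) n h, mul_zero]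
      simp only [hf', ← Finset.sum_mul]
      change ((rescaleFun φ l x y : ℝ) : ℂ) * u y = _
      rw [h3]
      push_cast
      rfl
    · intro n _
      exact integrableOn_cell (hfc.comp (by fun_prop))
  rw [h2, ← integral_add_left_eq_self f x]
  have h4 := Measure.integral_comp_smul_of_nonneg (volume : Measure (Rd d))
    (fun y => f (x + y)) l (hR := hl.le)
  have h5 : ∫ y, f (x + y) = (l ^ d) • ∫ y, f (x + l • y) := by
    rw [h4, smul_smul]
    simp [mul_inv_cancel₀ (pow_ne_zero d hl.ne')]
  rw [h5, ← integral_smul]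
  refine integral_congr_ae (Eventually.of_forall fun w => ?_)
  have : (l : ℂ) ^ d ≠ 0 := pow_ne_zero _ (by exact_mod_cast hl.ne')
  simp only [hf, add_sub_cancel_left, inv_smul_smul₀ hl.ne', Complex.real_smul]
  push_cast
  field_simp

/-! ### Reading off and verifying Hölder–Zygmund bounds -/

theorem le_hzSup_re {d : ℕ} (α : ℝ) (f : Dist d) :
    hzSup α (fun φ => (f.1 φ).re) ≤ hzNorm α f :=
  le_sqrt_sq_add _ _

theorem le_hzSup_im {d : ℕ} (α : ℝ) (f : Dist d) :
    hzSup α (fun φ => (f.1 φ).im) ≤ hzNorm α f := by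
  unfold hzNorm
  rw [add_comm]
  exact le_sqrt_sq_add _ _

theorem abs_le_of_scaledSup_le {d : ℕ} {T : Set 𝓓(cube d, ℝ)} {α : ℝ} {F : TestFn d → ℝ} {N : ℝ}
    (hN : 0 ≤ N) (h : scaledSup T α F ≤ ENNReal.ofReal N) (x : Rd d) (n : ℕ) {φ : 𝓓(cube d, ℝ)}
    (hφ : φ ∈ T) : |F (rescale φ ((2 : ℝ)⁻¹ ^ n) x)| ≤ N * ((2 : ℝ)⁻¹ ^ n) ^ α := by
  have hp : (0 : ℝ) < ((2 : ℝ)⁻¹ ^ n) ^ α := by positivity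
  have h1 : ‖F (rescale φ ((2 : ℝ)⁻¹ ^ n) x)‖ₑ / ENNReal.ofReal (((2 : ℝ)⁻¹ ^ n) ^ α) ≤
      ENNReal.ofReal N := by
    refine le_trans ?_ h
    refine le_iSup_of_le x (le_iSup_of_le n ?_)
    exact le_iSup₂ (f := fun (φ : 𝓓(cube d, ℝ)) (_ : φ ∈ T) =>
      ‖F (rescale φ ((2 : ℝ)⁻¹ ^ n) x)‖ₑ / ENNReal.ofReal (((2 : ℝ)⁻¹ ^ n) ^ α)) φ hφ
  rw [ENNReal.div_le_iff (by simpa using hp) (by simp), ← ENNReal.ofReal_mul hN,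
    ← ofReal_norm, ENNReal.ofReal_le_ofReal_iff (by positivity)] at h1
  exact h1

theorem scaledSup_le_ofReal {d : ℕ} {T : Set 𝓓(cube d, ℝ)} {α : ℝ} {F : TestFn d → ℝ} {N : ℝ}
    (hN : 0 ≤ N) (h : ∀ (x : Rd d) (n : ℕ), ∀ φ ∈ T,
      |F (rescale φ ((2 : ℝ)⁻¹ ^ n) x)| ≤ N * ((2 : ℝ)⁻¹ ^ n) ^ α) :
    scaledSup T α F ≤ ENNReal.ofReal N := by
  refine iSup_le fun x => iSup_le fun n => iSup₂_le fun φ hφ => ?_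
  have hp : (0 : ℝ) < ((2 : ℝ)⁻¹ ^ n) ^ α := by positivity
  rw [ENNReal.div_le_iff (by simpa using hp) (by simp), ← ENNReal.ofReal_mul hN,
    ← ofReal_norm]
  exact ENNReal.ofReal_le_ofReal (h x n φ hφ)

theorem norm_le_of_re_im {z : ℂ} {a : ℝ} (h1 : |z.re| ≤ a) (h2 : |z.im| ≤ a) : ‖z‖ ≤ 2 * a := by
  have := Complex.norm_le_abs_re_add_abs_im z
  linarith

/-- The norm of order `-κ` is defined by test functions that are bounded in `C^1`. -/
theorem floor_eq_one {κ : ℝ} (hκ : κ ∈ Set.Ioo (0 : ℝ) (1 / 2)) : ⌊-(-κ) + 1⌋₊ = 1 := by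
  rw [Nat.floor_eq_iff (by linarith [hκ.1])]
  constructor
  · simp [hκ.1.le]
  · have := hκ.2
    push_cast
    linarith

theorem norm_apply_rescale_of_neg {d : ℕ} {κ : ℝ} (hκ : κ ∈ Set.Ioo (0 : ℝ) (1 / 2)) {f : Dist d}
    {N : ℝ} (hN : 0 ≤ N) (h : hzNorm (-κ) f ≤ ENNReal.ofReal N) (x : Rd d) (n : ℕ)
    {φ : 𝓓(cube d, ℝ)} (hφ : φ ∈ classB (cube d) 1) :
    ‖f.1 (rescale φ ((2 : ℝ)⁻¹ ^ n) x)‖ ≤ 2 * (N * ((2 : ℝ)⁻¹ ^ n) ^ (-κ)) := by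
  have h1 := (le_hzSup_re (-κ) f).trans h
  have h2 := (le_hzSup_im (-κ) f).trans h
  have hn : ¬ (0 ≤ -κ) := by linarith [hκ.1]
  simp only [hzSup, if_neg hn, floor_eq_one hκ] at h1 h2
  exact norm_le_of_re_im (abs_le_of_scaledSup_le hN h1 x n hφ)
    (abs_le_of_scaledSup_le hN h2 x n hφ)

theorem sqrt_sq_add_sq_le_ofReal {s t : ℝ≥0∞} {N : ℝ} (hs : s ≤ ENNReal.ofReal N)
    (ht : t ≤ ENNReal.ofReal N) : (s ^ 2 + t ^ 2) ^ (1 / 2 : ℝ) ≤ ENNReal.ofReal (2 * N) := by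
  refine (sqrt_sq_add_le s t).trans ((add_le_add hs ht).trans (le_of_eq ?_))
  rw [← two_mul, ENNReal.ofReal_mul (by norm_num), ENNReal.ofReal_ofNat]

theorem hzNorm_neg_le {d : ℕ} {κ : ℝ} (hκ : κ ∈ Set.Ioo (0 : ℝ) (1 / 2)) {f : Dist d}
    {N : ℝ} (hN : 0 ≤ N) (h : ∀ (x : Rd d) (n : ℕ), ∀ φ ∈ classB (cube d) 1,
      ‖f.1 (rescale φ ((2 : ℝ)⁻¹ ^ n) x)‖ ≤ N * ((2 : ℝ)⁻¹ ^ n) ^ (-κ)) :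
    hzNorm (-κ) f ≤ ENNReal.ofReal (2 * N) := by
  have hn : ¬ (0 ≤ -κ) := by linarith [hκ.1]
  refine sqrt_sq_add_sq_le_ofReal ?_ ?_
  · simp only [hzSup, if_neg hn, floor_eq_one hκ]
    exact scaledSup_le_ofReal hN fun x n φ hφ => (Complex.abs_re_le_norm _).trans (h x n φ hφ)
  · simp only [hzSup, if_neg hn, floor_eq_one hκ]
    exact scaledSup_le_ofReal hN fun x n φ hφ => (Complex.abs_im_le_norm _).trans (h x n φ hφ)

theorem norm_apply_rescale_of_nonneg {d : ℕ} {ν : ℝ} (hν : 0 ≤ ν) {f : Dist d}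
    {N : ℝ} (hN : 0 ≤ N) (h : hzNorm ν f ≤ ENNReal.ofReal N) (x : Rd d) (n : ℕ)
    {φ : 𝓓(cube d, ℝ)} (hφ : φ ∈ classB (cube d) 0 ∩ classVanish (cube d) ν) :
    ‖f.1 (rescale φ ((2 : ℝ)⁻¹ ^ n) x)‖ ≤ 2 * (N * ((2 : ℝ)⁻¹ ^ n) ^ ν) := by
  have h1 := (le_hzSup_re ν f).trans h
  have h2 := (le_hzSup_im ν f).trans h
  simp only [hzSup, if_pos hν] at h1 h2
  exact norm_le_of_re_im (abs_le_of_scaledSup_le hN (le_add_self.trans h1) x n hφ)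
    (abs_le_of_scaledSup_le hN (le_add_self.trans h2) x n hφ)

theorem norm_apply_of_nonneg {d : ℕ} {ν : ℝ} (hν : 0 ≤ ν) {f : Dist d}
    {N : ℝ} (hN : 0 ≤ N) (h : hzNorm ν f ≤ ENNReal.ofReal N) {ψ : TestFn d}
    (hψ : ∀ y, |(ψ : Rd d → ℝ) y| ≤ 1) : ‖f.1 ψ‖ ≤ 2 * N := by
  have h1 := (le_hzSup_re ν f).trans h
  have h2 := (le_hzSup_im ν f).trans h
  simp only [hzSup, if_pos hν] at h1 h2
  refine norm_le_of_re_im ?_ ?_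
  · have h3 := (le_iSup₂ (f := fun (ψ : TestFn d) (_ : ∀ y, |(ψ : Rd d → ℝ) y| ≤ 1) =>
      ‖(f.1 ψ).re‖ₑ) ψ hψ).trans (le_self_add.trans h1)
    rw [← ofReal_norm, ENNReal.ofReal_le_ofReal_iff hN] at h3
    exact h3
  · have h3 := (le_iSup₂ (f := fun (ψ : TestFn d) (_ : ∀ y, |(ψ : Rd d → ℝ) y| ≤ 1) =>
      ‖(f.1 ψ).im‖ₑ) ψ hψ).trans (le_self_add.trans h2)
    rw [← ofReal_norm, ENNReal.ofReal_le_ofReal_iff hN] at h3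
    exact h3

theorem hzNorm_lt_top_of_nonneg {d : ℕ} {ν : ℝ} (hν : 0 ≤ ν) {f : Dist d}
    {N : ℝ} (h : ∀ ψ : TestFn d, (∀ y, |(ψ : Rd d → ℝ) y| ≤ 1) → ‖f.1 ψ‖ ≤ N)
    (h0 : ∀ (x : Rd d) (n : ℕ), ∀ φ ∈ classB (cube d) 0 ∩ classVanish (cube d) ν,
      f.1 (rescale φ ((2 : ℝ)⁻¹ ^ n) x) = 0) :
    hzNorm ν f < ⊤ := by
  refine lt_of_le_of_lt (sqrt_sq_add_sq_le_ofReal (N := N) ?_ ?_) ENNReal.ofReal_lt_top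
  · simp only [hzSup, if_pos hν]
    rw [← add_zero (ENNReal.ofReal N)]
    refine add_le_add (iSup₂_le fun ψ hψ => ?_) ?_
    · rw [← ofReal_norm]
      exact ENNReal.ofReal_le_ofReal ((Complex.abs_re_le_norm _).trans (h ψ hψ))
    · rw [← ENNReal.ofReal_zero]
      exact scaledSup_le_ofReal le_rfl fun x n φ hφ => by rw [h0 x n φ hφ]; simp
  · simp only [hzSup, if_pos hν]
    rw [← add_zero (ENNReal.ofReal N)]
    refine add_le_add (iSup₂_le fun ψ hψ => ?_) ?_
    · rw [← ofReal_norm]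
      exact ENNReal.ofReal_le_ofReal ((Complex.abs_im_le_norm _).trans (h ψ hψ))
    · rw [← ENNReal.ofReal_zero]
      exact scaledSup_le_ofReal le_rfl fun x n φ hφ => by rw [h0 x n φ hφ]; simp

theorem mem_classB_zero_iff {d : ℕ} {Ω : Opens (Rd d)} {φ : 𝓓(Ω, ℝ)} :
    φ ∈ classB Ω 0 ↔ ∀ y, |φ y| ≤ 1 := by
  constructor
  · intro h y
    simpa using h 0 le_rfl Fin.elim0 y
  · intro h m hm i y
    obtain rfl : m = 0 := by omega
    simpa using h y

theorem mem_classB_one_iff {d : ℕ} {Ω : Opens (Rd d)} {φ : 𝓓(Ω, ℝ)} :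
    φ ∈ classB Ω 1 ↔ (∀ y, |φ y| ≤ 1) ∧
      ∀ i y, |fderiv ℝ φ y (EuclideanSpace.single i (1 : ℝ))| ≤ 1 := by
  constructor
  · intro h
    refine ⟨fun y => by simpa using h 0 (by norm_num) Fin.elim0 y, fun i y => ?_⟩
    simpa using h 1 le_rfl (fun _ => i) y
  · rintro ⟨h0, h1⟩ m hm i y
    obtain rfl | rfl : m = 0 ∨ m = 1 := by omega
    · simpa using h0 y
    · simpa using h1 (i 0) y

theorem mem_classB_one_of_norm {d : ℕ} {Ω : Opens (Rd d)} {φ : 𝓓(Ω, ℝ)} (h0 : ∀ y, |φ y| ≤ 1)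
    (h1 : ∀ y, ‖fderiv ℝ φ y‖ ≤ 1) : φ ∈ classB Ω 1 := by
  refine mem_classB_one_iff.2 ⟨h0, fun i y => ?_⟩
  have := (fderiv ℝ φ y).le_opNorm (EuclideanSpace.single i (1 : ℝ))
  rw [PiLp.norm_single, norm_one, mul_one] at this
  exact this.trans (h1 y)

theorem norm_fderiv_le_of_mem_classB {d : ℕ} {Ω : Opens (Rd d)} {φ : 𝓓(Ω, ℝ)}
    (h : φ ∈ classB Ω 1) (y : Rd d) : ‖fderiv ℝ φ y‖ ≤ d := by
  refine ContinuousLinearMap.opNorm_le_bound _ (Nat.cast_nonneg d) fun v => ?_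
  have hv : v = ∑ i, v i • EuclideanSpace.single i (1 : ℝ) := by
    ext j
    simp [Finset.sum_apply, Pi.single_apply]
  calc ‖fderiv ℝ φ y v‖ = ‖∑ i, v i * fderiv ℝ φ y (EuclideanSpace.single i (1 : ℝ))‖ := by
        conv_lhs => rw [hv]
        simp [map_sum]
    _ ≤ ∑ i : Fin d, ‖v‖ := by
        refine norm_sum_le_of_le _ fun i _ => ?_
        rw [norm_mul]
        have h1 := (mem_classB_one_iff.1 h).2 i y
        have h2 := PiLp.norm_apply_le v i
        calc _ ≤ ‖v‖ * 1 := mul_le_mul h2 h1 (abs_nonneg _) (norm_nonneg _)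
          _ = ‖v‖ := mul_one _
    _ = d * ‖v‖ := by simp

/-- The support of a test function on the cube is bounded by the half-diagonal. -/
theorem eq_zero_of_lt_norm {d : ℕ} (φ : 𝓓(cube d, ℝ)) {y : Rd d}
    (hy : Real.sqrt (d * Real.pi ^ 2) < ‖y‖) : φ y = 0 := by
  by_contra h
  have h1 : y ∈ cube d := φ.tsupport_subset (subset_tsupport _ h)
  have h2 : y ∈ cell d := fun i => ⟨(h1 i).1, (h1 i).2.le⟩
  have := mem_closedBall_zero_iff.1 (cell_subset d h2)
  linarith

theorem closedBall_subset_cube {d : ℕ} {r : ℝ} (hr : r < Real.pi) :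
    Metric.closedBall (0 : Rd d) r ⊆ cube d := by
  intro y hy i
  have h1 := (PiLp.norm_apply_le y i).trans (mem_closedBall_zero_iff.1 hy)
  rw [Real.norm_eq_abs] at h1
  have := abs_le.1 h1
  exact ⟨by linarith, by linarith⟩

/-- A smooth function supported in a ball inside the cube, as a test function. -/
def toTest {d : ℕ} (φ : Rd d → ℝ) (hφ : ContDiff ℝ ∞ φ) (r : ℝ) (hr : r < Real.pi)
    (h0 : ∀ y, r < ‖y‖ → φ y = 0) : 𝓓(cube d, ℝ) where
  toFun := φ
  contDiff' := hφ
  hasCompactSupport' := HasCompactSupport.intro (isCompact_closedBall (0 : Rd d) r) fun y hy =>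
    h0 y (by simpa using hy)
  tsupport_subset' := by
    refine subset_trans (closure_minimal (fun y hy => ?_) Metric.isClosed_closedBall)
      (closedBall_subset_cube hr)
    by_contra h
    exact hy (h0 y (by simpa using h))

@[simp] theorem toTest_apply {d : ℕ} (φ : Rd d → ℝ) (hφ : ContDiff ℝ ∞ φ) (r : ℝ)
    (hr : r < Real.pi) (h0 : ∀ y, r < ‖y‖ → φ y = 0) (y : Rd d) :
    toTest φ hφ r hr h0 y = φ y := rfl

theorem coe_toTest {d : ℕ} (φ : Rd d → ℝ) (hφ : ContDiff ℝ ∞ φ) (r : ℝ)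
    (hr : r < Real.pi) (h0 : ∀ y, r < ‖y‖ → φ y = 0) :
    ⇑(toTest φ hφ r hr h0) = φ := rfl

/-! ### Averaging operators and the multiscale estimate -/

/-- The average `z ↦ ∫ f (z + t w) dμ(w)` of `f` at scale `t`. For a probability measure `μ` with
density `σ` this is the convolution of `f` with the reflected rescaled mollifier; the adjoint of
the operator of scale `t` is the operator of scale `-t`. -/
noncomputable def avg {d : ℕ} (μ : Measure (Rd d)) (t : ℝ) (f : Rd d → ℂ) (z : Rd d) : ℂ :=
  ∫ w, f (z + t • w) ∂μ

theorem avg_eq_zero {d : ℕ} {μ : Measure (Rd d)} {h : Rd d → ℂ} (hμ : ∀ᵐ w ∂μ, ‖w‖ ≤ 1)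
    {R t : ℝ} (h0 : ∀ z, R < ‖z‖ → h z = 0) (ht : |t| ≤ 1)
    {z : Rd d} (hz : R + 1 < ‖z‖) : avg μ t h z = 0 := by
  unfold avg
  refine integral_eq_zero_of_ae ?_
  filter_upwards [hμ] with w hw
  refine h0 _ ?_
  have h1 : ‖t • w‖ ≤ 1 := by
    rw [norm_smul, Real.norm_eq_abs]
    exact mul_le_one₀ ht (norm_nonneg _) hw
  have h2 := norm_sub_le_norm_add z (t • w)
  linarith

section Averages

variable {d : ℕ} {μ : Measure (Rd d)} [IsProbabilityMeasure μ] {f g h : Rd d → ℂ} {B : ℝ}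

theorem integrable_avg (hf : Continuous f) (hB : ∀ z, ‖f z‖ ≤ B) (t : ℝ) (z : Rd d) :
    Integrable (fun w => f (z + t • w)) μ :=
  Integrable.of_bound (hf.comp (by fun_prop)).aestronglyMeasurable B
    (Eventually.of_forall fun _ => hB _)

theorem norm_avg_le (hB : ∀ z, ‖f z‖ ≤ B) (t : ℝ) (z : Rd d) : ‖avg μ t f z‖ ≤ B := by
  have := norm_integral_le_of_norm_le_const (μ := μ) (f := fun w => f (z + t • w)) (C := B)
    (Eventually.of_forall fun w => hB _)
  simpa [avg] using this

theorem continuous_avg (hf : Continuous f) (hB : ∀ z, ‖f z‖ ≤ B) (t : ℝ) :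
    Continuous (avg μ t f) := by
  refine continuous_of_dominated (bound := fun _ => B) (fun z => ?_) (fun z => ?_)
    (integrable_const B) (Eventually.of_forall fun w => ?_)
  · exact (hf.comp (by fun_prop)).aestronglyMeasurable
  · exact Eventually.of_forall fun _ => hB _
  · exact hf.comp (by fun_prop)

theorem avg_comm (hf : Continuous f) (hB : ∀ z, ‖f z‖ ≤ B) (s t : ℝ) :
    avg μ s (avg μ t f) = avg μ t (avg μ s f) := by
  funext z
  unfold avg
  rw [integral_integral_swap]
  · refine integral_congr_ae (Eventually.of_forall fun w => ?_)
    refine integral_congr_ae (Eventually.of_forall fun w' => ?_)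
    change f _ = f _
    congr 1
    abel
  · refine Integrable.of_bound (Continuous.aestronglyMeasurable ?_) B
      (Eventually.of_forall fun p => hB _)
    exact hf.comp (by fun_prop)

theorem norm_avg_sub_le (hμ : ∀ᵐ w ∂μ, ‖w‖ ≤ 1) (hf : Continuous f) (hB : ∀ z, ‖f z‖ ≤ B)
    {t e : ℝ} {c : ℂ} {z : Rd d} (he : ∀ z', ‖z' - z‖ ≤ |t| → ‖f z' - c‖ ≤ e) :
    ‖avg μ t f z - c‖ ≤ e := by
  have h1 : avg μ t f z - c = ∫ w, (f (z + t • w) - c) ∂μ := by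
    rw [integral_sub (integrable_avg hf hB t z) (integrable_const c)]
    simp [avg]
  rw [h1]
  have := norm_integral_le_of_norm_le_const (μ := μ) (f := fun w => f (z + t • w) - c) (C := e) (by
    filter_upwards [hμ] with w hw
    refine he _ ?_
    rw [add_sub_cancel_left, norm_smul, Real.norm_eq_abs]
    exact mul_le_of_le_one_right (abs_nonneg t) hw)
  simpa using this

/-- The averages at scale `t` and at scale `-t` are adjoint to each other. -/
theorem integral_avg_mul (hμ : ∀ᵐ w ∂μ, ‖w‖ ≤ 1) (hf : Continuous f) (hB : ∀ z, ‖f z‖ ≤ B)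
    {R t : ℝ} (hh : Continuous h) (h0 : ∀ z, R < ‖z‖ → h z = 0) (ht : |t| ≤ 1) :
    ∫ z, avg μ t f z * h z = ∫ z, f z * avg μ (-t) h z := by
  have hhc : HasCompactSupport h :=
    HasCompactSupport.intro (isCompact_closedBall (0 : Rd d) R) fun y hy => h0 y (by simpa using hy)
  have hint : Integrable h := hh.integrable_of_hasCompactSupport hhc
  obtain ⟨H, hH⟩ : ∃ H, ∀ z, ‖h z‖ ≤ H := hh.bounded_above_of_compact_support hhc
  have hB0 : 0 ≤ B := (norm_nonneg _).trans (hB 0)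
  have i1 : Integrable (Function.uncurry fun z w : Rd d => f (z + t • w) * h z)
      (volume.prod μ) := by
    refine (hint.comp_fst μ).bdd_mul (c := B) ?_ (Eventually.of_forall fun p => hB _)
    exact (hf.comp (by fun_prop)).aestronglyMeasurable
  -- for almost every `w` the integrand is supported in the ball of radius `R + 1`
  have i2 : Integrable (Function.uncurry fun w z : Rd d => f z * h (z + (-t) • w))
      (μ.prod volume) := by
    have hind : Integrable (fun z : Rd d => (Metric.closedBall (0 : Rd d) (R + 1)).indicator
        (fun _ => B * H) z) :=
      (integrable_indicator_iff Metric.isClosed_closedBall.measurableSet).2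
        (integrableOn_const (isCompact_closedBall _ _).measure_lt_top.ne)
    refine (hind.comp_snd μ).mono' ?_ ?_
    · have : Continuous (Function.uncurry fun w z : Rd d => f z * h (z + (-t) • w)) :=
        (hf.comp (by fun_prop)).mul (hh.comp (by fun_prop))
      exact this.aestronglyMeasurable
    · have hμ' : ∀ᵐ p ∂(μ.prod (volume : Measure (Rd d))), ‖p.1‖ ≤ 1 :=
        Measure.quasiMeasurePreserving_fst.ae hμ
      filter_upwards [hμ'] with p hp
      change ‖f p.2 * h (p.2 + (-t) • p.1)‖ ≤ _
      by_cases hz : p.2 ∈ Metric.closedBall (0 : Rd d) (R + 1)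
      · rw [indicator_of_mem hz, norm_mul]
        exact mul_le_mul (hB _) (hH _) (norm_nonneg _) hB0
      · rw [indicator_of_notMem hz, h0, mul_zero, norm_zero]
        have h1 : ‖(-t) • p.1‖ ≤ 1 := by
          rw [norm_smul, Real.norm_eq_abs, abs_neg]
          exact mul_le_one₀ ht (norm_nonneg _) hp
        have h2 := norm_sub_le_norm_add p.2 ((-t) • p.1)
        have h3 : R + 1 < ‖p.2‖ := by simpa using hz
        linarith
  calc ∫ z, avg μ t f z * h z = ∫ z, ∫ w, f (z + t • w) * h z ∂μ := by
        simp only [avg, integral_mul_const]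
    _ = ∫ w, (∫ z, f (z + t • w) * h z) ∂μ := integral_integral_swap i1
    _ = ∫ w, (∫ z, f z * h (z + (-t) • w)) ∂μ := by
        refine integral_congr_ae (Eventually.of_forall fun w => ?_)
        change ∫ z, f (z + t • w) * h z = ∫ z, f z * h (z + (-t) • w)
        rw [← integral_add_right_eq_self (fun z => f z * h (z + (-t) • w)) (t • w)]
        simp
    _ = ∫ z, ∫ w, f z * h (z + (-t) • w) ∂μ := integral_integral_swap i2
    _ = _ := by simp only [avg, integral_const_mul]

theorem tendsto_avg (hμ : ∀ᵐ w ∂μ, ‖w‖ ≤ 1) (hf : Continuous f) (hB : ∀ z, ‖f z‖ ≤ B)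
    (z : Rd d) : Tendsto (fun n : ℕ => avg μ ((2 : ℝ)⁻¹ ^ n) f z) atTop (𝓝 (f z)) := by
  rw [Metric.tendsto_nhds]
  intro ε hε
  obtain ⟨δ, hδ, h⟩ := Metric.continuous_iff.1 hf z (ε / 2) (half_pos hε)
  have ht : Tendsto (fun n : ℕ => (2 : ℝ)⁻¹ ^ n) atTop (𝓝 0) :=
    tendsto_pow_atTop_nhds_zero_of_lt_one (by norm_num) (by norm_num)
  filter_upwards [ht.eventually (gt_mem_nhds hδ)] with n hn
  have hp : (0 : ℝ) < (2 : ℝ)⁻¹ ^ n := by positivity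
  rw [dist_eq_norm]
  refine lt_of_le_of_lt ?_ (half_lt_self hε)
  refine norm_avg_sub_le hμ hf hB fun z' hz' => ?_
  rw [abs_of_pos hp] at hz'
  rw [← dist_eq_norm]
  refine (h z' ?_).le
  rw [dist_eq_norm]
  linarith

theorem tendsto_avg_avg (hμ : ∀ᵐ w ∂μ, ‖w‖ ≤ 1) (hf : Continuous f) (hB : ∀ z, ‖f z‖ ≤ B)
    (z : Rd d) : Tendsto (fun n : ℕ => avg μ ((2 : ℝ)⁻¹ ^ n) (avg μ ((2 : ℝ)⁻¹ ^ (n + 1)) f) z)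
      atTop (𝓝 (f z)) := by
  rw [Metric.tendsto_nhds]
  intro ε hε
  obtain ⟨δ, hδ, h⟩ := Metric.continuous_iff.1 hf z (ε / 2) (half_pos hε)
  have ht : Tendsto (fun n : ℕ => (2 : ℝ)⁻¹ ^ n) atTop (𝓝 0) :=
    tendsto_pow_atTop_nhds_zero_of_lt_one (by norm_num) (by norm_num)
  filter_upwards [ht.eventually (gt_mem_nhds (half_pos hδ))] with n hn
  have hp : (0 : ℝ) < (2 : ℝ)⁻¹ ^ n := by positivity
  have hp1 : (2 : ℝ)⁻¹ ^ (n + 1) = (2 : ℝ)⁻¹ ^ n / 2 := by rw [pow_succ]; ring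
  rw [dist_eq_norm]
  refine lt_of_le_of_lt ?_ (half_lt_self hε)
  refine norm_avg_sub_le hμ (continuous_avg hf hB _) (norm_avg_le hB _) fun z' hz' => ?_
  refine norm_avg_sub_le hμ hf hB fun z'' hz'' => ?_
  rw [← dist_eq_norm]
  refine (h z'' ?_).le
  rw [abs_of_pos hp] at hz'
  rw [hp1, abs_of_pos (half_pos hp)] at hz''
  rw [dist_eq_norm]
  have : z'' - z = (z'' - z') + (z' - z) := by abel
  rw [this]
  linarith [norm_add_le (z'' - z') (z' - z)]

/-- The volume of the ball of radius `R + 1`, times a geometric series of ratio `2^{-κ}`. -/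
noncomputable def multiscaleConst (d : ℕ) (κ R : ℝ) : ℝ :=
  volume.real (Metric.closedBall (0 : Rd d) (R + 1)) * 2 ^ κ * (1 + 1 / (1 - (2 : ℝ)⁻¹ ^ κ))

theorem norm_integral_le_of_ball {F : Rd d → ℂ} {R K : ℝ} (h0 : ∀ z, R < ‖z‖ → F z = 0)
    (hK : ∀ z, ‖F z‖ ≤ K) :
    ‖∫ z, F z‖ ≤ K * volume.real (Metric.closedBall (0 : Rd d) R) := by
  rw [← setIntegral_eq_integral_of_forall_compl_eq_zero
    (s := Metric.closedBall (0 : Rd d) R) (fun z hz => h0 z (by simpa using hz))]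
  exact norm_setIntegral_le_of_norm_le_const (isCompact_closedBall _ _).measure_lt_top
    fun z _ => hK z

/-- If the averages of `g` at scale `2^{-n}` grow at most like `2^{nκ}`, then `g` can be integrated
against a `ν`-Hölder function `h`. With `Sₙ` the average at scale `2^{-n}`, the integrals
`Tₙ = ∫ (Sₙ Sₙ₊₁ g) h` tend to `∫ g h`, and
`Tₙ₊₁ - Tₙ = ∫ (Sₙ₊₁ g) (Sₙ₊₂* - Sₙ*) h` is of order `2^{nκ} 2^{-nν} ≤ 2^{-nκ}`. -/
theorem norm_integral_mul_le (hμ : ∀ᵐ w ∂μ, ‖w‖ ≤ 1) {κ ν A H R : ℝ} (hκ : 0 < κ) (hν : 2 * κ < ν)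
    (hg : Continuous g) (hB : ∀ z, ‖g z‖ ≤ B)
    (hA : ∀ (n : ℕ) z, ‖avg μ ((2 : ℝ)⁻¹ ^ n) g z‖ ≤ A * ((2 : ℝ)⁻¹ ^ n) ^ (-κ))
    (hh : Continuous h) (h0 : ∀ z, R < ‖z‖ → h z = 0) (hH : ∀ z, ‖h z‖ ≤ H)
    (hHol : ∀ z w, ‖z - w‖ ≤ 1 → ‖h z - h w‖ ≤ H * ‖z - w‖ ^ ν) :
    ‖∫ z, g z * h z‖ ≤ multiscaleConst d κ R * (A * H) := by
  set V := volume.real (Metric.closedBall (0 : Rd d) (R + 1)) with hV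
  have hV0 : 0 ≤ V := measureReal_nonneg
  have hH0 : 0 ≤ H := (norm_nonneg _).trans (hH 0)
  have hA0 : 0 ≤ A := by simpa using (norm_nonneg _).trans (hA 0 0)
  have hν0 : 0 ≤ ν := by linarith
  set r : ℝ := (2 : ℝ)⁻¹ ^ κ with hr
  have hr1 : r < 1 := Real.rpow_lt_one (by norm_num) (by norm_num) hκ
  have hr0 : 0 < r := by positivity
  set G : ℕ → Rd d → ℂ := fun n => avg μ ((2 : ℝ)⁻¹ ^ n) g with hG
  have hGc : ∀ n, Continuous (G n) := fun n => continuous_avg hg hB _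
  have hGB : ∀ n z, ‖G n z‖ ≤ B := fun n => norm_avg_le hB _
  set T : ℕ → ℂ := fun n => ∫ z, avg μ ((2 : ℝ)⁻¹ ^ n) (G (n + 1)) z * h z with hT
  have hle1 : ∀ n : ℕ, |(2 : ℝ)⁻¹ ^ n| ≤ 1 := fun n => by
    rw [abs_of_pos (by positivity)]
    exact pow_le_one₀ (by norm_num) (by norm_num)
  have hle1' : ∀ n : ℕ, |-(2 : ℝ)⁻¹ ^ n| ≤ 1 := fun n => by rw [abs_neg]; exact hle1 n
  have hGA : ∀ n z, ‖G n z‖ ≤ A * (r ^ n)⁻¹ := by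
    intro n z
    refine (hA n z).trans (le_of_eq ?_)
    rw [Real.rpow_neg (by positivity), hr, ← Real.rpow_pow_comm (by norm_num)]
  have hrinv : r⁻¹ = 2 ^ κ := by
    rw [hr, Real.inv_rpow (by norm_num), inv_inv]
  have hhc : HasCompactSupport h :=
    HasCompactSupport.intro (isCompact_closedBall (0 : Rd d) R) fun y hy => h0 y (by simpa using hy)
  have hhi : Integrable h := hh.integrable_of_hasCompactSupport hhc
  have hlim : Tendsto T atTop (𝓝 (∫ z, g z * h z)) := by
    refine tendsto_integral_of_dominated_convergence (fun z => B * ‖h z‖) (fun n => ?_)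
      (hhi.norm.const_mul B) (fun n => Eventually.of_forall fun z => ?_)
      (Eventually.of_forall fun z => ?_)
    · exact ((continuous_avg (hGc _) (hGB _) _).mul hh).aestronglyMeasurable
    · rw [norm_mul]
      exact mul_le_mul_of_nonneg_right (norm_avg_le (hGB _) _ _) (norm_nonneg _)
    · exact (tendsto_avg_avg hμ hg hB z).mul_const _
  have hadj : ∀ n m, ∫ z, avg μ ((2 : ℝ)⁻¹ ^ n) (G m) z * h z =
      ∫ z, G m z * avg μ (-(2 : ℝ)⁻¹ ^ n) h z := fun n m =>
    integral_avg_mul hμ (hGc m) (hGB m) hh h0 (hle1 n)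
  have hinc : ∀ n, dist (T n) (T (n + 1)) ≤ V * 2 ^ κ * (A * H) * r ^ n := by
    intro n
    -- exchanging the two averages makes `G (n + 1)` a common factor of `T n` and `T (n + 1)`
    have e1 : T (n + 1) = ∫ z, avg μ ((2 : ℝ)⁻¹ ^ (n + 2)) (G (n + 1)) z * h z := by
      simp only [hT, hG]
      rw [avg_comm hg hB]
    have hint : ∀ k, Integrable fun z => G (n + 1) z * avg μ (-(2 : ℝ)⁻¹ ^ k) h z := by
      intro k
      refine Continuous.integrable_of_hasCompactSupport
        ((hGc _).mul (continuous_avg hh hH _)) ?_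
      refine HasCompactSupport.intro (isCompact_closedBall (0 : Rd d) (R + 1)) fun y hy => ?_
      rw [avg_eq_zero hμ h0 (hle1' k) (by simpa using hy), mul_zero]
    rw [dist_comm, dist_eq_norm, e1, hT]
    simp only
    rw [hadj, hadj, ← integral_sub (hint _) (hint _)]
    have hb := norm_integral_le_of_ball (R := R + 1) (K := 2 ^ κ * (A * H) * r ^ n)
      (F := fun z => G (n + 1) z * avg μ (-(2 : ℝ)⁻¹ ^ (n + 2)) h z -
        G (n + 1) z * avg μ (-(2 : ℝ)⁻¹ ^ n) h z) (fun z hz => by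
          rw [avg_eq_zero hμ h0 (hle1' _) hz, avg_eq_zero hμ h0 (hle1' _) hz]
          simp) (fun z => ?_)
    · refine hb.trans (le_of_eq ?_)
      ring
    · rw [← mul_sub, norm_mul]
      have h1 : ‖avg μ (-(2 : ℝ)⁻¹ ^ (n + 2)) h z - avg μ (-(2 : ℝ)⁻¹ ^ n) h z‖ ≤
          H * ((2 : ℝ)⁻¹ ^ n) ^ ν := by
        have e : avg μ (-(2 : ℝ)⁻¹ ^ (n + 2)) h z - avg μ (-(2 : ℝ)⁻¹ ^ n) h z =
            ∫ w, (h (z + (-(2 : ℝ)⁻¹ ^ (n + 2)) • w) - h (z + (-(2 : ℝ)⁻¹ ^ n) • w)) ∂μ := by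
          rw [integral_sub (integrable_avg hh hH _ _) (integrable_avg hh hH _ _)]
          rfl
        rw [e]
        have := norm_integral_le_of_norm_le_const (μ := μ) (C := H * ((2 : ℝ)⁻¹ ^ n) ^ ν)
          (f := fun w => h (z + (-(2 : ℝ)⁻¹ ^ (n + 2)) • w) - h (z + (-(2 : ℝ)⁻¹ ^ n) • w)) (by
            filter_upwards [hμ] with w hw
            have hp : (0 : ℝ) < (2 : ℝ)⁻¹ ^ n := by positivity
            -- the two shifts of `z` differ by `(2^{-n} - 2^{-n-2}) w`
            have e2 : z + (-(2 : ℝ)⁻¹ ^ (n + 2)) • w - (z + (-(2 : ℝ)⁻¹ ^ n) • w) =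
                ((3 / 4) * (2 : ℝ)⁻¹ ^ n) • w := by
              rw [add_sub_add_left_eq_sub, ← sub_smul]
              congr 1
              rw [pow_add]
              ring
            have e3 : ‖z + (-(2 : ℝ)⁻¹ ^ (n + 2)) • w - (z + (-(2 : ℝ)⁻¹ ^ n) • w)‖ ≤
                (2 : ℝ)⁻¹ ^ n := by
              rw [e2, norm_smul, Real.norm_eq_abs, abs_of_pos (by positivity)]
              nlinarith [norm_nonneg w]
            have h2 := le_of_abs_le (hle1 n)
            refine (hHol _ _ (e3.trans h2)).trans ?_
            gcongr)
        simpa using this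
      have h2 : ((2 : ℝ)⁻¹ ^ n) ^ ν ≤ r ^ n * r ^ n := by
        calc ((2 : ℝ)⁻¹ ^ n) ^ ν ≤ ((2 : ℝ)⁻¹ ^ n) ^ (2 * κ) :=
              Real.rpow_le_rpow_of_exponent_ge (by positivity) (le_of_abs_le (hle1 n)) hν.le
          _ = r ^ n * r ^ n := by
              rw [two_mul, Real.rpow_add (by positivity), hr, Real.rpow_pow_comm (by norm_num)]
      calc _ ≤ (A * (r ^ (n + 1))⁻¹) * (H * (r ^ n * r ^ n)) := by
            gcongr
            · exact hGA _ _
            · exact h1.trans (by gcongr)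
        _ = 2 ^ κ * (A * H) * r ^ n := by
            rw [pow_succ, mul_inv, hrinv]
            have : r ^ n ≠ 0 := by positivity
            field_simp
  have hT0 : ‖T 0‖ ≤ V * 2 ^ κ * (A * H) := by
    rw [hT]
    simp only
    rw [hadj]
    have hb := norm_integral_le_of_ball (R := R + 1) (K := 2 ^ κ * (A * H))
      (F := fun z => G (0 + 1) z * avg μ (-(2 : ℝ)⁻¹ ^ 0) h z) (fun z hz => by
          rw [avg_eq_zero hμ h0 (hle1' _) hz, mul_zero]) (fun z => ?_)
    · refine hb.trans (le_of_eq ?_)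
      ring
    · rw [norm_mul]
      calc _ ≤ (A * (r ^ (0 + 1))⁻¹) * H :=
            mul_le_mul (hGA _ _) (norm_avg_le hH _ _) (norm_nonneg _) (by positivity)
        _ = _ := by
            rw [zero_add, pow_one, hrinv]
            ring
  have hfin := dist_le_of_le_geometric_of_tendsto₀ r _ hr1 hinc hlim
  rw [dist_comm, dist_eq_norm] at hfin
  have htri := norm_add_le ((∫ z, g z * h z) - T 0) (T 0)
  rw [sub_add_cancel] at htri
  refine (htri.trans (add_le_add hfin hT0)).trans (le_of_eq ?_)
  rw [multiscaleConst, ← hV, ← hr]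
  ring

end Averages

/-! ### A mollifier, and the Hölder regularity of functions with finite norm -/

/-- A smooth probability density supported in the unit ball. -/
noncomputable def mollifier (d : ℕ) : Rd d → ℝ :=
  (⟨1 / 2, 1, by norm_num, by norm_num⟩ : ContDiffBump (0 : Rd d)).normed volume

theorem contDiff_mollifier (d : ℕ) : ContDiff ℝ ∞ (mollifier d) :=
  ContDiffBump.contDiff_normed _

theorem mollifier_nonneg {d : ℕ} (y : Rd d) : 0 ≤ mollifier d y :=
  ContDiffBump.nonneg_normed _ _

theorem integral_mollifier (d : ℕ) : ∫ y, mollifier d y = 1 :=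
  ContDiffBump.integral_normed _

theorem mollifier_eq_zero {d : ℕ} {y : Rd d} (hy : 1 < ‖y‖) : mollifier d y = 0 := by
  have h := ContDiffBump.support_normed_eq
    (f := (⟨1 / 2, 1, by norm_num, by norm_num⟩ : ContDiffBump (0 : Rd d))) (μ := volume)
  by_contra h0
  have h1 : y ∈ Function.support (mollifier d) := h0
  rw [mollifier, h] at h1
  have := mem_ball_zero_iff.1 h1
  simp only at this
  linarith

theorem hasCompactSupport_mollifier (d : ℕ) : HasCompactSupport (mollifier d) :=
  ContDiffBump.hasCompactSupport_normed _

theorem integrable_mollifier (d : ℕ) : Integrable (mollifier d) :=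
  (contDiff_mollifier d).continuous.integrable_of_hasCompactSupport (hasCompactSupport_mollifier d)

theorem exists_bound_of_compactSupport {d : ℕ} {φ : Rd d → ℝ} (hφ : ContDiff ℝ ∞ φ)
    (hc : HasCompactSupport φ) : ∃ M : ℝ, 1 ≤ M ∧ ∀ y, |φ y| ≤ M ∧ ‖fderiv ℝ φ y‖ ≤ M := by
  obtain ⟨C, hC⟩ := hφ.continuous.bounded_above_of_compact_support hc
  obtain ⟨C', hC'⟩ := (hφ.continuous_fderiv (by simp)).bounded_above_of_compact_support
    (hc.fderiv (𝕜 := ℝ))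
  exact ⟨max 1 (max C C'), le_max_left _ _, fun y =>
    ⟨(hC y).trans ((le_max_left _ _).trans (le_max_right _ _)),
      (hC' y).trans ((le_max_right _ _).trans (le_max_right _ _))⟩⟩

/-- A bound for the mollifier and its derivative. -/
noncomputable def mollifierBound (d : ℕ) : ℝ :=
  (exists_bound_of_compactSupport (contDiff_mollifier d) (hasCompactSupport_mollifier d)).choose

theorem one_le_mollifierBound (d : ℕ) : 1 ≤ mollifierBound d :=
  (exists_bound_of_compactSupport (contDiff_mollifier d)
    (hasCompactSupport_mollifier d)).choose_spec.1

theorem abs_mollifier_le {d : ℕ} (y : Rd d) : |mollifier d y| ≤ mollifierBound d :=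
  ((exists_bound_of_compactSupport (contDiff_mollifier d)
    (hasCompactSupport_mollifier d)).choose_spec.2 y).1

theorem norm_fderiv_mollifier_le {d : ℕ} (y : Rd d) :
    ‖fderiv ℝ (mollifier d) y‖ ≤ mollifierBound d :=
  ((exists_bound_of_compactSupport (contDiff_mollifier d)
    (hasCompactSupport_mollifier d)).choose_spec.2 y).2

/-- The probability measure with density `mollifier d`. -/
noncomputable def mollifierMeasure (d : ℕ) : Measure (Rd d) :=
  volume.withDensity fun w => ENNReal.ofReal (mollifier d w)

instance (d : ℕ) : IsProbabilityMeasure (mollifierMeasure d) := by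
  constructor
  rw [mollifierMeasure, withDensity_apply _ MeasurableSet.univ, Measure.restrict_univ,
    ← ofReal_integral_eq_lintegral_ofReal (integrable_mollifier d)
      (Eventually.of_forall mollifier_nonneg), integral_mollifier, ENNReal.ofReal_one]

theorem measurable_mollifier (d : ℕ) : Measurable fun w : Rd d => ENNReal.ofReal (mollifier d w) :=
  (contDiff_mollifier d).continuous.measurable.ennreal_ofReal

theorem ae_mollifierMeasure_norm_le (d : ℕ) : ∀ᵐ w ∂mollifierMeasure d, ‖w‖ ≤ 1 := by
  rw [mollifierMeasure, ae_withDensity_iff (measurable_mollifier d)]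
  refine Eventually.of_forall fun w hw => ?_
  by_contra h
  exact hw (by rw [mollifier_eq_zero (not_le.1 h), ENNReal.ofReal_zero])

theorem avg_mollifierMeasure {d : ℕ} (t : ℝ) (f : Rd d → ℂ) (z : Rd d) :
    avg (mollifierMeasure d) t f z = ∫ w, (mollifier d w : ℂ) * f (z + t • w) := by
  rw [avg, mollifierMeasure, integral_withDensity_eq_integral_toReal_smul (measurable_mollifier d)
    (Eventually.of_forall fun _ => ENNReal.ofReal_lt_top)]
  refine integral_congr_ae (Eventually.of_forall fun w => ?_)
  simp only [ENNReal.toReal_ofReal (mollifier_nonneg w), Complex.real_smul]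

theorem mollifierBound_pos (d : ℕ) : 0 < mollifierBound d :=
  lt_of_lt_of_le one_pos (one_le_mollifierBound d)

/-- The mollifier, normalized by its `C^1` bound. -/
noncomputable def mollifierTest (d : ℕ) : 𝓓(cube d, ℝ) :=
  toTest (fun y => (mollifierBound d)⁻¹ * mollifier d y)
    (contDiff_const.mul (contDiff_mollifier d)) 1 (by linarith [Real.two_le_pi])
    (fun y hy => by simp [mollifier_eq_zero hy])

theorem abs_mollifierTest_le {d : ℕ} (y : Rd d) : |mollifierTest d y| ≤ 1 := by
  rw [mollifierTest, toTest_apply, abs_mul, abs_of_pos (inv_pos.2 (mollifierBound_pos d)),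
    inv_mul_le_iff₀ (mollifierBound_pos d), mul_one]
  exact abs_mollifier_le y

theorem mollifierTest_mem_classB (d : ℕ) : mollifierTest d ∈ classB (cube d) 1 := by
  refine mem_classB_one_of_norm abs_mollifierTest_le fun y => ?_
  rw [mollifierTest, coe_toTest,
    fderiv_const_mul ((contDiff_mollifier d).differentiable (by simp) y), norm_smul,
    Real.norm_eq_abs, abs_of_pos (inv_pos.2 (mollifierBound_pos d)),
    inv_mul_le_iff₀ (mollifierBound_pos d), mul_one]
  exact norm_fderiv_mollifier_le y

/-- The averages of a periodic function are its pairings with rescaled mollifiers. -/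
theorem norm_avg_eq {d : ℕ} {g : C(Rd d, ℂ)} (hg : IsPeriodic g) {t : ℝ} (ht : 0 < t) (z : Rd d) :
    ‖avg (mollifierMeasure d) t g z‖ =
      mollifierBound d * ‖(ofFun d g).1 (rescale (mollifierTest d) t z)‖ := by
  have hM0 := mollifierBound_pos d
  have e : avg (mollifierMeasure d) t g z =
      (mollifierBound d : ℂ) * ∫ w, (mollifierTest d w : ℂ) * g (z + t • w) := by
    rw [avg_mollifierMeasure, ← integral_const_mul]
    refine integral_congr_ae (Eventually.of_forall fun w => ?_)
    have : (mollifierBound d : ℂ) ≠ 0 := by exact_mod_cast hM0.ne'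
    simp only [mollifierTest, toTest_apply]
    push_cast
    field_simp
  rw [e, norm_mul, Complex.norm_real, Real.norm_eq_abs, abs_of_pos hM0, ofFun_rescale hg _ ht]

theorem norm_avg_le_of_hzNorm {d : ℕ} {κ : ℝ} (hκ : κ ∈ Set.Ioo (0 : ℝ) (1 / 2)) {g : C(Rd d, ℂ)}
    (hg : IsPeriodic g) {N : ℝ} (hN : 0 ≤ N) (h : hzNorm (-κ) (ofFun d g) ≤ ENNReal.ofReal N)
    (n : ℕ) (z : Rd d) :
    ‖avg (mollifierMeasure d) ((2 : ℝ)⁻¹ ^ n) g z‖ ≤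
      2 * mollifierBound d * N * ((2 : ℝ)⁻¹ ^ n) ^ (-κ) := by
  rw [norm_avg_eq hg (by positivity)]
  calc _ ≤ mollifierBound d * (2 * (N * ((2 : ℝ)⁻¹ ^ n) ^ (-κ))) :=
        mul_le_mul_of_nonneg_left
          (norm_apply_rescale_of_neg hκ hN h z n (mollifierTest_mem_classB d))
          (mollifierBound_pos d).le
    _ = _ := by ring

/-- The norm of order `ν ∈ [0, 1)` controls the pairings with test functions of mean zero. -/
theorem norm_integral_le_of_hzNorm {d : ℕ} {ν : ℝ} (hν : ν ∈ Set.Ico (0 : ℝ) 1) {u : C(Rd d, ℂ)}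
    (hu : IsPeriodic u) {N : ℝ} (hN : 0 ≤ N) (h : hzNorm ν (ofFun d u) ≤ ENNReal.ofReal N)
    {θ : Rd d → ℝ} (hθ : ContDiff ℝ ∞ θ) (h0 : ∀ y, 2 < ‖y‖ → θ y = 0) {M : ℝ} (hM0 : 0 < M)
    (hM : ∀ y, |θ y| ≤ M) (hint : ∫ y, θ y = 0) (n : ℕ) (x : Rd d) :
    ‖∫ w, (θ w : ℂ) * u (x + ((2 : ℝ)⁻¹ ^ n) • w)‖ ≤ 2 * M * N * ((2 : ℝ)⁻¹ ^ n) ^ ν := by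
  have hs : ContDiff ℝ ∞ fun y => M⁻¹ * θ y := contDiff_const.mul hθ
  set ζ : 𝓓(cube d, ℝ) := toTest (fun y => M⁻¹ * θ y) hs 2
    (by linarith [Real.pi_gt_three]) (fun y hy => by simp [h0 y hy]) with hζ
  have hζB : ζ ∈ classB (cube d) 0 ∩ classVanish (cube d) ν := by
    refine ⟨mem_classB_zero_iff.2 fun y => ?_, fun k hk => ?_⟩
    · rw [hζ, toTest_apply, abs_mul, abs_of_pos (inv_pos.2 hM0), inv_mul_le_iff₀ hM0, mul_one]
      exact hM y
    -- as `ν < 1`, only the moment of order zero has to vanish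
    · have hk1 : ∑ i, k i < 1 := by exact_mod_cast hk.trans_lt hν.2
      have hk0 : ∀ i, k i = 0 := fun i => by
        have := Finset.single_le_sum (f := k) (fun _ _ => Nat.zero_le _) (Finset.mem_univ i)
        omega
      simp [hk0, hζ, integral_const_mul, hint]
  have h1 := norm_apply_rescale_of_nonneg hν.1 hN h x n hζB
  rw [ofFun_rescale hu ζ (by positivity)] at h1
  have e : ∫ w, (θ w : ℂ) * u (x + ((2 : ℝ)⁻¹ ^ n) • w) =
      (M : ℂ) * ∫ w, (ζ w : ℂ) * u (x + ((2 : ℝ)⁻¹ ^ n) • w) := by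
    rw [← integral_const_mul]
    refine integral_congr_ae (Eventually.of_forall fun w => ?_)
    have : (M : ℂ) ≠ 0 := by exact_mod_cast hM0.ne'
    simp only [hζ, toTest_apply]
    push_cast
    field_simp
  rw [e, norm_mul, Complex.norm_real, Real.norm_eq_abs, abs_of_pos hM0]
  calc _ ≤ M * (2 * (N * ((2 : ℝ)⁻¹ ^ n) ^ ν)) := by gcongr
    _ = _ := by ring

/-- At unit scale the translates of a function supported in the cube do not overlap. -/
theorem abs_rescaleFun_one_le {d : ℕ} (φ : 𝓓(cube d, ℝ)) (hφ : ∀ y, |φ y| ≤ 1) (x y : Rd d) :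
    |rescaleFun φ 1 x y| ≤ 1 := by
  have hcell : ∀ n : Fin d → ℤ, φ (y - x + period n) ≠ 0 → y - x + period n ∈ cell d := by
    intro n hn i
    have h := φ.tsupport_subset (subset_tsupport _ hn) i
    exact ⟨h.1, h.2.le⟩
  simp only [rescaleFun, one_pow, inv_one, one_mul, one_smul]
  by_cases h : ∃ n : Fin d → ℤ, φ (y - x + period n) ≠ 0
  · obtain ⟨n, hn⟩ := h
    rw [finsum_eq_single _ n fun m hm => ?_]
    · exact hφ _
    · by_contra h'
      exact hm (eq_of_add_period_mem_cell (hcell m h') (hcell n hn))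
  · push Not at h
    simp [h]

theorem norm_avg_one_le {d : ℕ} {ν : ℝ} (hν : 0 ≤ ν) {u : C(Rd d, ℂ)}
    (hu : IsPeriodic u) {N : ℝ} (hN : 0 ≤ N) (h : hzNorm ν (ofFun d u) ≤ ENNReal.ofReal N)
    (x : Rd d) : ‖avg (mollifierMeasure d) 1 u x‖ ≤ 2 * mollifierBound d * N := by
  rw [norm_avg_eq hu one_pos]
  calc _ ≤ mollifierBound d * (2 * N) :=
        mul_le_mul_of_nonneg_left
          (norm_apply_of_nonneg hν hN h (abs_rescaleFun_one_le _ abs_mollifierTest_le x))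
          (mollifierBound_pos d).le
    _ = _ := by ring

/-- Averages at consecutive dyadic scales differ by a test function of mean zero. -/
theorem dist_avg_succ_le {d : ℕ} {ν : ℝ} (hν : ν ∈ Set.Ico (0 : ℝ) 1) {u : C(Rd d, ℂ)}
    (hu : IsPeriodic u) {N : ℝ} (hN : 0 ≤ N) (h : hzNorm ν (ofFun d u) ≤ ENNReal.ofReal N)
    (n : ℕ) (x : Rd d) :
    dist (avg (mollifierMeasure d) ((2 : ℝ)⁻¹ ^ n) u x)
      (avg (mollifierMeasure d) ((2 : ℝ)⁻¹ ^ (n + 1)) u x) ≤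
      2 * (mollifierBound d * (1 + 2 ^ d)) * N * ((2 : ℝ)⁻¹ ^ n) ^ ν := by
  set M := mollifierBound d with hM
  have hM0 : 0 < M := mollifierBound_pos d
  have hσ2 : ContDiff ℝ ∞ fun y : Rd d => mollifier d ((2 : ℝ) • y) :=
    (contDiff_mollifier d).comp (contDiff_const_smul _)
  have hσ2s : HasCompactSupport fun y : Rd d => mollifier d ((2 : ℝ) • y) :=
    (hasCompactSupport_mollifier d).comp_homeomorph (Homeomorph.smulOfNeZero (2 : ℝ) two_ne_zero)
  have hcov : ∀ f : Rd d → ℂ, ∫ w, f w = (2 : ℂ) ^ d * ∫ w, f ((2 : ℝ) • w) := by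
    intro f
    rw [Measure.integral_comp_smul_of_nonneg (volume : Measure (Rd d)) f 2 (hR := by norm_num)]
    simp [Complex.real_smul]
  have hcovr : ∫ w : Rd d, mollifier d ((2 : ℝ) • w) = ((2 : ℝ) ^ d)⁻¹ := by
    rw [Measure.integral_comp_smul_of_nonneg (volume : Measure (Rd d)) _ 2 (hR := by norm_num),
      integral_mollifier]
    simp
  have hi2 : Integrable fun y : Rd d => mollifier d ((2 : ℝ) • y) :=
    hσ2.continuous.integrable_of_hasCompactSupport hσ2s
  have key := norm_integral_le_of_hzNorm hν hu hN h
    (θ := fun y => mollifier d y - 2 ^ d * mollifier d ((2 : ℝ) • y))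
    ((contDiff_mollifier d).sub (contDiff_const.mul hσ2)) (fun y hy => by
      rw [mollifier_eq_zero (by linarith), mollifier_eq_zero, mul_zero, sub_zero]
      rw [norm_smul]
      norm_num
      linarith) (M := M * (1 + 2 ^ d)) (by positivity) (fun y => by
      refine (abs_sub _ _).trans ?_
      rw [abs_mul, abs_of_pos (by positivity : (0 : ℝ) < 2 ^ d)]
      have h1 := abs_mollifier_le y
      have h2 := mul_le_mul_of_nonneg_left (abs_mollifier_le ((2 : ℝ) • y))
        (by positivity : (0 : ℝ) ≤ 2 ^ d)
      rw [← hM] at h1 h2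
      linarith) (by
      rw [integral_sub (integrable_mollifier d) (hi2.const_mul _), integral_const_mul, hcovr,
        integral_mollifier]
      simp) n x
  refine le_trans (le_of_eq ?_) key
  rw [dist_eq_norm, avg_mollifierMeasure, avg_mollifierMeasure,
    hcov fun w => (mollifier d w : ℂ) * u (x + ((2 : ℝ)⁻¹ ^ (n + 1)) • w), ← integral_const_mul,
    ← integral_sub]
  · congr 1
    refine integral_congr_ae (Eventually.of_forall fun w => ?_)
    have e : ((2 : ℝ)⁻¹ ^ (n + 1)) • (2 : ℝ) • w = ((2 : ℝ)⁻¹ ^ n) • w := by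
      rw [smul_smul, pow_succ]
      congr 1
      ring
    simp only [e]
    push_cast
    ring
  · refine Continuous.integrable_of_hasCompactSupport ?_ ?_
    · exact (Complex.continuous_ofReal.comp (contDiff_mollifier d).continuous).mul
        (u.continuous.comp (by fun_prop))
    · exact ((hasCompactSupport_mollifier d).comp_left (g := Complex.ofReal) rfl).mul_right
  · refine Continuous.integrable_of_hasCompactSupport ?_ ?_
    · exact continuous_const.mul ((Complex.continuous_ofReal.comp hσ2.continuous).mul
        (u.continuous.comp (by fun_prop)))
    · exact ((hσ2s.comp_left (g := Complex.ofReal) rfl).mul_right).mul_left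

/-- Averages at the same scale around nearby points differ by a test function of mean zero. -/
theorem dist_avg_add_le {d : ℕ} {ν : ℝ} (hν : ν ∈ Set.Ico (0 : ℝ) 1) {u : C(Rd d, ℂ)}
    (hu : IsPeriodic u) {N : ℝ} (hN : 0 ≤ N) (h : hzNorm ν (ofFun d u) ≤ ENNReal.ofReal N)
    (n : ℕ) (x : Rd d) {y : Rd d} (hy : ‖y‖ ≤ (2 : ℝ)⁻¹ ^ n) :
    dist (avg (mollifierMeasure d) ((2 : ℝ)⁻¹ ^ n) u (x + y))
      (avg (mollifierMeasure d) ((2 : ℝ)⁻¹ ^ n) u x) ≤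
      2 * (mollifierBound d * 2) * N * ((2 : ℝ)⁻¹ ^ n) ^ ν := by
  set M := mollifierBound d with hM
  have hM0 : 0 < M := mollifierBound_pos d
  have hp : (0 : ℝ) < (2 : ℝ)⁻¹ ^ n := by positivity
  set v : Rd d := ((2 : ℝ)⁻¹ ^ n)⁻¹ • y with hv
  have hv1 : ‖v‖ ≤ 1 := by
    rw [hv, norm_smul, norm_inv, Real.norm_eq_abs, abs_of_pos hp, inv_mul_le_iff₀ hp, mul_one]
    exact hy
  have hyv : y = ((2 : ℝ)⁻¹ ^ n) • v := by rw [hv, smul_inv_smul₀ hp.ne']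
  have hσ2 : ContDiff ℝ ∞ fun w : Rd d => mollifier d (w - v) :=
    (contDiff_mollifier d).comp (contDiff_id.sub contDiff_const)
  have hσ2s : HasCompactSupport fun w : Rd d => mollifier d (w - v) :=
    (hasCompactSupport_mollifier d).comp_homeomorph (Homeomorph.subRight v)
  have hi2 : Integrable fun w : Rd d => mollifier d (w - v) :=
    hσ2.continuous.integrable_of_hasCompactSupport hσ2s
  have key := norm_integral_le_of_hzNorm hν hu hN h
    (θ := fun w => mollifier d (w - v) - mollifier d w)
    (hσ2.sub (contDiff_mollifier d)) (fun w hw => by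
      have := norm_sub_norm_le w v
      rw [mollifier_eq_zero (by linarith), mollifier_eq_zero (by linarith), sub_zero])
    (M := M * 2) (by positivity) (fun w => by
      refine (abs_sub _ _).trans ?_
      have h1 := abs_mollifier_le w
      have h2 := abs_mollifier_le (w - v)
      rw [← hM] at h1 h2
      linarith) (by
      rw [integral_sub hi2 (integrable_mollifier d), integral_sub_right_eq_self]
      simp) n x
  refine le_trans (le_of_eq ?_) key
  rw [dist_eq_norm, avg_mollifierMeasure, avg_mollifierMeasure,
    ← integral_sub_right_eq_self
      (fun w => (mollifier d w : ℂ) * u (x + y + ((2 : ℝ)⁻¹ ^ n) • w)) v, ← integral_sub]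
  · congr 1
    refine integral_congr_ae (Eventually.of_forall fun w => ?_)
    have e : x + y + ((2 : ℝ)⁻¹ ^ n) • (w - v) = x + ((2 : ℝ)⁻¹ ^ n) • w := by
      rw [smul_sub, ← hyv]
      abel
    simp only [e]
    push_cast
    ring
  · refine Continuous.integrable_of_hasCompactSupport ?_ ?_
    · exact (Complex.continuous_ofReal.comp hσ2.continuous).mul
        (u.continuous.comp (by fun_prop))
    · exact (hσ2s.comp_left (g := Complex.ofReal) rfl).mul_right
  · refine Continuous.integrable_of_hasCompactSupport ?_ ?_
    · exact (Complex.continuous_ofReal.comp (contDiff_mollifier d).continuous).mul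
        (u.continuous.comp (by fun_prop))
    · exact ((hasCompactSupport_mollifier d).comp_left (g := Complex.ofReal) rfl).mul_right

/-- A continuous function of finite Hölder–Zygmund norm is bounded and Hölder continuous, with a
constant which is uniform for orders bounded away from zero: its values are the limits of its
averages along dyadic scales. -/
theorem exists_holder_bound (d : ℕ) {κ : ℝ} (hκ : 0 < κ) :
    ∃ C : ℝ, 0 < C ∧ ∀ ν ∈ Set.Ioo (2 * κ) 1, ∀ u : C(Rd d, ℂ), IsPeriodic u → ∀ N : ℝ, 0 ≤ N →
      hzNorm ν (ofFun d u) ≤ ENNReal.ofReal N →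
      (∀ x, ‖u x‖ ≤ C * N) ∧ ∀ x y, ‖y‖ ≤ 1 → ‖u (x + y) - u x‖ ≤ C * N * ‖y‖ ^ ν := by
  set M := mollifierBound d with hM
  have hM0 : 0 < M := mollifierBound_pos d
  set r₀ : ℝ := (2 : ℝ)⁻¹ ^ (2 * κ) with hr₀
  have hr₀1 : r₀ < 1 := Real.rpow_lt_one (by norm_num) (by norm_num) (by linarith)
  set D : ℝ := 2 * (M * (1 + 2 ^ d)) / (1 - r₀) with hD
  have hD0 : 0 < D := div_pos (by positivity) (by linarith)
  refine ⟨2 * (2 * D + 4 * M), by positivity, fun ν hν u hu N hN h => ?_⟩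
  have hν0 : 0 < ν := by linarith [hν.1]
  have hν' : ν ∈ Set.Ico (0 : ℝ) 1 := ⟨hν0.le, hν.2⟩
  obtain ⟨B, hB⟩ := hu.exists_bound u.continuous
  set r : ℝ := (2 : ℝ)⁻¹ ^ ν with hr
  have hrr : r ≤ r₀ :=
    Real.rpow_le_rpow_of_exponent_ge (by norm_num) (by norm_num) hν.1.le
  have hr1 : r < 1 := hrr.trans_lt hr₀1
  have hpow : ∀ n : ℕ, ((2 : ℝ)⁻¹ ^ n) ^ ν = r ^ n := fun n => by
    rw [hr, Real.rpow_pow_comm (by norm_num)]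
  have hconv : ∀ n x, dist (avg (mollifierMeasure d) ((2 : ℝ)⁻¹ ^ n) u x) (u x) ≤
      D * N * ((2 : ℝ)⁻¹ ^ n) ^ ν := by
    intro n x
    have h1 := dist_le_of_le_geometric_of_tendsto r (hr := hr1)
      (f := fun n => avg (mollifierMeasure d) ((2 : ℝ)⁻¹ ^ n) u x)
      (C := 2 * (M * (1 + 2 ^ d)) * N) (fun n => by
        have := dist_avg_succ_le hν' hu hN h n x
        rwa [hpow] at this)
      (tendsto_avg (ae_mollifierMeasure_norm_le d) u.continuous hB x) n
    refine h1.trans ?_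
    rw [hpow]
    have hrn : 0 ≤ r ^ n := by positivity
    calc 2 * (M * (1 + 2 ^ d)) * N * r ^ n / (1 - r)
        ≤ 2 * (M * (1 + 2 ^ d)) * N * r ^ n / (1 - r₀) := by
          refine div_le_div_of_nonneg_left (by positivity) (by linarith) (by linarith)
      _ = D * N * r ^ n := by
          rw [hD]
          ring
  constructor
  · intro x
    have h1 := hconv 0 x
    have h2 := norm_avg_one_le hν0.le hu hN h x
    rw [dist_comm, dist_eq_norm] at h1
    simp only [pow_zero, Real.one_rpow, mul_one] at h1
    have h3 := norm_add_le (u x - avg (mollifierMeasure d) 1 u x) (avg (mollifierMeasure d) 1 u x)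
    rw [sub_add_cancel] at h3
    rw [← hM] at h2
    have : 0 ≤ D * N := by positivity
    have : 0 ≤ M * N := by positivity
    linarith
  · intro x y hy
    rcases eq_or_ne y 0 with rfl | hy0
    · simp [Real.zero_rpow hν0.ne']
    obtain ⟨n, hn1, hn2⟩ := exists_nat_pow_near_of_lt_one (norm_pos_iff.2 hy0) hy
      (by norm_num : (0 : ℝ) < 2⁻¹) (by norm_num)
    have h1 := hconv n x
    have h2 := hconv n (x + y)
    have h3 := dist_avg_add_le hν' hu hN h n x hn2
    rw [← hM] at h3
    rw [← dist_eq_norm]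
    have hp : (0 : ℝ) < (2 : ℝ)⁻¹ ^ n := by positivity
    have h4 : ((2 : ℝ)⁻¹ ^ n) ^ ν ≤ 2 * ‖y‖ ^ ν := by
      have e : (2 : ℝ)⁻¹ ^ n ≤ 2 * ‖y‖ := by
        rw [pow_succ] at hn1
        linarith
      calc ((2 : ℝ)⁻¹ ^ n) ^ ν ≤ (2 * ‖y‖) ^ ν := by gcongr
        _ = 2 ^ ν * ‖y‖ ^ ν := Real.mul_rpow (by norm_num) (norm_nonneg _)
        _ ≤ 2 * ‖y‖ ^ ν := by
          gcongr
          calc (2 : ℝ) ^ ν ≤ 2 ^ (1 : ℝ) :=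
                Real.rpow_le_rpow_of_exponent_le (by norm_num) hν.2.le
            _ = 2 := Real.rpow_one 2
    calc dist (u (x + y)) (u x)
        ≤ dist (u (x + y)) (avg (mollifierMeasure d) ((2 : ℝ)⁻¹ ^ n) u (x + y)) +
          dist (avg (mollifierMeasure d) ((2 : ℝ)⁻¹ ^ n) u (x + y))
            (avg (mollifierMeasure d) ((2 : ℝ)⁻¹ ^ n) u x) +
          dist (avg (mollifierMeasure d) ((2 : ℝ)⁻¹ ^ n) u x) (u x) := dist_triangle4 _ _ _ _
      _ ≤ (2 * D + 4 * M) * N * ((2 : ℝ)⁻¹ ^ n) ^ ν := by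
          rw [dist_comm (u (x + y))]
          linarith
      _ ≤ (2 * D + 4 * M) * N * (2 * ‖y‖ ^ ν) := by gcongr
      _ = _ := by ring

/-! ### The Young estimate for continuous functions -/

/-- The local Hölder condition propagates to longer increments by chaining. -/
theorem norm_increment_le {d : ℕ} {u : Rd d → ℂ} {H ν : ℝ} (hH : 0 ≤ H) (hν : 0 ≤ ν)
    (hu : ∀ x y, ‖y‖ ≤ 1 → ‖u (x + y) - u x‖ ≤ H * ‖y‖ ^ ν) {t : ℝ} (ht : t ≤ 1)
    (m : ℕ) (x y : Rd d) (hy : ‖y‖ ≤ m * t) : ‖u (x + y) - u x‖ ≤ m * (H * t ^ ν) := by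
  induction m generalizing x y with
  | zero =>
    have : y = 0 := by simpa using hy
    simp [this]
  | succ m ih =>
    have hm : (0 : ℝ) < m + 1 := by positivity
    push_cast at hy ⊢
    set y₁ : Rd d := ((m : ℝ) / (m + 1)) • y with hy₁
    set y₂ : Rd d := ((1 : ℝ) / (m + 1)) • y with hy₂
    have e : x + y = (x + y₁) + y₂ := by
      rw [add_assoc, hy₁, hy₂, ← add_smul, ← add_div, div_self hm.ne', one_smul]
    have n1 : ‖y₁‖ ≤ m * t := by
      rw [hy₁, norm_smul, Real.norm_eq_abs, abs_of_nonneg (by positivity), div_mul_eq_mul_div,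
        div_le_iff₀ hm]
      nlinarith [(Nat.cast_nonneg m : (0 : ℝ) ≤ m)]
    have n2 : ‖y₂‖ ≤ t := by
      rw [hy₂, norm_smul, Real.norm_eq_abs, abs_of_nonneg (by positivity), div_mul_eq_mul_div,
        div_le_iff₀ hm]
      linarith
    have h1 := ih x y₁ n1
    have h2 : ‖u (x + y₁ + y₂) - u (x + y₁)‖ ≤ H * t ^ ν :=
      (hu _ _ (n2.trans ht)).trans (by gcongr)
    rw [e]
    have h3 := norm_sub_le_norm_sub_add_norm_sub (u (x + y₁ + y₂)) (u (x + y₁)) (u x)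
    linarith

/-- The local estimate at dyadic scales. In the coordinate `w` given by `y = x + l w`, the averages
of `g` at scale `2^{-k}` are its averages at scale `l 2^{-k}`, again a dyadic scale. -/
theorem norm_integral_increment_le_dyadic {d : ℕ} {κ ν : ℝ} (hκ : κ ∈ Set.Ioo (0 : ℝ) (1 / 2))
    (hν : ν ∈ Set.Ioo (2 * κ) 1) {R : ℝ} {m : ℕ} (hm : R + 1 ≤ m) {u g : C(Rd d, ℂ)}
    (hg : IsPeriodic g) {H N b : ℝ} (hH : 0 ≤ H) (hN : 0 ≤ N)
    (hu : ∀ x y, ‖y‖ ≤ 1 → ‖u (x + y) - u x‖ ≤ H * ‖y‖ ^ ν)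
    (hgN : hzNorm (-κ) (ofFun d g) ≤ ENNReal.ofReal N) {φ : Rd d → ℝ}
    (hφ0 : ∀ w, R < ‖w‖ → φ w = 0) (hφb : ∀ w, |φ w| ≤ b)
    (hφl : ∀ w z, |φ w - φ z| ≤ b * ‖w - z‖) (n : ℕ) (x : Rd d) :
    ‖∫ w, (φ w : ℂ) * ((u (x + ((2 : ℝ)⁻¹ ^ n) • w) - u x) * g (x + ((2 : ℝ)⁻¹ ^ n) • w))‖ ≤
      multiscaleConst d κ R * (2 * mollifierBound d * (1 + m)) * (b * H * N) *
        ((2 : ℝ)⁻¹ ^ n) ^ (ν - κ) := by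
  have hν0 : 0 < ν := by linarith [hν.1, hκ.1]
  have hM0 : 0 < mollifierBound d := mollifierBound_pos d
  set l : ℝ := (2 : ℝ)⁻¹ ^ n with hl
  have hl0 : 0 < l := by positivity
  have hl1 : l ≤ 1 := pow_le_one₀ (by norm_num) (by norm_num)
  have hb0 : 0 ≤ b := (abs_nonneg _).trans (hφb 0)
  obtain ⟨B, hB⟩ := hg.exists_bound g.continuous
  have hφc : Continuous φ := by
    have : LipschitzWith (Real.toNNReal b) φ := LipschitzWith.of_dist_le_mul fun w z => by
      rw [Real.coe_toNNReal _ hb0, Real.dist_eq, dist_eq_norm]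
      exact hφl w z
    exact this.continuous
  set K : ℝ := (1 + m) * (b * H * l ^ ν) with hK
  have hlν : 0 ≤ l ^ ν := by positivity
  have hinc : ∀ w : Rd d, ‖w‖ ≤ R + 1 → ‖u (x + l • w) - u x‖ ≤ m * (H * l ^ ν) := by
    intro w hw
    refine norm_increment_le hH hν0.le hu hl1 m x _ ?_
    rw [norm_smul, Real.norm_eq_abs, abs_of_pos hl0, mul_comm]
    exact mul_le_mul_of_nonneg_right (hw.trans hm) hl0.le
  have hm0 : (0 : ℝ) ≤ m := Nat.cast_nonneg m
  have key := norm_integral_mul_le (μ := mollifierMeasure d) (ae_mollifierMeasure_norm_le d)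
    (κ := κ) (ν := ν) (A := 2 * mollifierBound d * N * l ^ (-κ)) (H := K) (R := R) (B := B)
    (g := fun w => g (x + l • w)) (h := fun w => (φ w : ℂ) * (u (x + l • w) - u x)) hκ.1 hν.1
    (g.continuous.comp (by fun_prop)) (fun _ => hB _) (fun k z => ?_) ?_ (fun w hw => ?_)
    (fun w => ?_) (fun z w hzw => ?_)
  · have e : ∫ w, (φ w : ℂ) * ((u (x + l • w) - u x) * g (x + l • w)) =
        ∫ w, g (x + l • w) * ((φ w : ℂ) * (u (x + l • w) - u x)) := by
      refine integral_congr_ae (Eventually.of_forall fun w => ?_)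
      simp only
      ring
    rw [e]
    refine key.trans (le_of_eq ?_)
    rw [hK, sub_eq_add_neg, Real.rpow_add hl0]
    ring
  · have e : avg (mollifierMeasure d) ((2 : ℝ)⁻¹ ^ k) (fun w => g (x + l • w)) z =
        avg (mollifierMeasure d) ((2 : ℝ)⁻¹ ^ (n + k)) g (x + l • z) := by
      unfold avg
      refine integral_congr_ae (Eventually.of_forall fun w => ?_)
      simp only [smul_add, smul_smul, pow_add, add_assoc, hl]
    rw [e]
    refine (norm_avg_le_of_hzNorm hκ hg hN hgN _ _).trans (le_of_eq ?_)
    rw [pow_add, Real.mul_rpow (by positivity) (by positivity)]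
    ring
  · exact (Complex.continuous_ofReal.comp hφc).mul
      ((u.continuous.comp (by fun_prop)).sub continuous_const)
  · simp [hφ0 w hw]
  · by_cases hw : R < ‖w‖
    · simp only [hφ0 w hw, Complex.ofReal_zero, zero_mul, norm_zero]
      positivity
    · rw [norm_mul, Complex.norm_real, Real.norm_eq_abs]
      calc |φ w| * ‖u (x + l • w) - u x‖ ≤ b * (m * (H * l ^ ν)) :=
            mul_le_mul (hφb w) (hinc w (by linarith [not_lt.1 hw])) (norm_nonneg _) hb0
        _ ≤ K := by
            rw [hK]
            have : 0 ≤ b * H * l ^ ν := by positivity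
            linarith
  -- if `h` does not vanish at both points, then both lie in the ball of radius `R + 1`
  · by_cases hboth : R < ‖z‖ ∧ R < ‖w‖
    · simp only [hφ0 z hboth.1, hφ0 w hboth.2, Complex.ofReal_zero, zero_mul, sub_self, norm_zero]
      positivity
    have hw : ‖w‖ ≤ R + 1 := by
      by_contra hcon
      refine hboth ⟨?_, by linarith⟩
      have := norm_sub_norm_le w z
      rw [norm_sub_rev] at this
      linarith
    have h1 : ‖u (x + l • z) - u (x + l • w)‖ ≤ H * (l ^ ν * ‖z - w‖ ^ ν) := by
      have e : x + l • z = (x + l • w) + l • (z - w) := by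
        rw [smul_sub]
        abel
      have e' : ‖l • (z - w)‖ = l * ‖z - w‖ := by
        rw [norm_smul, Real.norm_eq_abs, abs_of_pos hl0]
      rw [e, ← Real.mul_rpow hl0.le (norm_nonneg _), ← e']
      refine hu _ _ ?_
      rw [e']
      exact mul_le_one₀ hl1 (norm_nonneg _) hzw
    have h2 : ‖z - w‖ ≤ ‖z - w‖ ^ ν := Real.self_le_rpow_of_le_one (norm_nonneg _) hzw hν.2.le
    have e : (φ z : ℂ) * (u (x + l • z) - u x) - (φ w : ℂ) * (u (x + l • w) - u x) =
        (φ z : ℂ) * (u (x + l • z) - u (x + l • w)) +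
          ((φ z - φ w : ℝ) : ℂ) * (u (x + l • w) - u x) := by
      push_cast
      ring
    rw [e]
    refine (norm_add_le _ _).trans ?_
    rw [norm_mul, norm_mul, Complex.norm_real, Complex.norm_real, Real.norm_eq_abs,
      Real.norm_eq_abs]
    have h3 : |φ z| * ‖u (x + l • z) - u (x + l • w)‖ ≤ b * (H * (l ^ ν * ‖z - w‖ ^ ν)) :=
      mul_le_mul (hφb z) h1 (norm_nonneg _) hb0
    have h4 : |φ z - φ w| * ‖u (x + l • w) - u x‖ ≤ (b * ‖z - w‖ ^ ν) * (m * (H * l ^ ν)) :=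
      mul_le_mul ((hφl z w).trans (by gcongr)) (hinc w hw) (norm_nonneg _) (by positivity)
    refine (add_le_add h3 h4).trans (le_of_eq ?_)
    rw [hK]
    ring

/-- The increment `u - u(x)` gains a factor `l^ν` at scale `l` around `x`, so its product with `g`
is of order `l^{ν - κ}` there. -/
theorem exists_norm_integral_increment_le (d : ℕ) {κ : ℝ} (hκ : κ ∈ Set.Ioo (0 : ℝ) (1 / 2))
    (R : ℝ) : ∃ C : ℝ, 0 < C ∧ ∀ ν ∈ Set.Ioo (2 * κ) 1, ∀ u g : C(Rd d, ℂ),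
      IsPeriodic g → ∀ H N b : ℝ, 0 ≤ H → 0 ≤ N →
      (∀ x y, ‖y‖ ≤ 1 → ‖u (x + y) - u x‖ ≤ H * ‖y‖ ^ ν) →
      hzNorm (-κ) (ofFun d g) ≤ ENNReal.ofReal N → ∀ φ : Rd d → ℝ,
      (∀ w, R < ‖w‖ → φ w = 0) → (∀ w, |φ w| ≤ b) → (∀ w z, |φ w - φ z| ≤ b * ‖w - z‖) →
      ∀ l ∈ Set.Ioc (0 : ℝ) 1, ∀ x : Rd d,
      ‖∫ w, (φ w : ℂ) * ((u (x + l • w) - u x) * g (x + l • w))‖ ≤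
        C * (b * H * N) * l ^ (ν - κ) := by
  obtain ⟨m, hm⟩ := exists_nat_ge (R + 1)
  have hM0 : 0 < mollifierBound d := mollifierBound_pos d
  set K : ℝ := max 1 (multiscaleConst d κ R * (2 * mollifierBound d * (1 + m))) with hK
  have hK0 : 0 < K := lt_of_lt_of_le one_pos (le_max_left _ _)
  refine ⟨2 ^ d * K * 4, by positivity, ?_⟩
  intro ν hν u g hg H N b hH hN hu hgN φ hφ0 hφb hφl l hl x
  have hb0 : 0 ≤ b := (abs_nonneg _).trans (hφb 0)
  -- a general scale is dyadic up to a factor `c ∈ [1, 2)`, absorbed into the test function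
  obtain ⟨n, hn1, hn2⟩ := exists_nat_pow_near_of_lt_one hl.1 hl.2
    (by norm_num : (0 : ℝ) < 2⁻¹) (by norm_num)
  set l₀ : ℝ := (2 : ℝ)⁻¹ ^ n with hl₀
  have hl₀0 : 0 < l₀ := by positivity
  have hl2 : l₀ ≤ 2 * l := by
    rw [pow_succ] at hn1
    linarith
  set c : ℝ := l₀ / l with hc
  have hc1 : 1 ≤ c := (one_le_div hl.1).2 hn2
  have hc2 : c ≤ 2 := (div_le_iff₀ hl.1).2 hl2
  have hc0 : 0 < c := lt_of_lt_of_le one_pos hc1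
  have hlc : l * c = l₀ := by
    rw [hc]
    field_simp [hl.1.ne']
  have hb2 : b ≤ 2 * b := by linarith
  have key := norm_integral_increment_le_dyadic (φ := fun w => φ (c • w)) (b := 2 * b) hκ hν hm
    hg hH hN hu hgN (fun w hw => hφ0 _ (by
      rw [norm_smul, Real.norm_eq_abs, abs_of_pos hc0]
      nlinarith [norm_nonneg w])) (fun w => (hφb _).trans hb2)
    (fun w z => (hφl _ _).trans (by
      rw [← smul_sub, norm_smul, Real.norm_eq_abs, abs_of_pos hc0]
      nlinarith [mul_nonneg hb0 (norm_nonneg (w - z))])) n x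
  have hcov : ∫ w, (φ w : ℂ) * ((u (x + l • w) - u x) * g (x + l • w)) =
      (c : ℂ) ^ d * ∫ w, (φ (c • w) : ℂ) * ((u (x + l₀ • w) - u x) * g (x + l₀ • w)) := by
    have h1 := Measure.integral_comp_smul_of_nonneg (volume : Measure (Rd d))
      (fun w => (φ w : ℂ) * ((u (x + l • w) - u x) * g (x + l • w))) c (hR := hc0.le)
    simp only [smul_smul, hlc] at h1
    rw [h1]
    have : (c : ℂ) ^ d ≠ 0 := pow_ne_zero _ (by exact_mod_cast hc0.ne')
    simp only [finrank_euclideanSpace, Fintype.card_fin, Complex.real_smul]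
    push_cast
    field_simp
  have hνκ0 : 0 < ν - κ := by linarith [hν.1, hκ.1]
  have hνκ1 : ν - κ ≤ 1 := by linarith [hν.2, hκ.1]
  have hpow : l₀ ^ (ν - κ) ≤ 2 * l ^ (ν - κ) := by
    calc l₀ ^ (ν - κ) ≤ (2 * l) ^ (ν - κ) := by gcongr
      _ = 2 ^ (ν - κ) * l ^ (ν - κ) := Real.mul_rpow (by norm_num) hl.1.le
      _ ≤ 2 * l ^ (ν - κ) := by
        have := hl.1
        gcongr
        calc (2 : ℝ) ^ (ν - κ) ≤ 2 ^ (1 : ℝ) :=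
              Real.rpow_le_rpow_of_exponent_le (by norm_num) hνκ1
          _ = 2 := Real.rpow_one 2
  have hlp : 0 ≤ l ^ (ν - κ) := Real.rpow_nonneg hl.1.le _
  rw [hcov, norm_mul, norm_pow, Complex.norm_real, Real.norm_eq_abs, abs_of_pos hc0]
  calc _ ≤ 2 ^ d * (K * (2 * b * H * N) * (2 * l ^ (ν - κ))) := by
        refine mul_le_mul (pow_le_pow_left₀ hc0.le hc2 d) ?_ (norm_nonneg _) (by positivity)
        refine key.trans ?_
        refine mul_le_mul ?_ hpow (by positivity) (by positivity)
        exact mul_le_mul_of_nonneg_right (le_max_right _ _) (by positivity)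
    _ = _ := by ring

theorem abs_sub_le_of_norm_fderiv_le {d : ℕ} {φ : Rd d → ℝ} (hφ : ContDiff ℝ ∞ φ) {b : ℝ}
    (h : ∀ y, ‖fderiv ℝ φ y‖ ≤ b) (w z : Rd d) : |φ w - φ z| ≤ b * ‖w - z‖ := by
  have := Convex.norm_image_sub_le_of_norm_fderiv_le (𝕜 := ℝ) (f := φ) (s := univ) (C := b)
    (x := z) (y := w) (fun y _ => hφ.differentiable (by simp) y) (fun y _ => h y) convex_univ
    (mem_univ _) (mem_univ _)
  simpa using this

/-- The Young estimate: multiplication is bounded from `𝒵^ν × 𝒵^{-κ}` to `𝒵^{-κ}` on continuous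
functions. -/
theorem exists_hzNorm_mul_le (d : ℕ) {κ : ℝ} (hκ : κ ∈ Set.Ioo (0 : ℝ) (1 / 2)) :
    ∃ C : ℝ, 0 < C ∧ ∀ ν ∈ Set.Ioo (2 * κ) 1, ∀ u g : C(Rd d, ℂ),
      IsPeriodic u → IsPeriodic g → ∀ Nu Ng : ℝ, 0 ≤ Nu → 0 ≤ Ng →
      hzNorm ν (ofFun d u) ≤ ENNReal.ofReal Nu → hzNorm (-κ) (ofFun d g) ≤ ENNReal.ofReal Ng →
      hzNorm (-κ) (ofFun d (u * g)) ≤ ENNReal.ofReal (C * (Nu * Ng)) := by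
  obtain ⟨C₁, hC₁, h₁⟩ := exists_holder_bound d hκ.1
  obtain ⟨C₂, hC₂, h₂⟩ := exists_norm_integral_increment_le d hκ (Real.sqrt (d * Real.pi ^ 2))
  refine ⟨2 * (C₂ * ((d + 1) * C₁) + 2 * C₁), by positivity, ?_⟩
  intro ν hν u g hu hg Nu Ng hNu hNg hu' hg'
  obtain ⟨hsup, hhol⟩ := h₁ ν hν u hu Nu hNu hu'
  have hug : IsPeriodic (u * g : C(Rd d, ℂ)) := fun n y => by simp [hu n y, hg n y]
  have := hzNorm_neg_le (d := d) hκ (f := ofFun d (u * g))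
    (N := (C₂ * ((d + 1) * C₁) + 2 * C₁) * (Nu * Ng)) (by positivity) fun x n φ hφ => ?_
  · refine this.trans (le_of_eq ?_)
    congr 1
    ring
  set l : ℝ := (2 : ℝ)⁻¹ ^ n with hl
  have hl0 : 0 < l := by positivity
  have hl1 : l ≤ 1 := pow_le_one₀ (by norm_num) (by norm_num)
  have hd0 : (0 : ℝ) ≤ d := Nat.cast_nonneg d
  have h3 := h₂ ν hν u g hg (C₁ * Nu) Ng (d + 1) (by positivity) hNg hhol hg' φ
    (fun w hw => eq_zero_of_lt_norm φ hw)
    (fun w => ((mem_classB_one_iff.1 hφ).1 w).trans (by linarith))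
    (abs_sub_le_of_norm_fderiv_le φ.contDiff fun y =>
      (norm_fderiv_le_of_mem_classB hφ y).trans (by linarith)) l ⟨hl0, hl1⟩ x
  have h4 := norm_apply_rescale_of_neg hκ hNg hg' x n hφ
  rw [ofFun_rescale hg φ hl0] at h4
  rw [ofFun_rescale hug φ hl0]
  have hint : ∀ F : Rd d → ℂ, Continuous F → Integrable fun w => (φ w : ℂ) * F w := by
    intro F hF
    refine Continuous.integrable_of_hasCompactSupport ?_ ?_
    · exact (Complex.continuous_ofReal.comp φ.contDiff.continuous).mul hF
    · exact (φ.hasCompactSupport.comp_left (g := Complex.ofReal) rfl).mul_right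
  have hgc : Continuous fun w => g (x + l • w) := g.continuous.comp (by fun_prop)
  have huc : Continuous fun w => u (x + l • w) := u.continuous.comp (by fun_prop)
  have e : ∫ w, (φ w : ℂ) * (u * g : C(Rd d, ℂ)) (x + l • w) =
      (∫ w, (φ w : ℂ) * ((u (x + l • w) - u x) * g (x + l • w))) +
        u x * ∫ w, (φ w : ℂ) * g (x + l • w) := by
    rw [← integral_const_mul, ← integral_add (hint (fun w => (u (x + l • w) - u x) * g (x + l • w))
        ((huc.sub continuous_const).mul hgc))
      ((hint _ hgc).const_mul _)]
    refine integral_congr_ae (Eventually.of_forall fun w => ?_)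
    simp only [ContinuousMap.mul_apply]
    ring
  rw [e]
  have hlp : l ^ (ν - κ) ≤ l ^ (-κ) :=
    Real.rpow_le_rpow_of_exponent_ge hl0 hl1 (by linarith [hν.1, hκ.1])
  calc _ ≤ C₂ * ((d + 1) * (C₁ * Nu) * Ng) * l ^ (-κ) +
        (C₁ * Nu) * (2 * (Ng * l ^ (-κ))) := by
        refine (norm_add_le _ _).trans (add_le_add (h3.trans ?_) ?_)
        · exact mul_le_mul_of_nonneg_left hlp (by positivity)
        · rw [norm_mul]
          exact mul_le_mul (hsup x) h4 (norm_nonneg _) (by positivity)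
    _ = _ := by ring

/-! ### Distributions of finite norm are of order one -/

theorem rescaleFun_one {d : ℕ} (φ : Rd d → ℝ) (x y : Rd d) :
    rescaleFun φ 1 x y = ∑ᶠ n : Fin d → ℤ, φ (y - x + period n) := by
  simp [rescaleFun]

/-- Multiplying the periodization of `χ` by a periodic function localizes that function by `χ`. -/
theorem rescaleFun_one_mul {d : ℕ} {χ ψ : Rd d → ℝ} (hψ : IsPeriodic ψ)
    (x y : Rd d) :
    rescaleFun (fun w => χ w * ψ (w + x)) 1 x y = rescaleFun χ 1 x y * ψ y := by
  rw [rescaleFun_one, rescaleFun_one, finsum_mul]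
  refine finsum_congr fun n => ?_
  rw [show y - x + period n + x = y + period n by abel, hψ n y]

theorem le_rescaleFun_one {d : ℕ} {χ : Rd d → ℝ} (hc : HasCompactSupport χ) (h0 : ∀ y, 0 ≤ χ y)
    (x y : Rd d) (n : Fin d → ℤ) : χ (y - x + period n) ≤ rescaleFun χ 1 x y := by
  obtain ⟨S, hS⟩ := exists_finset_period hc one_ne_zero x ‖y‖
  rw [rescaleFun_one]
  refine single_le_finsum (f := fun n => χ (y - x + period n)) n
    (S.finite_toSet.subset fun n hn => ?_) fun n => h0 _
  by_contra h
  refine hn ?_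
  have := hS y le_rfl n h
  rwa [inv_one, one_smul] at this

theorem norm_fderiv_mul_le {d : ℕ} {f g : Rd d → ℝ} (hf : ContDiff ℝ ∞ f) (hg : ContDiff ℝ ∞ g)
    {A B : ℝ} (hA : ∀ y, |f y| ≤ A) (hA' : ∀ y, ‖fderiv ℝ f y‖ ≤ A) (hB : ∀ y, |g y| ≤ B)
    (hB' : ∀ y, ‖fderiv ℝ g y‖ ≤ B) (y : Rd d) :
    ‖fderiv ℝ (fun w => f w * g w) y‖ ≤ 2 * (A * B) := by
  rw [fderiv_fun_mul (hf.differentiable (by simp) y) (hg.differentiable (by simp) y)]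
  have hA0 : 0 ≤ A := (abs_nonneg _).trans (hA y)
  refine (norm_add_le _ _).trans ?_
  rw [norm_smul, norm_smul, Real.norm_eq_abs, Real.norm_eq_abs, two_mul]
  refine add_le_add (mul_le_mul (hA y) (hB' y) (norm_nonneg _) hA0) ?_
  rw [mul_comm A B]
  exact mul_le_mul (hB y) (hA' y) (norm_nonneg _) ((abs_nonneg _).trans (hB y))

/-- A distribution of finite norm of order `-κ` is bounded by the `C^1` norm: a partition of unity
writes a smooth function on the torus as a sum of finitely many localized test functions. -/
theorem exists_norm_apply_le (d : ℕ) {κ : ℝ} (hκ : κ ∈ Set.Ioo (0 : ℝ) (1 / 2)) :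
    ∃ C : ℝ, 0 ≤ C ∧ ∀ (F : Dist d) (N : ℝ), 0 ≤ N → hzNorm (-κ) F ≤ ENNReal.ofReal N →
      ∀ (φ : TestFn d) (B : ℝ), (∀ y, |(φ : Rd d → ℝ) y| ≤ B) →
      (∀ y, ‖fderiv ℝ (φ : Rd d → ℝ) y‖ ≤ B) → ‖F.1 φ‖ ≤ C * N * B := by
  obtain ⟨t, -, htf, hcov⟩ := (isCompact_closedBall (0 : Rd d)
    (Real.sqrt (d * Real.pi ^ 2))).finite_cover_balls one_pos
  lift t to Finset (Rd d) using htf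
  set χ : ContDiffBump (0 : Rd d) := ⟨1, 2, by norm_num, by norm_num⟩ with hχ
  have hχc : HasCompactSupport χ := χ.hasCompactSupport
  have hχs : ContDiff ℝ ∞ χ := χ.contDiff
  have hχ0 : ∀ y, 0 ≤ χ y := fun y => χ.nonneg
  have hχz : ∀ y, 2 < ‖y‖ → χ y = 0 := fun y hy => χ.zero_of_le_dist (by
    rw [dist_zero_right]
    exact hy.le)
  -- the bumps centered at the points of `t` have a sum bounded below by one
  set S : Rd d → ℝ := fun y => ∑ x ∈ t, rescaleFun χ 1 x y with hS
  have hSs : ContDiff ℝ ∞ S := ContDiff.sum fun x _ => rescaleFun_contDiff hχs hχc 1 x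
  have hSp : IsPeriodic S := fun n y => by
    simp only [hS]
    exact Finset.sum_congr rfl fun x _ => rescaleFun_periodic χ 1 x n y
  have hS1 : ∀ y, 1 ≤ S y := by
    intro y
    obtain ⟨n, hn⟩ := exists_add_period_mem_cell y
    obtain ⟨x, hx, hyx⟩ := mem_iUnion₂.1 (hcov (cell_subset d hn))
    have h1 : χ (y - x + period n) = 1 := by
      refine χ.one_of_mem_closedBall ?_
      rw [mem_closedBall_zero_iff]
      rw [Metric.mem_ball, dist_eq_norm] at hyx
      rw [show y - x + period n = y + period n - x by abel]
      exact hyx.le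
    calc (1 : ℝ) = χ (y - x + period n) := h1.symm
      _ ≤ rescaleFun χ 1 x y := le_rescaleFun_one hχc hχ0 x y n
      _ ≤ S y := Finset.single_le_sum (f := fun x => rescaleFun χ 1 x y)
        (fun x _ => by
          rw [rescaleFun_one]
          exact finsum_nonneg fun n => hχ0 _) hx
  have hSne : ∀ y, S y ≠ 0 := fun y => (lt_of_lt_of_le one_pos (hS1 y)).ne'
  set θ : Rd d → Rd d → ℝ := fun x w => χ w * (S (w + x))⁻¹ with hθ
  have hθs : ∀ x, ContDiff ℝ ∞ (θ x) := fun x =>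
    hχs.mul ((hSs.comp (contDiff_id.add contDiff_const)).inv fun w => hSne _)
  have hθc : ∀ x, HasCompactSupport (θ x) := fun x => hχc.mul_right
  choose M hM1 hM using fun x => exists_bound_of_compactSupport (hθs x) (hθc x)
  refine ⟨∑ x ∈ t, 4 * M x, Finset.sum_nonneg fun x _ => by linarith [hM1 x], ?_⟩
  intro F N hN hF φ B hB hB'
  have hB0 : 0 ≤ B := (abs_nonneg _).trans (hB 0)
  rcases hB0.eq_or_lt with rfl | hBpos
  · have : φ = 0 := by
      ext y
      simpa using hB y
    simp [this]
  have hφs : ContDiff ℝ ∞ (φ : Rd d → ℝ) := φ.2.1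
  have hφx : ∀ x, ContDiff ℝ ∞ fun w => (φ : Rd d → ℝ) (w + x) := fun x =>
    hφs.comp (contDiff_id.add contDiff_const)
  have hφx' : ∀ x w, ‖fderiv ℝ (fun w => (φ : Rd d → ℝ) (w + x)) w‖ ≤ B := fun x w => by
    rw [fderiv_comp_add_right]
    exact hB' _
  have hcpos : ∀ x, 0 < 2 * (M x * B) := fun x => by
    have := hM1 x
    positivity
  set ζ : Rd d → 𝓓(cube d, ℝ) := fun x =>
    toTest (fun w => (2 * (M x * B))⁻¹ * (θ x w * (φ : Rd d → ℝ) (w + x)))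
      (contDiff_const.mul ((hθs x).mul (hφx x))) 2 (by linarith [Real.pi_gt_three])
      (fun w hw => by simp [hθ, hχz w hw]) with hζ
  have hζB : ∀ x, ζ x ∈ classB (cube d) 1 := by
    intro x
    refine mem_classB_one_of_norm (fun w => ?_) fun w => ?_
    · rw [hζ, toTest_apply, abs_mul, abs_of_pos (inv_pos.2 (hcpos x)), inv_mul_le_iff₀ (hcpos x),
        mul_one, abs_mul]
      have := mul_le_mul (hM x w).1 (hB (w + x)) (abs_nonneg _) (by linarith [hM1 x])
      have := hcpos x
      linarith
    · simp only [hζ, coe_toTest]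
      rw [fderiv_const_mul (((hθs x).mul (hφx x)).differentiable (by simp) w), norm_smul,
        Real.norm_eq_abs, abs_of_pos (inv_pos.2 (hcpos x)), inv_mul_le_iff₀ (hcpos x), mul_one]
      exact norm_fderiv_mul_le (hθs x) (hφx x) (fun y => (hM x y).1) (fun y => (hM x y).2)
        (fun y => hB _) (hφx' x) w
  -- each localized piece is normalized to belong to the class of test functions of the norm
  have hdec : φ = ∑ x ∈ t, (2 * (M x * B)) • rescale (ζ x) 1 x := by
    ext y
    have h1 : ∀ x, (2 * (M x * B)) * rescaleFun (ζ x) 1 x y =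
        rescaleFun χ 1 x y * ((S y)⁻¹ * (φ : Rd d → ℝ) y) := by
      intro x
      have h2 := rescaleFun_one_mul (χ := χ) (x := x) (y := y)
        (ψ := fun y => (2 * (M x * B))⁻¹ * ((S y)⁻¹ * (φ : Rd d → ℝ) y)) (fun n y => by
          simp only [hSp n y, φ.2.2 n y])
      have h3 : (ζ x : Rd d → ℝ) = fun w => χ w *
          ((2 * (M x * B))⁻¹ * ((S (w + x))⁻¹ * (φ : Rd d → ℝ) (w + x))) := by
        funext w
        simp only [hζ, toTest_apply, hθ]
        ring
      rw [h3, h2]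
      rw [mul_left_comm, mul_inv_cancel_left₀ (hcpos x).ne']
    have h4 : ((∑ x ∈ t, (2 * (M x * B)) • rescale (ζ x) 1 x : TestFn d) : Rd d → ℝ) y =
        ∑ x ∈ t, (2 * (M x * B)) * rescaleFun (ζ x) 1 x y := by
      rw [Submodule.coe_sum, Finset.sum_apply]
      rfl
    rw [h4]
    simp only [h1]
    rw [← Finset.sum_mul, ← mul_assoc]
    change _ = S y * (S y)⁻¹ * _
    rw [mul_inv_cancel₀ (hSne y), one_mul]
  have hζF : ∀ x, ‖F.1 (rescale (ζ x) 1 x)‖ ≤ 2 * N := by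
    intro x
    have := norm_apply_rescale_of_neg hκ hN hF x 0 (hζB x)
    simpa using this
  calc ‖F.1 φ‖ = ‖∑ x ∈ t, (2 * (M x * B)) • F.1 (rescale (ζ x) 1 x)‖ := by
        conv_lhs => rw [hdec]
        rw [map_sum]
        simp only [map_smul]
    _ ≤ ∑ x ∈ t, 4 * M x * N * B := by
        refine norm_sum_le_of_le _ fun x _ => ?_
        rw [norm_smul, Real.norm_eq_abs, abs_of_pos (hcpos x)]
        calc _ ≤ 2 * (M x * B) * (2 * N) := mul_le_mul_of_nonneg_left (hζF x) (hcpos x).le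
          _ = _ := by ring
    _ = _ := by
        rw [Finset.sum_mul, Finset.sum_mul]

theorem exists_bound_testFn {d : ℕ} (φ : TestFn d) :
    ∃ B : ℝ, (∀ y, |(φ : Rd d → ℝ) y| ≤ B) ∧ ∀ y, ‖fderiv ℝ (φ : Rd d → ℝ) y‖ ≤ B := by
  have hφ' : IsPeriodic (fderiv ℝ (φ : Rd d → ℝ)) := by
    intro n y
    rw [← fderiv_comp_add_right]
    congr 1
    funext z
    exact φ.2.2 n z
  have hs : ContDiff ℝ ∞ (φ : Rd d → ℝ) := φ.2.1
  obtain ⟨B, hB⟩ := IsPeriodic.exists_bound (u := (φ : Rd d → ℝ)) φ.2.2 hs.continuous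
  obtain ⟨B', hB'⟩ := hφ'.exists_bound (hs.continuous_fderiv (by simp))
  exact ⟨max B B', fun y => (hB y).trans (le_max_left _ _),
    fun y => (hB' y).trans (le_max_right _ _)⟩

/-- The space `𝒵^{-κ}` is Hausdorff. -/
theorem eq_zero_of_hzNorm_eq_zero {d : ℕ} {κ : ℝ} (hκ : κ ∈ Set.Ioo (0 : ℝ) (1 / 2)) {F : Dist d}
    (hF : hzNorm (-κ) F = 0) : F = 0 := by
  obtain ⟨C, -, h⟩ := exists_norm_apply_le d hκ
  ext φ
  obtain ⟨B, hB, hB'⟩ := exists_bound_testFn φ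
  have := h F 0 le_rfl (by simp [hF]) φ B hB hB'
  simpa using this

/-! ### Convergence in the Hölder–Zygmund norm and completeness -/

theorem hzNorm_sub_le {d : ℕ} (α : ℝ) (f g : Dist d) :
    hzNorm α (f - g) ≤ 4 * (hzNorm α f + hzNorm α g) := by
  have h := hzNorm_le α (f := f) (g := g) (h := f - g) (a := 1) (b := 1)
    (fun φ => by simpa using enorm_sub_le (a := f.1 φ) (b := g.1 φ))
  simpa using h

/-- Convergence of a sequence of distributions in the Hölder–Zygmund norm of order `α`. -/
def HZTendsto {d : ℕ} (α : ℝ) (f : ℕ → Dist d) (F : Dist d) : Prop :=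
  Tendsto (fun n => hzNorm α (F - f n)) atTop (𝓝 0)

theorem HZTendsto.of_le {d : ℕ} {α : ℝ} {f : ℕ → Dist d} {F : Dist d} {a : ℕ → ℝ≥0∞}
    (ha : Tendsto a atTop (𝓝 0)) {c : ℝ≥0∞} (hc : c ≠ ⊤) (h : ∀ n, hzNorm α (F - f n) ≤ c * a n) :
    HZTendsto α f F := by
  have h1 : Tendsto (fun n => c * a n) atTop (𝓝 (c * 0)) := ENNReal.Tendsto.const_mul ha (Or.inr hc)
  rw [mul_zero] at h1
  exact tendsto_of_tendsto_of_tendsto_of_le_of_le tendsto_const_nhds h1 (fun _ => zero_le) h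

theorem HZTendsto.add {d : ℕ} {α : ℝ} {f g : ℕ → Dist d} {F G : Dist d} (hf : HZTendsto α f F)
    (hg : HZTendsto α g G) : HZTendsto α (fun n => f n + g n) (F + G) := by
  have h : Tendsto (fun n => hzNorm α (F - f n) + hzNorm α (G - g n)) atTop (𝓝 (0 + 0)) :=
    Tendsto.add hf hg
  rw [add_zero] at h
  refine HZTendsto.of_le h (c := 4) (by simp) fun n => ?_
  rw [add_sub_add_comm]
  exact hzNorm_add_le α _ _

theorem HZTendsto.smul {d : ℕ} {α : ℝ} {f : ℕ → Dist d} {F : Dist d} (c : ℂ)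
    (hf : HZTendsto α f F) : HZTendsto α (fun n => c • f n) (c • F) := by
  refine HZTendsto.of_le hf (c := 4 * ‖c‖ₑ) (ENNReal.mul_ne_top (by simp) (by simp)) fun n => ?_
  rw [← smul_sub c F (f n), mul_assoc]
  exact hzNorm_smul_le α c _

theorem HZTendsto.unique {d : ℕ} {κ : ℝ} (hκ : κ ∈ Set.Ioo (0 : ℝ) (1 / 2)) {f : ℕ → Dist d}
    {F G : Dist d} (hF : HZTendsto (-κ) f F) (hG : HZTendsto (-κ) f G) : F = G := by
  refine sub_eq_zero.1 (eq_zero_of_hzNorm_eq_zero hκ (le_antisymm ?_ zero_le))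
  have h : Tendsto (fun n => 4 * (hzNorm (-κ) (F - f n) + hzNorm (-κ) (G - f n))) atTop
      (𝓝 (4 * (0 + 0))) := ENNReal.Tendsto.const_mul (Tendsto.add hF hG) (Or.inr (by simp))
  rw [add_zero, mul_zero] at h
  refine ge_of_tendsto' h fun n => ?_
  have := hzNorm_sub_le (-κ) (F - f n) (G - f n)
  rwa [sub_sub_sub_cancel_right] at this

theorem HZTendsto.hzNorm_le {d : ℕ} {α : ℝ} {f : ℕ → Dist d} {F : Dist d} (hf : HZTendsto α f F)
    {b : ℕ → ℝ≥0∞} {B : ℝ≥0∞} (hb : Tendsto b atTop (𝓝 B)) (h : ∀ n, hzNorm α (f n) ≤ b n) :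
    hzNorm α F ≤ 4 * B := by
  have h1 : Tendsto (fun n => 4 * (hzNorm α (F - f n) + b n)) atTop (𝓝 (4 * (0 + B))) :=
    ENNReal.Tendsto.const_mul (Tendsto.add hf hb) (Or.inr (by simp))
  rw [zero_add] at h1
  refine ge_of_tendsto' h1 fun n => ?_
  calc hzNorm α F = hzNorm α ((F - f n) + f n) := by rw [sub_add_cancel]
    _ ≤ 4 * (hzNorm α (F - f n) + hzNorm α (f n)) := hzNorm_add_le α _ _
    _ ≤ _ := by gcongr; exact h n

theorem le_ofReal_of_lt_top {a : ℝ≥0∞} (h : a < ⊤) : a ≤ ENNReal.ofReal a.toReal :=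
  (ENNReal.ofReal_toReal h.ne).ge

/-- Convergence in norm of negative order implies convergence as distributions. -/
theorem HZTendsto.tendsto {d : ℕ} {κ : ℝ} (hκ : κ ∈ Set.Ioo (0 : ℝ) (1 / 2))
    {f : ℕ → Dist d} {F : Dist d} (hf : HZTendsto (-κ) f F) (φ : TestFn d) :
    Tendsto (fun n => (f n).1 φ) atTop (𝓝 (F.1 φ)) := by
  obtain ⟨C, hC, h⟩ := exists_norm_apply_le d hκ
  obtain ⟨B, hB, hB'⟩ := exists_bound_testFn φ
  have hlt : ∀ᶠ n in atTop, hzNorm (-κ) (F - f n) < ⊤ := hf.eventually (gt_mem_nhds (by simp))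
  have h1 : Tendsto (fun n => C * (hzNorm (-κ) (F - f n)).toReal * B) atTop (𝓝 (C * 0 * B)) := by
    refine ((ENNReal.tendsto_toReal (by simp)).comp hf).const_mul C |>.mul_const B
  rw [mul_zero, zero_mul] at h1
  rw [tendsto_iff_norm_sub_tendsto_zero]
  refine squeeze_zero' (Eventually.of_forall fun _ => norm_nonneg _) ?_ h1
  filter_upwards [hlt] with n hn
  rw [norm_sub_rev]
  exact h (F - f n) _ ENNReal.toReal_nonneg (le_ofReal_of_lt_top hn) φ B hB hB'

/-- Completeness: a Cauchy sequence in the norm of order `-κ` converges. -/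
theorem exists_hzTendsto_of_cauchy {d : ℕ} {κ : ℝ} (hκ : κ ∈ Set.Ioo (0 : ℝ) (1 / 2))
    {f : ℕ → Dist d} {a : ℕ → ℝ} (ha0 : ∀ n, 0 ≤ a n) (ha : Tendsto a atTop (𝓝 0))
    (h : ∀ m n, hzNorm (-κ) (f m - f n) ≤ ENNReal.ofReal (a m + a n)) :
    ∃ F, HZTendsto (-κ) f F := by
  obtain ⟨C, hC, hP⟩ := exists_norm_apply_le d hκ
  have hdiff : ∀ m n (φ : TestFn d) (B : ℝ), (∀ y, |(φ : Rd d → ℝ) y| ≤ B) →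
      (∀ y, ‖fderiv ℝ (φ : Rd d → ℝ) y‖ ≤ B) →
      ‖(f m).1 φ - (f n).1 φ‖ ≤ C * (a m + a n) * B := fun m n φ B hB hB' =>
    hP (f m - f n) _ (add_nonneg (ha0 m) (ha0 n)) (h m n) φ B hB hB'
  have hlim : ∀ φ : TestFn d, ∃ z, Tendsto (fun n => (f n).1 φ) atTop (𝓝 z) := by
    intro φ
    obtain ⟨B, hB, hB'⟩ := exists_bound_testFn φ
    refine cauchySeq_tendsto_of_complete (Metric.cauchySeq_iff.2 fun ε hε => ?_)
    have h1 : Tendsto (fun n => C * a n * B) atTop (𝓝 (C * 0 * B)) :=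
      (ha.const_mul C).mul_const B
    rw [mul_zero, zero_mul] at h1
    obtain ⟨N, hN⟩ := eventually_atTop.1 (h1.eventually (gt_mem_nhds (half_pos hε)))
    refine ⟨N, fun m hm n hn => ?_⟩
    rw [dist_eq_norm]
    have h2 := hdiff m n φ B hB hB'
    have h3 := hN m hm
    have h4 := hN n hn
    have h5 : C * (a m + a n) * B = C * a m * B + C * a n * B := by ring
    linarith
  choose T hT using hlim
  set L : TestFn d →ₗ[ℝ] ℂ :=
    { toFun := T
      map_add' := fun φ ψ => tendsto_nhds_unique (hT (φ + ψ)) (by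
        simpa only [map_add] using (hT φ).add (hT ψ))
      map_smul' := fun c φ => tendsto_nhds_unique (hT (c • φ)) (by
        simpa only [map_smul, RingHom.id_apply] using (hT φ).const_smul c) } with hL
  have hLd : L ∈ Dist d := by
    obtain ⟨C₀, N₀, hC₀, h₀⟩ := (f 0).2
    refine ⟨C₀ + C * a 0, max N₀ 1, add_nonneg hC₀ (mul_nonneg hC (ha0 0)), fun φ B hB => ?_⟩
    have hB0 : ∀ y, |(φ : Rd d → ℝ) y| ≤ B := fun y => by simpa using hB 0 (Nat.zero_le _) y
    have hB1 : ∀ y, ‖fderiv ℝ (φ : Rd d → ℝ) y‖ ≤ B := fun y => by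
      have := hB 1 (le_max_right _ _) y
      rwa [← norm_iteratedFDeriv_fderiv, norm_iteratedFDeriv_zero] at this
    have h1 := h₀ φ B fun k hk => hB k (hk.trans (le_max_left _ _))
    have h2 : Tendsto (fun m => C₀ * B + C * (a m + a 0) * B) atTop
        (𝓝 (C₀ * B + C * (0 + a 0) * B)) :=
      (((ha.add_const _).const_mul C).mul_const B).const_add _
    rw [zero_add, ← add_mul] at h2
    refine le_of_tendsto_of_tendsto' (hT φ).norm h2 fun m => ?_
    have h3 := norm_add_le ((f 0).1 φ) ((f m).1 φ - (f 0).1 φ)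
    rw [add_sub_cancel] at h3
    exact h3.trans (add_le_add h1 (hdiff m 0 φ B hB0 hB1))
  refine ⟨⟨L, hLd⟩, ?_⟩
  refine HZTendsto.of_le (a := fun n => ENNReal.ofReal (2 * (2 * a n))) ?_ (c := 1)
    (by simp) fun n => ?_
  · have : Tendsto (fun n => ENNReal.ofReal (2 * (2 * a n))) atTop
        (𝓝 (ENNReal.ofReal (2 * (2 * 0)))) :=
      ENNReal.tendsto_ofReal ((ha.const_mul 2).const_mul 2)
    simpa using this
  · rw [one_mul]
    refine hzNorm_neg_le hκ (by linarith [ha0 n]) fun x k φ hφ => ?_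
    have h1 : Tendsto (fun m => ‖(f m).1 (rescale φ ((2 : ℝ)⁻¹ ^ k) x) -
        (f n).1 (rescale φ ((2 : ℝ)⁻¹ ^ k) x)‖) atTop
        (𝓝 ‖L (rescale φ ((2 : ℝ)⁻¹ ^ k) x) - (f n).1 (rescale φ ((2 : ℝ)⁻¹ ^ k) x)‖) :=
      ((hT _).sub_const _).norm
    have h2 : Tendsto (fun m => 2 * ((a m + a n) * ((2 : ℝ)⁻¹ ^ k) ^ (-κ))) atTop
        (𝓝 (2 * ((0 + a n) * ((2 : ℝ)⁻¹ ^ k) ^ (-κ)))) :=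
      ((ha.add_const _).mul_const _).const_mul 2
    rw [zero_add, ← mul_assoc] at h2
    exact le_of_tendsto_of_tendsto' h1 h2 fun m =>
      norm_apply_rescale_of_neg hκ (add_nonneg (ha0 m) (ha0 n)) (h m n) x k hφ

/-- Elements of the little space are limits of smooth functions. -/
theorem exists_smooth_hzTendsto {d : ℕ} {α : ℝ} (F : LittleHZ d α) :
    ∃ g : ℕ → C(Rd d, ℂ), (∀ n, IsPeriodic (g n)) ∧ (∀ n, ContDiff ℝ ∞ (g n)) ∧
      HZTendsto α (fun n => ofFun d (g n)) F.1 ∧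
      ∀ n, hzNorm α (F.1 - ofFun d (g n)) ≤ ENNReal.ofReal (1 / ((n : ℝ) + 1)) := by
  have h : ∀ n : ℕ, (0 : ℝ≥0∞) < ENNReal.ofReal (1 / ((n : ℝ) + 1)) := fun n =>
    ENNReal.ofReal_pos.2 Nat.one_div_pos_of_nat
  choose g hp hs hg using fun n => F.2.2 _ (h n)
  refine ⟨g, hp, hs, HZTendsto.of_le (a := fun n : ℕ => ENNReal.ofReal (1 / ((n : ℝ) + 1))) ?_
    (c := 1) (by simp) fun n => by simpa using (hg n).le, fun n => (hg n).le⟩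
  have := ENNReal.tendsto_ofReal tendsto_one_div_add_atTop_nhds_zero_nat
  simpa using this

theorem hzNorm_lt_top_of_sub {d : ℕ} {α : ℝ} {F G : Dist d} (hF : hzNorm α F < ⊤)
    (h : hzNorm α (F - G) < ⊤) : hzNorm α G < ⊤ := by
  have h1 := hzNorm_sub_le α F (F - G)
  rw [sub_sub_cancel] at h1
  exact h1.trans_lt (ENNReal.mul_lt_top (by simp) (ENNReal.add_lt_top.2 ⟨hF, h⟩))

/-! ### Continuous representatives -/

/-- A continuous periodic function is determined by its distribution. -/
theorem ofFun_injective {d : ℕ} {u v : C(Rd d, ℂ)} (hu : IsPeriodic u) (hv : IsPeriodic v)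
    (h : ofFun d u = ofFun d v) : u = v := by
  obtain ⟨C, -, hC⟩ := exists_holder_bound d (κ := 1 / 8) (by norm_num)
  have hp : IsPeriodic (u - v : C(Rd d, ℂ)) := fun n y => by simp [hu n y, hv n y]
  have h0 := (hC (1 / 2) (by norm_num) (u - v) hp 0 le_rfl (by
    rw [map_sub, h, sub_self, hzNorm_zero]
    exact zero_le)).1
  ext x
  have := h0 x
  rw [mul_zero, norm_le_zero_iff, ContinuousMap.sub_apply, sub_eq_zero] at this
  exact this

theorem norm_ofFun_apply_le {d : ℕ} {u : C(Rd d, ℂ)} {e b : ℝ} (hu : ∀ y, ‖u y‖ ≤ e)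
    {φ : TestFn d} (hφ : ∀ y, |(φ : Rd d → ℝ) y| ≤ b) :
    ‖(ofFun d u).1 φ‖ ≤ b * e * volume.real (cell d) := by
  refine norm_setIntegral_le_of_norm_le_const
    (lt_of_le_of_lt (measure_mono (cell_subset d)) (isCompact_closedBall _ _).measure_lt_top)
    fun y _ => ?_
  rw [norm_mul, Complex.norm_real]
  exact mul_le_mul (hφ y) (hu y) (norm_nonneg _) ((abs_nonneg _).trans (hφ y))

/-- Every element of the little space of positive order is a continuous function: smooth
approximants converge uniformly. -/
theorem exists_continuous_rep {d : ℕ} {κ ν : ℝ} (hκ : 0 < κ) (hν : ν ∈ Set.Ioo (2 * κ) 1)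
    (U : LittleHZ d ν) : ∃ u : C(Rd d, ℂ), IsPeriodic u ∧ U.1 = ofFun d u := by
  obtain ⟨C, hC0, hC⟩ := exists_holder_bound d hκ
  obtain ⟨g, hp, -, -, hg⟩ := exists_smooth_hzTendsto U
  have hν0 : 0 ≤ ν := by linarith [hν.1]
  set ε : ℕ → ℝ := fun n => 1 / ((n : ℝ) + 1) with hε
  have hε0 : ∀ n, 0 ≤ ε n := fun n => Nat.one_div_pos_of_nat.le
  have hεt : Tendsto ε atTop (𝓝 0) := tendsto_one_div_add_atTop_nhds_zero_nat
  have hdiff : ∀ m n x, ‖g m x - g n x‖ ≤ C * (4 * (ε m + ε n)) := by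
    intro m n
    have hpp : IsPeriodic (g m - g n : C(Rd d, ℂ)) := fun k y => by simp [hp m k y, hp n k y]
    refine (hC ν hν (g m - g n) hpp _ (by have := hε0 m; have := hε0 n; positivity) ?_).1
    have h1 := hzNorm_sub_le ν (U.1 - ofFun d (g n)) (U.1 - ofFun d (g m))
    rw [sub_sub_sub_cancel_left, ← map_sub] at h1
    refine h1.trans ?_
    rw [ENNReal.ofReal_mul (by norm_num), ENNReal.ofReal_ofNat,
      ENNReal.ofReal_add (hε0 m) (hε0 n), add_comm]
    gcongr
    · exact hg m
    · exact hg n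
  have hlim : ∀ x, ∃ z, Tendsto (fun n => g n x) atTop (𝓝 z) := by
    intro x
    refine cauchySeq_tendsto_of_complete (Metric.cauchySeq_iff.2 fun δ hδ => ?_)
    have h1 : Tendsto (fun n => C * (4 * ε n)) atTop (𝓝 (C * (4 * 0))) :=
      (hεt.const_mul 4).const_mul C
    rw [mul_zero, mul_zero] at h1
    obtain ⟨N, hN⟩ := eventually_atTop.1 (h1.eventually (gt_mem_nhds (half_pos hδ)))
    refine ⟨N, fun m hm n hn => ?_⟩
    rw [dist_eq_norm]
    have h2 := hdiff m n x
    have h3 := hN m hm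
    have h4 := hN n hn
    have h5 : C * (4 * (ε m + ε n)) = C * (4 * ε m) + C * (4 * ε n) := by ring
    linarith
  choose u hu using hlim
  have hun : ∀ n x, ‖u x - g n x‖ ≤ C * (4 * ε n) := by
    intro n x
    have h1 : Tendsto (fun m => C * (4 * (ε m + ε n))) atTop (𝓝 (C * (4 * (0 + ε n)))) :=
      ((hεt.add_const _).const_mul 4).const_mul C
    rw [zero_add] at h1
    exact le_of_tendsto_of_tendsto' ((hu x).sub_const _).norm h1 fun m => hdiff m n x
  have h4t : Tendsto (fun n => C * (4 * ε n)) atTop (𝓝 0) := by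
    simpa using (hεt.const_mul 4).const_mul C
  have hunif : TendstoUniformly (fun n x => g n x) u atTop := by
    rw [Metric.tendstoUniformly_iff]
    intro δ hδ
    filter_upwards [h4t.eventually (gt_mem_nhds hδ)] with n hn x
    rw [dist_eq_norm]
    exact (hun n x).trans_lt hn
  have huc : Continuous u := hunif.continuous (Frequently.of_forall fun n => (g n).continuous)
  refine ⟨⟨u, huc⟩, fun k y => ?_, ?_⟩
  · refine tendsto_nhds_unique (hu (y + period k)) ?_
    exact (hu y).congr fun n => (hp n k y).symm
  · ext φ
    obtain ⟨B, hB, -⟩ := exists_bound_testFn φ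
    set B' : ℝ := max B 1 with hB'
    have hB'0 : 0 < B' := lt_of_lt_of_le one_pos (le_max_right _ _)
    have h1 : Tendsto (fun n => (ofFun d (g n)).1 φ) atTop (𝓝 (U.1.1 φ)) := by
      rw [tendsto_iff_norm_sub_tendsto_zero]
      have h2 : Tendsto (fun n => B' * (2 * ε n)) atTop (𝓝 0) := by
        simpa using (hεt.const_mul 2).const_mul B'
      refine squeeze_zero (fun _ => norm_nonneg _) (fun n => ?_) h2
      have h3 := norm_apply_of_nonneg hν0 (hε0 n) (hg n) (ψ := B'⁻¹ • φ) (fun y => by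
        change |B'⁻¹ * (φ : Rd d → ℝ) y| ≤ 1
        rw [abs_mul, abs_of_pos (inv_pos.2 hB'0), inv_mul_le_iff₀ hB'0, mul_one]
        exact (hB y).trans (le_max_left _ _))
      rw [map_smul, norm_smul, Real.norm_eq_abs, abs_of_pos (inv_pos.2 hB'0),
        inv_mul_le_iff₀ hB'0] at h3
      rw [norm_sub_rev]
      exact h3
    refine tendsto_nhds_unique h1 ?_
    rw [tendsto_iff_norm_sub_tendsto_zero]
    have h2 : Tendsto (fun n => B * (C * (4 * ε n)) * volume.real (cell d)) atTop (𝓝 0) := by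
      simpa using (h4t.const_mul B).mul_const (volume.real (cell d))
    refine squeeze_zero (fun _ => norm_nonneg _) (fun n => ?_) h2
    have h3 := norm_ofFun_apply_le (u := ⟨u, huc⟩ - g n) (fun y => hun n y) hB
    rw [map_sub] at h3
    rw [norm_sub_rev]
    exact h3

theorem ofFun_const_mem {d : ℕ} {ν : ℝ} (hν : 0 ≤ ν) (c : ℂ) :
    ofFun d (ContinuousMap.const (Rd d) c) ∈ LittleHZ d ν := by
  have hp : IsPeriodic (ContinuousMap.const (Rd d) c) := fun _ _ => rfl
  refine ⟨hzNorm_lt_top_of_nonneg hν (N := 1 * ‖c‖ * volume.real (cell d)) (fun ψ hψ =>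
    norm_ofFun_apply_le (fun _ => le_rfl) hψ) fun x n φ hφ => ?_,
    fun ε hε => ⟨ContinuousMap.const (Rd d) c, hp, contDiff_const, ?_⟩⟩
  · rw [ofFun_rescale hp φ (by positivity)]
    have h := hφ.2 0 (by simpa using hν)
    simp only [Pi.zero_apply, pow_zero, Finset.prod_const_one, mul_one] at h
    simp only [ContinuousMap.const_apply]
    rw [integral_mul_const, integral_complex_ofReal, h]
    simp
  · rw [sub_self, hzNorm_zero]
    exact hε

/-! ### The Young product -/

/-- The Young estimate in terms of extended norms. -/
theorem exists_hzNorm_mul_le_mul (d : ℕ) {κ : ℝ} (hκ : κ ∈ Set.Ioo (0 : ℝ) (1 / 2)) :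
    ∃ C : ℝ≥0, ∀ ν ∈ Set.Ioo (2 * κ) 1, ∀ u g : C(Rd d, ℂ),
      IsPeriodic u → IsPeriodic g → hzNorm ν (ofFun d u) < ⊤ → hzNorm (-κ) (ofFun d g) < ⊤ →
      hzNorm (-κ) (ofFun d (u * g)) ≤ C * (hzNorm ν (ofFun d u) * hzNorm (-κ) (ofFun d g)) := by
  obtain ⟨C, hC0, hC⟩ := exists_hzNorm_mul_le d hκ
  refine ⟨C.toNNReal, fun ν hν u g hu hg hu' hg' => ?_⟩
  have h := hC ν hν u g hu hg _ _ ENNReal.toReal_nonneg ENNReal.toReal_nonneg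
    (le_ofReal_of_lt_top hu') (le_ofReal_of_lt_top hg')
  rwa [ENNReal.ofReal_mul hC0.le, ENNReal.ofReal_mul ENNReal.toReal_nonneg,
    ENNReal.ofReal_toReal hu'.ne, ENNReal.ofReal_toReal hg'.ne] at h

/-- The product of an element of `𝒵_s^ν` and an element of `𝒵_s^{-κ}`, as the limit of the products
of the continuous representative of the former with approximants of the latter. -/
theorem exists_product {d : ℕ} {κ ν : ℝ} (hκ : κ ∈ Set.Ioo (0 : ℝ) (1 / 2))
    (hν : ν ∈ Set.Ioo (2 * κ) 1) {u : C(Rd d, ℂ)} (hu : IsPeriodic u)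
    (hU : ofFun d u ∈ LittleHZ d ν) (η : LittleHZ d (-κ)) :
    ∃ T : LittleHZ d (-κ), ∀ g : ℕ → C(Rd d, ℂ), (∀ n, IsPeriodic (g n)) →
      HZTendsto (-κ) (fun n => ofFun d (g n)) η.1 →
      (∀ n, hzNorm (-κ) (ofFun d (g n)) < ⊤) →
      HZTendsto (-κ) (fun n => ofFun d (u * g n)) T.1 := by
  obtain ⟨C, hC⟩ := exists_hzNorm_mul_le_mul d hκ
  obtain ⟨f, hfp, hfs, hft, hf⟩ := exists_smooth_hzTendsto η
  have hfin : ∀ n, hzNorm (-κ) (ofFun d (f n)) < ⊤ := fun n =>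
    hzNorm_lt_top_of_sub η.2.1 ((hf n).trans_lt ENNReal.ofReal_lt_top)
  set Nu := hzNorm ν (ofFun d u) with hNu
  have hNu' : Nu < ⊤ := hU.1
  have hmul : ∀ g g' : C(Rd d, ℂ), IsPeriodic g → IsPeriodic g' →
      hzNorm (-κ) (η.1 - ofFun d g) < ⊤ → hzNorm (-κ) (η.1 - ofFun d g') < ⊤ →
      hzNorm (-κ) (ofFun d (u * g) - ofFun d (u * g')) ≤
        C * (Nu * (4 * (hzNorm (-κ) (η.1 - ofFun d g) + hzNorm (-κ) (η.1 - ofFun d g')))) := by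
    intro g g' hg hg' h h'
    have hp : IsPeriodic (g - g' : C(Rd d, ℂ)) := fun k y => by simp [hg k y, hg' k y]
    have h1 := hzNorm_sub_le (-κ) (η.1 - ofFun d g') (η.1 - ofFun d g)
    rw [sub_sub_sub_cancel_left, ← map_sub, add_comm] at h1
    have h2 := hC ν hν u (g - g') hu hp hNu' (h1.trans_lt
      (ENNReal.mul_lt_top (by simp) (ENNReal.add_lt_top.2 ⟨h, h'⟩)))
    rw [← map_sub, ← mul_sub]
    exact h2.trans (by gcongr)
  set a : ℕ → ℝ := fun n => C * Nu.toReal * 4 * (1 / ((n : ℝ) + 1)) with ha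
  have ha0 : ∀ n, 0 ≤ a n := fun n => by
    have : 0 ≤ Nu.toReal := ENNReal.toReal_nonneg
    positivity
  have hat : Tendsto a atTop (𝓝 0) := by
    simpa [ha] using tendsto_one_div_add_atTop_nhds_zero_nat.const_mul (C * Nu.toReal * 4)
  obtain ⟨T, hT⟩ := exists_hzTendsto_of_cauchy hκ (f := fun n => ofFun d (u * f n)) ha0 hat
    fun m n => by
      refine (hmul (f m) (f n) (hfp m) (hfp n) ((hf m).trans_lt ENNReal.ofReal_lt_top)
        ((hf n).trans_lt ENNReal.ofReal_lt_top)).trans ?_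
      have e : ENNReal.ofReal (a m + a n) = C * (Nu * (4 * (ENNReal.ofReal (1 / ((m : ℝ) + 1)) +
          ENNReal.ofReal (1 / ((n : ℝ) + 1))))) := by
        rw [← ENNReal.ofReal_add (by positivity) (by positivity)]
        have h1 : a m + a n = (C : ℝ) * (Nu.toReal * (4 * (1 / ((m : ℝ) + 1) +
            1 / ((n : ℝ) + 1)))) := by
          simp only [ha]
          ring
        rw [h1, ENNReal.ofReal_mul (NNReal.coe_nonneg C), ENNReal.ofReal_coe_nnreal,
          ENNReal.ofReal_mul ENNReal.toReal_nonneg, ENNReal.ofReal_toReal hNu'.ne,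
          ENNReal.ofReal_mul (by norm_num), ENNReal.ofReal_ofNat]
      rw [e]
      gcongr
      · exact hf m
      · exact hf n
  have hufin : ∀ n, hzNorm (-κ) (ofFun d (u * f n)) < ⊤ := fun n =>
    (hC ν hν u (f n) hu (hfp n) hNu' (hfin n)).trans_lt
      (ENNReal.mul_lt_top (by simp) (ENNReal.mul_lt_top hNu' (hfin n)))
  have hTfin : hzNorm (-κ) T < ⊤ := by
    obtain ⟨n, hn⟩ := (hT.eventually (gt_mem_nhds (by simp : (0 : ℝ≥0∞) < ⊤))).exists
    have h1 := hzNorm_add_le (-κ) (T - ofFun d (u * f n)) (ofFun d (u * f n))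
    rw [sub_add_cancel] at h1
    exact h1.trans_lt (ENNReal.mul_lt_top (by simp) (ENNReal.add_lt_top.2 ⟨hn, hufin n⟩))
  obtain ⟨v, hvp, hvs, hvt, hv⟩ := exists_smooth_hzTendsto (⟨ofFun d u, hU⟩ : LittleHZ d ν)
  -- `T` is close to some `u f n`, which is close to a product of smooth functions
  have hTmem : T ∈ LittleHZ d (-κ) := by
    refine ⟨hTfin, fun ε hε => ?_⟩
    have hε' : 0 < ε / 4 / 2 :=
      ENNReal.div_pos (ENNReal.div_pos hε.ne' (by simp)).ne' (by simp)
    obtain ⟨n, hn⟩ := (hT.eventually (gt_mem_nhds hε')).exists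
    have h1 : Tendsto (fun m => C * hzNorm (-κ) (ofFun d (f n)) *
        hzNorm ν (ofFun d u - ofFun d (v m))) atTop
        (𝓝 (C * hzNorm (-κ) (ofFun d (f n)) * 0)) :=
      ENNReal.Tendsto.const_mul hvt (Or.inr (ENNReal.mul_ne_top (by simp) (hfin n).ne))
    rw [mul_zero] at h1
    obtain ⟨m, hm⟩ := (h1.eventually (gt_mem_nhds hε')).exists
    refine ⟨v m * f n, fun k y => by simp [hvp m k y, hfp n k y], (hvs m).mul (hfs n), ?_⟩
    have h2 : hzNorm (-κ) (ofFun d (u * f n) - ofFun d (v m * f n)) < ε / 4 / 2 := by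
      have hp : IsPeriodic (u - v m : C(Rd d, ℂ)) := fun k y => by simp [hu k y, hvp m k y]
      have h3 := hC ν hν (u - v m) (f n) hp (hfp n) (by
        rw [map_sub]
        exact (hv m).trans_lt ENNReal.ofReal_lt_top) (hfin n)
      rw [← map_sub, ← sub_mul]
      refine h3.trans_lt (lt_of_eq_of_lt ?_ hm)
      rw [map_sub]
      ring
    have e : T - ofFun d (v m * f n) = (T - ofFun d (u * f n)) +
        (ofFun d (u * f n) - ofFun d (v m * f n)) := by abel
    rw [e]
    refine (hzNorm_add_le _ _ _).trans_lt ?_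
    calc _ < 4 * (ε / 4) := by
          refine (ENNReal.mul_lt_mul_iff_right (by simp) (by simp)).2 ?_
          exact (ENNReal.add_lt_add hn h2).trans_eq (ENNReal.add_halves _)
      _ = ε := ENNReal.mul_div_cancel (by simp) (by simp)
  refine ⟨⟨T, hTmem⟩, fun g hgp hgt hgfin => ?_⟩
  have hgfin' : ∀ n, hzNorm (-κ) (η.1 - ofFun d (g n)) < ⊤ := fun n =>
    (hzNorm_sub_le _ _ _).trans_lt (ENNReal.mul_lt_top (by simp)
      (ENNReal.add_lt_top.2 ⟨η.2.1, hgfin n⟩))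
  have hlim : Tendsto (fun n => hzNorm (-κ) (T - ofFun d (u * f n)) +
      C * (Nu * (4 * (hzNorm (-κ) (η.1 - ofFun d (f n)) +
        hzNorm (-κ) (η.1 - ofFun d (g n)))))) atTop (𝓝 (0 + C * (Nu * (4 * (0 + 0))))) := by
    refine Tendsto.add hT ?_
    refine ENNReal.Tendsto.const_mul ?_ (Or.inr (by simp))
    refine ENNReal.Tendsto.const_mul ?_ (Or.inr hNu'.ne)
    exact ENNReal.Tendsto.const_mul (Tendsto.add hft hgt) (Or.inr (by simp))
  simp only [add_zero, mul_zero] at hlim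
  refine HZTendsto.of_le hlim (c := 4) (by simp) fun n => ?_
  have e : T - ofFun d (u * g n) = (T - ofFun d (u * f n)) +
      (ofFun d (u * f n) - ofFun d (u * g n)) := by abel
  change hzNorm (-κ) (T - ofFun d (u * g n)) ≤ _
  rw [e]
  refine (hzNorm_add_le _ _ _).trans ?_
  gcongr
  exact hmul (f n) (g n) (hfp n) (hgp n) ((hf n).trans_lt ENNReal.ofReal_lt_top) (hgfin' n)

/-- The product exists, is bilinear and bounded, and is computed by approximating its second
factor. -/
theorem exists_young_product {d : ℕ} {κ ν : ℝ} (hκ : κ ∈ Set.Ioo (0 : ℝ) (1 / 2))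
    (hν : ν ∈ Set.Ioo (2 * κ) 1) :
    ∃ M : LittleHZ d ν →ₗ[ℂ] LittleHZ d (-κ) →ₗ[ℂ] LittleHZ d (-κ), IsYoungProduct M ∧
      ∀ (U : LittleHZ d ν) (η : LittleHZ d (-κ)) (u : C(Rd d, ℂ)), IsPeriodic u →
      U.1 = ofFun d u → ∀ g : ℕ → C(Rd d, ℂ), (∀ n, IsPeriodic (g n)) →
      HZTendsto (-κ) (fun n => ofFun d (g n)) η.1 →
      (∀ n, hzNorm (-κ) (ofFun d (g n)) < ⊤) →
      HZTendsto (-κ) (fun n => ofFun d (u * g n)) (M U η).1 := by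
  -- `r U` is the continuous representative of `U`; its uniqueness gives linearity in `U`
  choose r hrp hr using fun U : LittleHZ d ν => exists_continuous_rep hκ.1 hν U
  have hrU : ∀ U : LittleHZ d ν, ofFun d (r U) ∈ LittleHZ d ν := fun U => by
    rw [← hr U]
    exact U.2
  have hreq : ∀ (U : LittleHZ d ν) (u : C(Rd d, ℂ)), IsPeriodic u → U.1 = ofFun d u → r U = u :=
    fun U u hu hU => ofFun_injective (hrp U) hu ((hr U).symm.trans hU)
  choose T hT using fun (U : LittleHZ d ν) (η : LittleHZ d (-κ)) =>
    exists_product hκ hν (hrp U) (hrU U) η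
  choose f hfp hfs hft hf using fun η : LittleHZ d (-κ) => exists_smooth_hzTendsto η
  have hfin : ∀ (η : LittleHZ d (-κ)) n, hzNorm (-κ) (ofFun d (f η n)) < ⊤ := fun η n =>
    hzNorm_lt_top_of_sub η.2.1 ((hf η n).trans_lt ENNReal.ofReal_lt_top)
  have hTf : ∀ U η, HZTendsto (-κ) (fun n => ofFun d (r U * f η n)) (T U η).1 := fun U η =>
    hT U η (f η) (hfp η) (hft η) (hfin η)
  set M : LittleHZ d ν →ₗ[ℂ] LittleHZ d (-κ) →ₗ[ℂ] LittleHZ d (-κ) :=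
    LinearMap.mk₂ ℂ T
      (fun U U' η => by
        refine Subtype.ext (HZTendsto.unique hκ (hTf (U + U') η) ?_)
        have e : r (U + U') = r U + r U' := hreq _ _
          (fun k y => by simp [hrp U k y, hrp U' k y]) (by
            rw [map_add, ← hr, ← hr]
            rfl)
        simp only [e, add_mul, map_add]
        exact (hTf U η).add (hTf U' η))
      (fun c U η => by
        refine Subtype.ext (HZTendsto.unique hκ (hTf (c • U) η) ?_)
        have e : r (c • U) = c • r U := hreq _ _
          (fun k y => by simp [hrp U k y]) (by
            rw [map_smul, ← hr]
            rfl)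
        simp only [e, smul_mul_assoc, map_smul]
        exact (hTf U η).smul c)
      (fun U η η' => by
        have h := hT U (η + η') (fun n => f η n + f η' n)
          (fun n k y => by simp [hfp η n k y, hfp η' n k y])
          (by
            simp only [map_add]
            exact (hft η).add (hft η'))
          (fun n => by
            rw [map_add]
            exact (hzNorm_add_le _ _ _).trans_lt (ENNReal.mul_lt_top (by simp)
              (ENNReal.add_lt_top.2 ⟨hfin η n, hfin η' n⟩)))
        refine Subtype.ext (HZTendsto.unique hκ h ?_)
        simp only [mul_add, map_add]
        exact (hTf U η).add (hTf U η'))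
      (fun c U η => by
        have h := hT U (c • η) (fun n => c • f η n)
          (fun n k y => by simp [hfp η n k y])
          (by
            simp only [map_smul]
            exact (hft η).smul c)
          (fun n => by
            rw [map_smul]
            exact (hzNorm_smul_le _ _ _).trans_lt (ENNReal.mul_lt_top (by simp)
              (ENNReal.mul_lt_top (by simp) (hfin η n))))
        refine Subtype.ext (HZTendsto.unique hκ h ?_)
        simp only [mul_smul_comm, map_smul]
        exact (hTf U η).smul c) with hM
  have hMT : ∀ U η, M U η = T U η := fun U η => rfl
  refine ⟨M, ⟨?_, ?_⟩, ?_⟩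
  · obtain ⟨C, hC⟩ := exists_hzNorm_mul_le_mul d hκ
    refine ⟨16 * C, fun U η => ?_⟩
    have hb : Tendsto (fun n => C * (hzNorm ν U.1 * (4 * (hzNorm (-κ) η.1 +
        hzNorm (-κ) (η.1 - ofFun d (f η n)))))) atTop
        (𝓝 (C * (hzNorm ν U.1 * (4 * (hzNorm (-κ) η.1 + 0))))) := by
      refine ENNReal.Tendsto.const_mul ?_ (Or.inr (by simp))
      refine ENNReal.Tendsto.const_mul ?_ (Or.inr U.2.1.ne)
      exact ENNReal.Tendsto.const_mul (Tendsto.add tendsto_const_nhds (hft η)) (Or.inr (by simp))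
    have h := HZTendsto.hzNorm_le (hTf U η) hb fun n => by
      have h1 := hzNorm_sub_le (-κ) η.1 (η.1 - ofFun d (f η n))
      rw [sub_sub_cancel] at h1
      have h2 := hC ν hν (r U) (f η n) (hrp U) (hfp η n) (hrU U).1 (hfin η n)
      rw [← hr U] at h2
      exact h2.trans (by gcongr)
    rw [hMT]
    refine h.trans (le_of_eq ?_)
    push_cast
    ring
  · intro u g hu hus hg hgs hU hη
    have e : r ⟨ofFun d u, hU⟩ = u := hreq _ _ hu rfl
    have hconst : ∀ F : Dist d, HZTendsto (-κ) (fun _ => F) F := fun F => by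
      simp [HZTendsto, hzNorm_zero]
    have h := hT ⟨ofFun d u, hU⟩ ⟨ofFun d g, hη⟩ (fun _ => g) (fun _ => hg) (hconst _)
      (fun _ => hη.1)
    rw [e] at h
    rw [hMT]
    exact HZTendsto.unique hκ h (hconst _)
  · intro U η u hu hU g hg hgt hgfin
    rw [hMT]
    have h := hT U η g hg hgt hgfin
    rwa [hreq U u hu hU] at h

/-- The values of a Young product are limits of products of smooth functions. -/
theorem IsYoungProduct.hzTendsto {d : ℕ} {κ ν : ℝ}
    {M : LittleHZ d ν →ₗ[ℂ] LittleHZ d (-κ) →ₗ[ℂ] LittleHZ d (-κ)} (hM : IsYoungProduct M)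
    (U : LittleHZ d ν) (η : LittleHZ d (-κ)) {f g : ℕ → C(Rd d, ℂ)}
    (hfp : ∀ n, IsPeriodic (f n)) (hfs : ∀ n, ContDiff ℝ ∞ (f n))
    (hf : HZTendsto ν (fun n => ofFun d (f n)) U.1) (hfin : ∀ n, ofFun d (f n) ∈ LittleHZ d ν)
    (hgp : ∀ n, IsPeriodic (g n)) (hgs : ∀ n, ContDiff ℝ ∞ (g n))
    (hg : HZTendsto (-κ) (fun n => ofFun d (g n)) η.1)
    (hgin : ∀ n, ofFun d (g n) ∈ LittleHZ d (-κ)) :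
    HZTendsto (-κ) (fun n => ofFun d (f n * g n)) (M U η).1 := by
  obtain ⟨⟨K, hK⟩, hsm⟩ := hM
  have hη : hzNorm (-κ) η.1 ≠ ⊤ := η.2.1.ne
  have hU : hzNorm ν U.1 ≠ ⊤ := U.2.1.ne
  have hlim : Tendsto (fun n => K * (hzNorm ν (U.1 - ofFun d (f n)) * hzNorm (-κ) η.1) +
      K * (4 * (hzNorm ν U.1 + hzNorm ν (U.1 - ofFun d (f n))) *
        hzNorm (-κ) (η.1 - ofFun d (g n)))) atTop
      (𝓝 (K * (0 * hzNorm (-κ) η.1) + K * (4 * (hzNorm ν U.1 + 0) * 0))) := by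
    refine Tendsto.add ?_ ?_
    · refine ENNReal.Tendsto.const_mul ?_ (Or.inr (by simp))
      exact ENNReal.Tendsto.mul_const hf (Or.inr hη)
    · refine ENNReal.Tendsto.const_mul ?_ (Or.inr (by simp))
      refine ENNReal.Tendsto.mul ?_ (Or.inr (by simp)) hg (Or.inr ?_)
      · exact ENNReal.Tendsto.const_mul (Tendsto.add tendsto_const_nhds hf) (Or.inr (by simp))
      · rw [add_zero]
        exact ENNReal.mul_ne_top (by simp) hU
  simp only [zero_mul, mul_zero, add_zero] at hlim
  refine HZTendsto.of_le hlim (c := 4) (by simp) fun n => ?_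
  set fn : LittleHZ d ν := ⟨ofFun d (f n), hfin n⟩ with hfn
  set gn : LittleHZ d (-κ) := ⟨ofFun d (g n), hgin n⟩ with hgn
  set U' : LittleHZ d ν := ⟨U.1 - ofFun d (f n), Submodule.sub_mem _ U.2 (hfin n)⟩ with hU'
  set η' : LittleHZ d (-κ) := ⟨η.1 - ofFun d (g n), Submodule.sub_mem _ η.2 (hgin n)⟩ with hη'
  have eU : U = U' + fn := Subtype.ext (sub_add_cancel U.1 (ofFun d (f n))).symm
  have eη : η = η' + gn := Subtype.ext (sub_add_cancel η.1 (ofFun d (g n))).symm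
  have e1 : (M U η).1 = (M U' η).1 + (M fn η).1 := by
    conv_lhs => rw [eU, map_add]
    rfl
  have e2 : (M fn η).1 = (M fn η').1 + (M fn gn).1 := by
    conv_lhs => rw [eη, map_add]
    rfl
  have e3 : (M fn gn).1 = ofFun d (f n * g n) :=
    hsm (f n) (g n) (hfp n) (hfs n) (hgp n) (hgs n) (hfin n) (hgin n)
  have e : (M U η).1 - ofFun d (f n * g n) = (M U' η).1 + (M fn η').1 := by
    rw [e1, e2, e3]
    abel
  change hzNorm (-κ) ((M U η).1 - ofFun d (f n * g n)) ≤ _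
  rw [e]
  refine (hzNorm_add_le _ _ _).trans ?_
  have h1 := hzNorm_sub_le ν U.1 (U.1 - ofFun d (f n))
  rw [sub_sub_cancel] at h1
  gcongr
  · exact hK U' η
  · exact (hK fn η').trans (by gcongr)

theorem mem_littleHZ_of_contDiff {d : ℕ} {α : ℝ} {g : C(Rd d, ℂ)} (hp : IsPeriodic g)
    (hs : ContDiff ℝ ∞ g) (h : hzNorm α (ofFun d g) < ⊤) : ofFun d g ∈ LittleHZ d α :=
  ⟨h, fun ε hε => ⟨g, hp, hs, by rwa [sub_self, hzNorm_zero]⟩⟩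

theorem IsYoungProduct.unique {d : ℕ} {κ ν : ℝ} (hκ : κ ∈ Set.Ioo (0 : ℝ) (1 / 2))
    {M M' : LittleHZ d ν →ₗ[ℂ] LittleHZ d (-κ) →ₗ[ℂ] LittleHZ d (-κ)} (hM : IsYoungProduct M)
    (hM' : IsYoungProduct M') : M' = M := by
  ext1 U
  ext1 η
  obtain ⟨f, hfp, hfs, hft, hf⟩ := exists_smooth_hzTendsto U
  obtain ⟨g, hgp, hgs, hgt, hg⟩ := exists_smooth_hzTendsto η
  have hfin : ∀ n, ofFun d (f n) ∈ LittleHZ d ν := fun n =>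
    mem_littleHZ_of_contDiff (hfp n) (hfs n)
      (hzNorm_lt_top_of_sub U.2.1 ((hf n).trans_lt ENNReal.ofReal_lt_top))
  have hgin : ∀ n, ofFun d (g n) ∈ LittleHZ d (-κ) := fun n =>
    mem_littleHZ_of_contDiff (hgp n) (hgs n)
      (hzNorm_lt_top_of_sub η.2.1 ((hg n).trans_lt ENNReal.ofReal_lt_top))
  exact Subtype.ext (HZTendsto.unique hκ
    (hM'.hzTendsto U η hfp hfs hft hfin hgp hgs hgt hgin)
    (hM.hzTendsto U η hfp hfs hft hfin hgp hgs hgt hgin))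

/-! ### The local estimate -/

theorem holderSeminorm_le {d : ℕ} {ν H : ℝ} (hH : 0 ≤ H) {u : Rd d → ℂ}
    (h : ∀ x y, ‖y‖ ≤ 1 → ‖u (x + y) - u x‖ ≤ H * ‖y‖ ^ ν) :
    holderSeminorm ν u ≤ ENNReal.ofReal H := by
  refine iSup_le fun x => iSup₂_le fun y hy => ?_
  rcases eq_or_ne y 0 with rfl | hy0
  · simp
  have hp : 0 < ‖y‖ ^ ν := Real.rpow_pos_of_pos (norm_pos_iff.2 hy0) _
  rw [ENNReal.div_le_iff (by simpa using hp) (by simp), ← ENNReal.ofReal_mul hH, ← ofReal_norm]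
  exact ENNReal.ofReal_le_ofReal (h x y hy)

theorem norm_sub_le_of_holderSeminorm {d : ℕ} {ν : ℝ} {u : Rd d → ℂ}
    (h : holderSeminorm ν u < ⊤) (x y : Rd d) (hy : ‖y‖ ≤ 1) :
    ‖u (x + y) - u x‖ ≤ (holderSeminorm ν u).toReal * ‖y‖ ^ ν := by
  rcases eq_or_ne y 0 with rfl | hy0
  · rw [add_zero, sub_self, norm_zero]
    exact mul_nonneg ENNReal.toReal_nonneg (Real.rpow_nonneg (norm_nonneg _) _)
  have hp : 0 < ‖y‖ ^ ν := Real.rpow_pos_of_pos (norm_pos_iff.2 hy0) _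
  have h1 : ‖u (x + y) - u x‖ₑ / ENNReal.ofReal (‖y‖ ^ ν) ≤ holderSeminorm ν u :=
    le_iSup_of_le x (le_iSup₂ (f := fun (y : Rd d) (_ : ‖y‖ ≤ 1) =>
      ‖u (x + y) - u x‖ₑ / ENNReal.ofReal (‖y‖ ^ ν)) y hy)
  rw [← ENNReal.ofReal_toReal h.ne, ENNReal.div_le_iff (by simpa using hp) (by simp),
    ← ENNReal.ofReal_mul ENNReal.toReal_nonneg, ← ofReal_norm, ENNReal.ofReal_le_ofReal_iff
    (by positivity)] at h1
  exact h1

/-- A product of two test functions of the unit ball satisfies the assumptions of the local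
estimate; the constant comes from the product rule and `‖∇φ‖ ≤ d`. -/
theorem prodTest_bounds {d : ℕ} {φ ψ : 𝓓(unitBall d, ℝ)} (hφ : φ ∈ classB (unitBall d) 1)
    (hψ : ψ ∈ classB (unitBall d) 1) :
    (∀ w, 1 < ‖w‖ → prodTest φ ψ w = 0) ∧ (∀ w, |prodTest φ ψ w| ≤ 2 * ((d + 1) * (d + 1))) ∧
      ∀ w z, |prodTest φ ψ w - prodTest φ ψ z| ≤ 2 * ((d + 1) * (d + 1)) * ‖w - z‖ := by
  have hd0 : (0 : ℝ) ≤ d := Nat.cast_nonneg d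
  have hcoe : ∀ w, prodTest φ ψ w = φ w * ψ w := fun _ => rfl
  have h1 : ∀ χ : 𝓓(unitBall d, ℝ), χ ∈ classB (unitBall d) 1 → ∀ w, |χ w| ≤ d + 1 := fun χ hχ w =>
    ((mem_classB_one_iff.1 hχ).1 w).trans (by linarith)
  have h2 : ∀ χ : 𝓓(unitBall d, ℝ), χ ∈ classB (unitBall d) 1 → ∀ w,
      ‖fderiv ℝ χ w‖ ≤ d + 1 := fun χ hχ w =>
    (norm_fderiv_le_of_mem_classB hχ w).trans (by linarith)
  refine ⟨fun w hw => ?_, fun w => ?_, ?_⟩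
  · rw [hcoe]
    have : φ w = 0 := by
      by_contra h
      have h3 : w ∈ unitBall d := φ.tsupport_subset (subset_tsupport _ h)
      have h4 : ‖w‖ < 1 := mem_ball_zero_iff.1 h3
      linarith
    rw [this, zero_mul]
  · rw [hcoe, abs_mul]
    have := mul_le_mul (h1 φ hφ w) (h1 ψ hψ w) (abs_nonneg _) (by positivity)
    have h3 : (0 : ℝ) ≤ (d + 1) * (d + 1) := by positivity
    linarith
  · refine abs_sub_le_of_norm_fderiv_le (prodTest φ ψ).contDiff fun y => ?_
    exact norm_fderiv_mul_le φ.contDiff ψ.contDiff (h1 φ hφ) (h2 φ hφ) (h1 ψ hψ) (h2 ψ hψ) y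

end HZ

theorem mainTheorem3 (d : ℕ) (hd : 0 < d) (κ : ℝ) (hκ : κ ∈ Set.Ioo (0 : ℝ) (1 / 2)) :
    ∃ C : ℝ≥0, ∀ ν ∈ Set.Ioo (2 * κ) 1,
      ∃ M : HZ.LittleHZ d ν →ₗ[ℂ] HZ.LittleHZ d (-κ) →ₗ[ℂ] HZ.LittleHZ d (-κ),
        HZ.IsYoungProduct M ∧ (∀ M', HZ.IsYoungProduct M' → M' = M) ∧
        ∀ (U : HZ.LittleHZ d ν) (η : HZ.LittleHZ d (-κ)),
          ∃ u : C(HZ.Rd d, ℂ), HZ.IsPeriodic u ∧ U.1 = HZ.ofFun d u ∧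
          ∃ V : HZ.Rd d → HZ.LittleHZ d ν,
            (∀ x, (V x).1 = HZ.ofFun d (u - ContinuousMap.const (HZ.Rd d) (u x))) ∧
            (⨆ (x : HZ.Rd d) (l ∈ Set.Ioc (0 : ℝ) 1)
                (φ ∈ HZ.classB (HZ.unitBall d) 1) (ψ ∈ HZ.classB (HZ.unitBall d) 1),
              ‖(M (V x) η).1.1 (HZ.rescale (HZ.prodTest φ ψ) l x)‖ₑ /
                ENNReal.ofReal (l ^ (ν - 3 * κ)))
              ≤ C * (HZ.holderSeminorm ν u * HZ.hzNorm (-κ) η.1) ∧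
            HZ.holderSeminorm ν u * HZ.hzNorm (-κ) η.1
              ≤ C * (HZ.hzNorm ν U.1 * HZ.hzNorm (-κ) η.1) := by
  obtain ⟨C₁, hC₁0, hC₁⟩ := HZ.exists_holder_bound d hκ.1
  obtain ⟨C₂, hC₂0, hC₂⟩ := HZ.exists_norm_integral_increment_le d hκ 1
  set b : ℝ := 2 * ((d + 1) * (d + 1)) with hb
  have hb0 : 0 ≤ b := by positivity
  refine ⟨(C₂ * (b * 4)).toNNReal + C₁.toNNReal, fun ν hν => ?_⟩
  obtain ⟨M, hM, hMlim⟩ := HZ.exists_young_product (d := d) hκ hν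
  refine ⟨M, hM, fun M' hM' => hM.unique hκ hM', fun U η => ?_⟩
  have hν0 : 0 ≤ ν := by linarith [hν.1, hκ.1]
  obtain ⟨u, hup, hu⟩ := HZ.exists_continuous_rep hκ.1 hν U
  have hUfin : HZ.hzNorm ν U.1 < ⊤ := U.2.1
  have hηfin : HZ.hzNorm (-κ) η.1 < ⊤ := η.2.1
  have hhol : HZ.holderSeminorm ν u ≤ ENNReal.ofReal (C₁ * (HZ.hzNorm ν U.1).toReal) := by
    refine HZ.holderSeminorm_le (mul_nonneg hC₁0.le ENNReal.toReal_nonneg) ?_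
    refine (hC₁ ν hν u hup _ ENNReal.toReal_nonneg ?_).2
    rw [← hu]
    exact HZ.le_ofReal_of_lt_top hUfin
  have hholfin : HZ.holderSeminorm ν u < ⊤ := hhol.trans_lt ENNReal.ofReal_lt_top
  refine ⟨u, hup, hu, fun x => ⟨HZ.ofFun d (u - ContinuousMap.const (HZ.Rd d) (u x)), ?_⟩,
    fun x => rfl, ?_, ?_⟩
  · rw [map_sub, ← hu]
    exact Submodule.sub_mem _ U.2 (HZ.ofFun_const_mem hν0 _)
  · set H : ℝ := (HZ.holderSeminorm ν u).toReal with hH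
    set N : ℝ := (HZ.hzNorm (-κ) η.1).toReal with hN
    have hH0 : 0 ≤ H := ENNReal.toReal_nonneg
    have hN0 : 0 ≤ N := ENNReal.toReal_nonneg
    refine iSup_le fun x => iSup₂_le fun l hl => iSup₂_le fun φ hφ => iSup₂_le fun ψ hψ => ?_
    obtain ⟨g, hgp, -, hgt, hg⟩ := HZ.exists_smooth_hzTendsto η
    have hlp : 0 < l ^ (ν - 3 * κ) := Real.rpow_pos_of_pos hl.1 _
    have hgN : ∀ n, HZ.hzNorm (-κ) (HZ.ofFun d (g n)) ≤
        ENNReal.ofReal (4 * (N + 1 / ((n : ℝ) + 1))) := by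
      intro n
      have h1 := HZ.hzNorm_sub_le (-κ) η.1 (η.1 - HZ.ofFun d (g n))
      rw [sub_sub_cancel] at h1
      refine h1.trans ?_
      rw [ENNReal.ofReal_mul (by norm_num), ENNReal.ofReal_ofNat,
        ENNReal.ofReal_add hN0 (by positivity), hN, ENNReal.ofReal_toReal hηfin.ne]
      gcongr
      exact hg n
    have hup' : HZ.IsPeriodic (u - ContinuousMap.const (HZ.Rd d) (u x) : C(HZ.Rd d, ℂ)) :=
      fun k y => by simp [hup k y]
    have hlim := (hMlim _ η _ hup' (rfl : (⟨HZ.ofFun d (u - ContinuousMap.const (HZ.Rd d) (u x)),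
      by
        rw [map_sub, ← hu]
        exact Submodule.sub_mem _ U.2 (HZ.ofFun_const_mem hν0 _)⟩ : HZ.LittleHZ d ν).1 = _)
      g hgp hgt fun n => (hgN n).trans_lt ENNReal.ofReal_lt_top).tendsto hκ
        (HZ.rescale (HZ.prodTest φ ψ) l x)
    obtain ⟨hφ0, hφb, hφl⟩ := HZ.prodTest_bounds hφ hψ
    have hbound : ∀ n, ‖(HZ.ofFun d ((u - ContinuousMap.const (HZ.Rd d) (u x)) * g n)).1
        (HZ.rescale (HZ.prodTest φ ψ) l x)‖ ≤
        C₂ * (b * H * (4 * (N + 1 / ((n : ℝ) + 1)))) * l ^ (ν - κ) := by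
      intro n
      rw [HZ.ofFun_rescale (fun k y => by simp [hup k y, hgp n k y]) _ hl.1]
      exact hC₂ ν hν u (g n) (hgp n) H _ b hH0 (by positivity)
        (HZ.norm_sub_le_of_holderSeminorm hholfin) (hgN n) _ hφ0 hφb hφl l hl x
    have hblim : Tendsto (fun n : ℕ => C₂ * (b * H * (4 * (N + 1 / ((n : ℝ) + 1)))) *
        l ^ (ν - κ)) atTop (𝓝 (C₂ * (b * H * (4 * (N + 0))) * l ^ (ν - κ))) :=
      ((((tendsto_one_div_add_atTop_nhds_zero_nat.const_add N).const_mul 4).const_mul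
        (b * H)).const_mul C₂).mul_const _
    have hfinal := le_of_tendsto_of_tendsto' hlim.norm hblim hbound
    have hll : l ^ (ν - κ) ≤ l ^ (ν - 3 * κ) :=
      Real.rpow_le_rpow_of_exponent_ge hl.1 hl.2 (by linarith [hκ.1])
    rw [ENNReal.div_le_iff (by simpa using hlp) (by simp), ← ofReal_norm]
    calc _ ≤ ENNReal.ofReal (C₂ * (b * 4) * (H * N) * l ^ (ν - 3 * κ)) := by
          refine ENNReal.ofReal_le_ofReal (hfinal.trans ?_)
          rw [add_zero]
          calc _ ≤ C₂ * (b * H * (4 * N)) * l ^ (ν - 3 * κ) := by gcongr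
            _ = _ := by ring
      _ = ENNReal.ofReal (C₂ * (b * 4)) * (HZ.holderSeminorm ν u * HZ.hzNorm (-κ) η.1) *
          ENNReal.ofReal (l ^ (ν - 3 * κ)) := by
          rw [ENNReal.ofReal_mul (by positivity), ENNReal.ofReal_mul (by positivity),
            ENNReal.ofReal_mul hH0, hH, hN, ENNReal.ofReal_toReal hholfin.ne,
            ENNReal.ofReal_toReal hηfin.ne]
      _ ≤ _ := by
          gcongr
          rw [ENNReal.coe_add]
          exact le_self_add
  · calc _ ≤ ENNReal.ofReal (C₁ * (HZ.hzNorm ν U.1).toReal) * HZ.hzNorm (-κ) η.1 := by gcongr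
      _ = ENNReal.ofReal C₁ * (HZ.hzNorm ν U.1 * HZ.hzNorm (-κ) η.1) := by
          rw [ENNReal.ofReal_mul hC₁0.le, ENNReal.ofReal_toReal hUfin.ne, mul_assoc]
      _ ≤ _ := by
          gcongr
          rw [ENNReal.coe_add]
          exact le_add_self
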